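/- Fix $1\le p<\infty$ and write $\mathbb C_0=\{s\in\mathbb C:\operatorname{Re}s>0\}$. For a function $f$ on $\mathbb C_0$ and $\sigma>0$ put $$M_p(\sigma,f)=\Big(\lim_{T\to\infty}\frac1{2T}\int_{-T}^{T}|f(\sigma+it)|^p\,dt\Big)^{1/p}$$ whenever the limit exists as a finite number; it exists for every Dirichlet polynomial $P(s)=\sum_{n=1}^N a_nn^{-s}$. Let $\mathscr H^p$ be the closure (completion) of the space of Dirichlet polynomials in the norm $\|P\|_p=\sup_{\sigma>0}M_p(\sigma,P)$. The coefficient functionals $P\mapsto a_n$ extend continuously to $\mathscr H^p$, and an element of $\mathscr H^p$ is identified with the Dirichlet series having the same coefficients. **Theorem.** Let $\sum_{n\ge1}a_nn^{-s}$ be a Dirichlet series that converges at some point, and suppose that its sum has an analytic continuation $f$ to $\mathbb C_0$ satisfying $$\sup_{\sigma>0}\ \sup_{T\ge1}\ \frac1{2T}\int_{-T}^{T}|f(\sigma+it)|^p\,dt<\infty.$$ Then (i) the limit defining $M_p(\sigma,f)$ exists (and is finite) for every $\sigma>0$; (ii) the function $\sigma\mapsto\log M_p(\sigma,f)$ is decreasing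 (in the weak sense, i.e. nonincreasing) and convex on $(0,\infty)$; here $M_p(\sigma,f)>0$ for every $\sigma>0$ unless $f$ is identically zero; (iii) $f$ belongs to $\mathscr H^p$, that is, there is an element of $\mathscr H^p$ with coefficients $a_1,a_2,\dots$, and its norm is $\|f\|_p=\lim_{\sigma\to0^+}M_p(\sigma,f)$. -/

import Mathlib

open Filter Topology MeasureTheory

namespace DirichletHardy

/-- The truncated mean `(1 / 2T) ∫_{-T}^{T} |f (σ + i t)| ^ p dt` on the line `Re s = σ`. -/
noncomputable def truncMean (p σ : ℝ) (f : ℂ → ℂ) (T : ℝ) : ℝ :=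
  1 / (2 * T) * ∫ t in (-T)..T, ‖f (σ + t * Complex.I)‖ ^ p

/-- The limit defining `M_p(σ, f) ^ p` exists as a (finite) real number. -/
def MeanExists (p σ : ℝ) (f : ℂ → ℂ) : Prop :=
  ∃ L : ℝ, Tendsto (truncMean p σ f) atTop (𝓝 L)

/-- `M_p(σ, f) = (lim_{T → ∞} (1 / 2T) ∫_{-T}^{T} |f (σ + i t)| ^ p dt) ^ (1 / p)`; meaningful when
`MeanExists p σ f` holds. -/
noncomputable def Mean (p σ : ℝ) (f : ℂ → ℂ) : ℝ :=
  (limUnder atTop (truncMean p σ f)) ^ (1 / p)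

/-- The Dirichlet series `∑ a n n ^ (-s)`, summed over `n = 1, 2, …` in this order, converges
(possibly only conditionally) at `s` with sum `ℓ`. The value `a 0` plays no role. -/
def SeriesConvergesTo (a : ℕ → ℂ) (s ℓ : ℂ) : Prop :=
  Tendsto (fun N : ℕ => ∑ n ∈ Finset.Icc 1 N, a n * (n : ℂ) ^ (-s)) atTop (𝓝 ℓ)

/-- The value at `s` of the Dirichlet polynomial with coefficients `P`. -/
noncomputable def evalPoly (P : ℕ+ →₀ ℂ) (s : ℂ) : ℂ :=
  P.sum fun n c => c * (n : ℂ) ^ (-s)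

/-- Dirichlet polynomials, given by their coefficients, to be normed by `‖·‖_p`. -/
def DirichletPolynomial (_p : ℝ) : Type := ℕ+ →₀ ℂ

noncomputable instance (p : ℝ) : AddCommGroup (DirichletPolynomial p) :=
  inferInstanceAs (AddCommGroup (ℕ+ →₀ ℂ))

noncomputable instance (p : ℝ) : Module ℂ (DirichletPolynomial p) :=
  inferInstanceAs (Module ℂ (ℕ+ →₀ ℂ))

/-- The norm `‖P‖_p = sup_{σ > 0} M_p(σ, P)` of a Dirichlet polynomial. -/
noncomputable instance (p : ℝ) : Norm (DirichletPolynomial p) where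
  norm P := ⨆ σ : Set.Ioi (0 : ℝ), Mean p σ (evalPoly P)

/-! ### The means of Dirichlet polynomials exist -/

/-- Trigonometric polynomials on the real line. -/
def trig : Submodule ℂ (ℝ → ℂ) :=
  Submodule.span ℂ (Set.range fun (l : ℝ) (t : ℝ) => Complex.exp (l * t * Complex.I))

theorem exp_mem_trig (l : ℝ) : (fun t : ℝ => Complex.exp (l * t * Complex.I)) ∈ trig :=
  Submodule.subset_span ⟨l, rfl⟩

theorem zero_mem_trig : (fun _ : ℝ => (0 : ℂ)) ∈ trig := trig.zero_mem

theorem one_mem_trig : (fun _ : ℝ => (1 : ℂ)) ∈ trig := by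
  simpa using exp_mem_trig 0

theorem mul_mem_trig {f g : ℝ → ℂ} (hf : f ∈ trig) (hg : g ∈ trig) :
    (fun t => f t * g t) ∈ trig := by
  induction hf using Submodule.span_induction with
  | mem f hf =>
    obtain ⟨l, rfl⟩ := hf
    induction hg using Submodule.span_induction with
    | mem g hg =>
      obtain ⟨m, rfl⟩ := hg
      convert exp_mem_trig (l + m) using 2
      rw [← Complex.exp_add]; congr 1; push_cast; ring
    | zero => simpa only [Pi.zero_apply, zero_mul, mul_zero] using zero_mem_trig
    | add x y _ _ hx hy => simpa [mul_add] using! trig.add_mem hx hy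
    | smul c x _ hx => simpa [mul_left_comm] using! trig.smul_mem c hx
  | zero => simpa only [Pi.zero_apply, zero_mul, mul_zero] using zero_mem_trig
  | add x y _ _ hx hy => simpa [add_mul] using! trig.add_mem hx hy
  | smul c x _ hx => simpa [mul_assoc] using! trig.smul_mem c hx

theorem conj_mem_trig {f : ℝ → ℂ} (hf : f ∈ trig) :
    (fun t => (starRingEnd ℂ) (f t)) ∈ trig := by
  induction hf using Submodule.span_induction with
  | mem f hf =>
    obtain ⟨l, rfl⟩ := hf
    convert exp_mem_trig (-l) using 2
    simp [← Complex.exp_conj]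
  | zero => simpa only [Pi.zero_apply, map_zero] using zero_mem_trig
  | add x y _ _ hx hy => simpa using! trig.add_mem hx hy
  | smul c x _ hx => simpa using! trig.smul_mem ((starRingEnd ℂ) c) hx

theorem continuous_of_mem_trig {f : ℝ → ℂ} (hf : f ∈ trig) : Continuous f := by
  induction hf using Submodule.span_induction with
  | mem f hf => obtain ⟨l, rfl⟩ := hf; fun_prop
  | zero => exact continuous_const
  | add x y _ _ hx hy => exact hx.add hy
  | smul c x _ hx => exact hx.const_smul c

theorem tendsto_mean_exp (l : ℝ) :
    Tendsto (fun T : ℝ => 1 / (2 * T : ℂ) * ∫ t in (-T)..T, Complex.exp (l * t * Complex.I))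
      atTop (𝓝 (if l = 0 then 1 else 0)) := by
  by_cases hl : l = 0
  · subst hl
    refine Tendsto.congr' ?_ tendsto_const_nhds
    filter_upwards [eventually_gt_atTop 0] with T hT
    have : (T : ℂ) ≠ 0 := by exact_mod_cast hT.ne'
    simp
    field_simp
    norm_num
  · rw [if_neg hl]
    have hc : (l * Complex.I : ℂ) ≠ 0 := by simp [hl]
    refine squeeze_zero_norm' (a := fun T : ℝ => (1 / |l|) * T⁻¹) ?_ ?_
    · filter_upwards [eventually_gt_atTop 0] with T hT
      have h1 := integral_exp_mul_complex (a := -T) (b := T) hc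
      have h2 : (fun t : ℝ => Complex.exp (l * t * Complex.I)) =
          fun t : ℝ => Complex.exp (l * Complex.I * t) := by
        ext t; congr 1; ring
      have e : ∀ x : ℝ, ‖Complex.exp (l * Complex.I * x)‖ = 1 := fun x => by
        rw [show (l * Complex.I * x : ℂ) = ((l * x : ℝ) : ℂ) * Complex.I by push_cast; ring]
        exact Complex.norm_exp_ofReal_mul_I _
      rw [h2, h1, norm_mul, norm_div _ (l * Complex.I : ℂ)]
      have h3 := norm_sub_le (Complex.exp (l * Complex.I * T))
        (Complex.exp (l * Complex.I * (-T : ℝ)))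
      rw [e, e] at h3
      have h4 : ‖(1 / (2 * T) : ℂ)‖ = 1 / (2 * T) := by
        simp [abs_of_pos hT]
      have h5 : ‖(l * Complex.I : ℂ)‖ = |l| := by simp
      rw [h4, h5]
      have : 0 < |l| := abs_pos.mpr hl
      calc _ ≤ 1 / (2 * T) * ((1 + 1) / |l|) := by gcongr
        _ = _ := by field_simp; norm_num
    · simpa using tendsto_inv_atTop_zero.const_mul (1 / |l|)

theorem exists_mean_of_mem_trig {f : ℝ → ℂ} (hf : f ∈ trig) :
    ∃ L : ℂ, Tendsto (fun T : ℝ => 1 / (2 * T : ℂ) * ∫ t in (-T)..T, f t) atTop (𝓝 L) := by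
  induction hf using Submodule.span_induction with
  | mem f hf => obtain ⟨l, rfl⟩ := hf; exact ⟨_, tendsto_mean_exp l⟩
  | zero => exact ⟨0, by simp⟩
  | add x y hx hy hx' hy' =>
    obtain ⟨L, hL⟩ := hx'
    obtain ⟨K, hK⟩ := hy'
    refine ⟨L + K, (hL.add hK).congr fun T => ?_⟩
    have := intervalIntegral.integral_add (μ := volume)
      ((continuous_of_mem_trig hx).intervalIntegrable (-T) T)
      ((continuous_of_mem_trig hy).intervalIntegrable (-T) T)
    simp only [Pi.add_apply]
    rw [this]; ring
  | smul c x hx hx' =>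
    obtain ⟨L, hL⟩ := hx'
    refine ⟨c * L, (hL.const_mul c).congr fun T => ?_⟩
    simp only [Pi.smul_apply, smul_eq_mul, intervalIntegral.integral_const_mul]; ring

theorem exists_bound_of_mem_trig {f : ℝ → ℂ} (hf : f ∈ trig) : ∃ B : ℝ, ∀ t, ‖f t‖ ≤ B := by
  induction hf using Submodule.span_induction with
  | mem f hf =>
    obtain ⟨l, rfl⟩ := hf
    refine ⟨1, fun t => ?_⟩
    dsimp only
    rw [show (l * t * Complex.I : ℂ) = ((l * t : ℝ) : ℂ) * Complex.I by push_cast; ring]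
    exact (Complex.norm_exp_ofReal_mul_I _).le
  | zero => exact ⟨0, by simp⟩
  | add x y _ _ hx hy =>
    obtain ⟨B, hB⟩ := hx
    obtain ⟨C, hC⟩ := hy
    exact ⟨B + C, fun t => (norm_add_le _ _).trans (add_le_add (hB t) (hC t))⟩
  | smul c x _ hx =>
    obtain ⟨B, hB⟩ := hx
    exact ⟨‖c‖ * B, fun t => by
      simpa using mul_le_mul_of_nonneg_left (hB t) (norm_nonneg c)⟩

theorem polynomial_mem_trig {f : ℝ → ℂ} (hf : f ∈ trig) (q : Polynomial ℝ) :
    (fun t => ((q.eval (‖f t‖ ^ 2) : ℝ) : ℂ)) ∈ trig := by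
  have hsq : (fun t => ((‖f t‖ ^ 2 : ℝ) : ℂ)) ∈ trig := by
    convert mul_mem_trig hf (conj_mem_trig hf) using 2 with t
    rw [Complex.mul_conj, Complex.normSq_eq_norm_sq]
  have hpow : ∀ n : ℕ, (fun t => ((‖f t‖ ^ 2 : ℝ) : ℂ) ^ n) ∈ trig := by
    intro n
    induction n with
    | zero => simpa using one_mem_trig
    | succ n ih => simpa only [pow_succ] using mul_mem_trig ih hsq
  induction q using Polynomial.induction_on' with
  | add q r hq hr => simpa using! trig.add_mem hq hr
  | monomial n c =>
    simpa using! trig.smul_mem (c : ℂ) (hpow n)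

theorem exists_mean_norm_rpow {f : ℝ → ℂ} (hf : f ∈ trig) {p : ℝ} (hp : 0 < p) :
    ∃ L : ℝ, Tendsto (fun T : ℝ => 1 / (2 * T) * ∫ t in (-T)..T, ‖f t‖ ^ p) atTop (𝓝 L) := by
  obtain ⟨B, hB⟩ := exists_bound_of_mem_trig hf
  have hcont := continuous_of_mem_trig hf
  have hcp : Continuous fun t => ‖f t‖ ^ p := hcont.norm.rpow_const fun _ => Or.inr hp.le
  refine cauchySeq_tendsto_of_complete (Metric.cauchySeq_iff'.2 fun ε hε => ?_)
  obtain ⟨q, hq⟩ := exists_polynomial_near_of_continuousOn 0 (B ^ 2) (fun x => x ^ (p / 2))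
    (Real.continuous_rpow_const (by positivity)).continuousOn (ε / 4) (by positivity)
  have hqc : Continuous fun t => q.eval (‖f t‖ ^ 2) := q.continuous.comp (hcont.norm.pow 2)
  have hnear : ∀ t, |‖f t‖ ^ p - q.eval (‖f t‖ ^ 2)| ≤ ε / 4 := by
    intro t
    have h := hq (‖f t‖ ^ 2) ⟨by positivity, by gcongr; exact hB t⟩
    have h2 : (‖f t‖ ^ 2) ^ (p / 2) = ‖f t‖ ^ p := by
      rw [← Real.rpow_natCast, ← Real.rpow_mul (norm_nonneg _)]
      congr 1; push_cast; ring
    simp only [h2] at h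
    rw [abs_sub_comm]
    exact h.le
  obtain ⟨L, hL⟩ := exists_mean_of_mem_trig (polynomial_mem_trig hf q)
  have hL' : Tendsto (fun T : ℝ => 1 / (2 * T) * ∫ t in (-T)..T, q.eval (‖f t‖ ^ 2)) atTop
      (𝓝 L.re) := by
    refine ((Complex.continuous_re.tendsto L).comp hL).congr fun T => ?_
    simp only [Function.comp]
    rw [intervalIntegral.integral_ofReal, ← Complex.ofReal_re (1 / (2 * T) * _)]
    push_cast; rfl
  have hclose : ∀ T : ℝ, 0 < T → |1 / (2 * T) * (∫ t in (-T)..T, ‖f t‖ ^ p) -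
      1 / (2 * T) * ∫ t in (-T)..T, q.eval (‖f t‖ ^ 2)| ≤ ε / 4 := by
    intro T hT
    rw [← mul_sub, ← intervalIntegral.integral_sub (hcp.intervalIntegrable _ _)
      (hqc.intervalIntegrable _ _), abs_mul, abs_of_pos (by positivity)]
    have := intervalIntegral.norm_integral_le_of_norm_le_const (a := -T) (b := T)
      (f := fun t => ‖f t‖ ^ p - q.eval (‖f t‖ ^ 2)) fun t _ => hnear t
    rw [Real.norm_eq_abs, show T - -T = 2 * T by ring, abs_of_pos (by positivity : 0 < 2 * T)]
      at this
    calc _ ≤ 1 / (2 * T) * (ε / 4 * (2 * T)) := by gcongr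
      _ = ε / 4 := by field_simp
  obtain ⟨N, hN⟩ := eventually_atTop.1 ((hL'.eventually (Metric.ball_mem_nhds _
    (by positivity : 0 < ε / 4))).and (eventually_gt_atTop 0))
  refine ⟨N, fun T hT => ?_⟩
  have a1 := hclose T (hN T hT).2
  have a2 := hclose N (hN N le_rfl).2
  have b1 := (hN T hT).1
  have b2 := (hN N le_rfl).1
  rw [Real.dist_eq, abs_lt] at b1 b2
  rw [abs_le] at a1 a2
  rw [Real.dist_eq, abs_lt]
  constructor <;> linarith [a1.1, a1.2, a2.1, a2.2, b1.1, b1.2, b2.1, b2.2]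

theorem natCast_cpow_eq (n : ℕ+) (σ t : ℝ) :
    (n : ℂ) ^ (-(σ + t * Complex.I) : ℂ) = ((n : ℝ) ^ (-σ) : ℝ) *
      Complex.exp ((-Real.log n : ℝ) * t * Complex.I) := by
  have hn : ((n : ℕ) : ℂ) ≠ 0 := by simp
  have hn' : (0 : ℝ) < (n : ℕ) := by exact_mod_cast n.pos
  rw [Complex.cpow_def_of_ne_zero hn, Real.rpow_def_of_pos hn', Complex.ofReal_exp,
    ← Complex.exp_add]
  congr 1
  rw [← Complex.natCast_log]
  push_cast
  ring

theorem evalPoly_line_mem_trig (P : ℕ+ →₀ ℂ) (σ : ℝ) :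
    (fun t : ℝ => evalPoly P (σ + t * Complex.I)) ∈ trig := by
  have : (fun t : ℝ => evalPoly P (σ + t * Complex.I)) = ∑ n ∈ P.support,
      (P n * ((n : ℝ) ^ (-σ) : ℝ)) •
        fun t : ℝ => Complex.exp ((-Real.log n : ℝ) * t * Complex.I) := by
    ext t
    simp only [evalPoly, Finsupp.sum, Finset.sum_apply, Pi.smul_apply, smul_eq_mul]
    refine Finset.sum_congr rfl fun n _ => ?_
    rw [natCast_cpow_eq]; ring
  rw [this]
  exact trig.sum_mem fun n _ => trig.smul_mem _ (exp_mem_trig _)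

theorem meanExists_evalPoly {p : ℝ} (hp : 0 < p) (σ : ℝ) (P : ℕ+ →₀ ℂ) :
    MeanExists p σ (evalPoly P) :=
  exists_mean_norm_rpow (evalPoly_line_mem_trig P σ) hp

/-! ### The norm axioms -/

theorem truncMean_nonneg (p σ : ℝ) (f : ℂ → ℂ) {T : ℝ} (hT : 0 < T) : 0 ≤ truncMean p σ f T := by
  unfold truncMean
  have := intervalIntegral.integral_nonneg (μ := volume) (by linarith : -T ≤ T)
    fun t _ => Real.rpow_nonneg (norm_nonneg (f (σ + t * Complex.I))) p
  positivity

theorem MeanExists.tendsto {p σ : ℝ} {f : ℂ → ℂ} (hp : 0 < p) (h : MeanExists p σ f) :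
    Tendsto (fun T => truncMean p σ f T ^ (1 / p)) atTop (𝓝 (Mean p σ f)) :=
  (tendsto_nhds_limUnder h).rpow_const (Or.inr (by positivity))

theorem MeanExists.mean_nonneg {p σ : ℝ} {f : ℂ → ℂ} (hp : 0 < p) (h : MeanExists p σ f) :
    0 ≤ Mean p σ f :=
  ge_of_tendsto (h.tendsto hp) ((eventually_gt_atTop 0).mono fun _ hT =>
    Real.rpow_nonneg (truncMean_nonneg p σ f hT) _)

theorem truncMean_rpow_eq {p : ℝ} (hp : 1 ≤ p) (σ : ℝ) {f : ℂ → ℂ}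
    (hf : Continuous fun t : ℝ => f (σ + t * Complex.I)) {T : ℝ} (hT : 0 < T) :
    truncMean p σ f T ^ (1 / p) = (1 / (2 * T)) ^ (1 / p) *
      lpNorm (fun t : ℝ => f (σ + t * Complex.I)) (ENNReal.ofReal p)
        (volume.restrict (Set.Ioc (-T) T)) := by
  have hp0 : 0 < p := by linarith
  rw [lpNorm_eq_integral_norm_rpow_toReal (by simpa using hp0) ENNReal.ofReal_ne_top
    hf.aestronglyMeasurable, ENNReal.toReal_ofReal hp0.le, truncMean,
    intervalIntegral.integral_of_le (by linarith), Real.mul_rpow (by positivity)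
    (integral_nonneg fun t => by positivity), one_div p]

theorem truncMean_add_le {p : ℝ} (hp : 1 ≤ p) (σ : ℝ) {f g : ℂ → ℂ}
    (hf : Continuous fun t : ℝ => f (σ + t * Complex.I))
    (hg : Continuous fun t : ℝ => g (σ + t * Complex.I)) {T : ℝ} (hT : 0 < T) :
    truncMean p σ (fun s => f s + g s) T ^ (1 / p) ≤
      truncMean p σ f T ^ (1 / p) + truncMean p σ g T ^ (1 / p) := by
  rw [truncMean_rpow_eq hp σ hf hT, truncMean_rpow_eq hp σ hg hT,
    truncMean_rpow_eq (f := fun s => f s + g s) hp σ (hf.add hg) hT, ← mul_add]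
  have hmem : MemLp (fun t : ℝ => f (σ + t * Complex.I)) (ENNReal.ofReal p)
      (volume.restrict (Set.Ioc (-T) T)) := by
    obtain ⟨B, hB⟩ := (isCompact_Icc (a := -T) (b := T)).exists_bound_of_continuousOn
      hf.continuousOn
    refine MemLp.of_bound hf.aestronglyMeasurable B ?_
    filter_upwards [ae_restrict_mem measurableSet_Ioc] with t ht
    exact hB t (Set.Ioc_subset_Icc_self ht)
  gcongr
  exact lpNorm_add_le hmem (by simpa using hp)

theorem evalPoly_add (P Q : ℕ+ →₀ ℂ) : evalPoly (P + Q) = fun s => evalPoly P s + evalPoly Q s := by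
  ext s
  exact Finsupp.sum_add_index' (by simp) (by intros; ring)

theorem evalPoly_smul (c : ℂ) (P : ℕ+ →₀ ℂ) : evalPoly (c • P) = fun s => c * evalPoly P s := by
  ext s
  rw [evalPoly, Finsupp.sum_smul_index (by simp), evalPoly, Finsupp.mul_sum]
  exact Finsupp.sum_congr fun n _ => by ring

theorem mean_add_le {p : ℝ} (hp : 1 ≤ p) (σ : ℝ) (P Q : ℕ+ →₀ ℂ) :
    Mean p σ (evalPoly (P + Q)) ≤ Mean p σ (evalPoly P) + Mean p σ (evalPoly Q) := by
  have hp0 : 0 < p := by linarith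
  refine le_of_tendsto_of_tendsto ((meanExists_evalPoly hp0 σ (P + Q)).tendsto hp0)
    (((meanExists_evalPoly hp0 σ P).tendsto hp0).add
      ((meanExists_evalPoly hp0 σ Q).tendsto hp0)) ?_
  filter_upwards [eventually_gt_atTop 0] with T hT
  rw [evalPoly_add]
  exact truncMean_add_le hp σ (continuous_of_mem_trig (evalPoly_line_mem_trig P σ))
    (continuous_of_mem_trig (evalPoly_line_mem_trig Q σ)) hT

theorem mean_smul {p : ℝ} (hp : 1 ≤ p) (σ : ℝ) (c : ℂ) (P : ℕ+ →₀ ℂ) :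
    Mean p σ (evalPoly (c • P)) = ‖c‖ * Mean p σ (evalPoly P) := by
  have hp0 : 0 < p := by linarith
  refine tendsto_nhds_unique ((meanExists_evalPoly hp0 σ (c • P)).tendsto hp0)
    ((((meanExists_evalPoly hp0 σ P).tendsto hp0).const_mul ‖c‖).congr' ?_)
  filter_upwards [eventually_gt_atTop 0] with T hT
  have h : truncMean p σ (evalPoly (c • P)) T = ‖c‖ ^ p * truncMean p σ (evalPoly P) T := by
    simp only [truncMean, evalPoly_smul, norm_mul, Real.mul_rpow (norm_nonneg _) (norm_nonneg _),
      intervalIntegral.integral_const_mul]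
    ring
  rw [h, Real.mul_rpow (by positivity) (truncMean_nonneg p σ _ hT), ← Real.rpow_mul
    (norm_nonneg _), mul_one_div_cancel hp0.ne', Real.rpow_one]

theorem mean_le_of_norm_le {p : ℝ} (hp : 1 ≤ p) {σ B : ℝ} (hB0 : 0 ≤ B) {f : ℂ → ℂ}
    (h : MeanExists p σ f) (hB : ∀ t : ℝ, ‖f (σ + t * Complex.I)‖ ≤ B) :
    Mean p σ f ≤ B := by
  have hp0 : 0 < p := by linarith
  refine le_of_tendsto (h.tendsto hp0) ?_
  filter_upwards [eventually_gt_atTop 0] with T hT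
  have h1 := intervalIntegral.norm_integral_le_of_norm_le_const (a := -T) (b := T)
    (f := fun t : ℝ => ‖f (σ + t * Complex.I)‖ ^ p) (C := B ^ p) fun t _ => by
      rw [Real.norm_of_nonneg (by positivity)]
      exact Real.rpow_le_rpow (norm_nonneg _) (hB t) hp0.le
  rw [show T - -T = 2 * T by ring, abs_of_pos (by positivity : 0 < 2 * T)] at h1
  have h2 : truncMean p σ f T ≤ B ^ p :=
    calc _ ≤ 1 / (2 * T) * (B ^ p * (2 * T)) := by
          unfold truncMean
          gcongr
          exact (le_abs_self _).trans h1
      _ = B ^ p := by field_simp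
  calc _ ≤ (B ^ p) ^ (1 / p) :=
        Real.rpow_le_rpow (truncMean_nonneg p σ f hT) h2 (by positivity)
    _ = B := by rw [← Real.rpow_mul hB0, mul_one_div_cancel hp0.ne', Real.rpow_one]

theorem bddAbove_mean {p : ℝ} (hp : 1 ≤ p) (P : ℕ+ →₀ ℂ) :
    BddAbove (Set.range fun σ : Set.Ioi (0 : ℝ) => Mean p σ (evalPoly P)) := by
  refine ⟨∑ n ∈ P.support, ‖P n‖, ?_⟩
  rintro _ ⟨⟨σ, hσ⟩, rfl⟩
  refine mean_le_of_norm_le hp (Finset.sum_nonneg fun _ _ => norm_nonneg _)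
    (meanExists_evalPoly (by linarith) σ P) fun t => ?_
  refine (norm_sum_le _ _).trans (Finset.sum_le_sum fun n _ => ?_)
  have hn : ‖((n : ℕ) : ℂ) ^ (-(σ + t * Complex.I) : ℂ)‖ ≤ 1 := by
    rw [Complex.norm_natCast_cpow_of_pos n.pos]
    refine Real.rpow_le_one_of_one_le_of_nonpos (by exact_mod_cast n.pos) ?_
    simpa using (Set.mem_Ioi.1 hσ).le
  rw [norm_mul]
  exact mul_le_of_le_one_right (norm_nonneg _) hn

theorem mean_le_norm {p : ℝ} (hp : 1 ≤ p) (P : DirichletPolynomial p) {σ : ℝ} (hσ : 0 < σ) :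
    Mean p σ (evalPoly P) ≤ ‖P‖ :=
  le_ciSup (bddAbove_mean hp P) (⟨σ, hσ⟩ : Set.Ioi (0 : ℝ))

theorem seminormCore {p : ℝ} (hp : 1 ≤ p) : SeminormedSpace.Core ℂ (DirichletPolynomial p) where
  norm_nonneg P := Real.iSup_nonneg fun σ =>
    (meanExists_evalPoly (by linarith) σ P).mean_nonneg (by linarith)
  norm_smul c P := by
    change (⨆ σ : Set.Ioi (0 : ℝ), Mean p σ (evalPoly (c • (P : ℕ+ →₀ ℂ)))) = _
    exact (iSup_congr fun σ : Set.Ioi (0 : ℝ) => mean_smul hp σ c P).trans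
      (Real.mul_iSup_of_nonneg (norm_nonneg c) _).symm
  norm_triangle P Q := by
    have : Nonempty (Set.Ioi (0 : ℝ)) := ⟨⟨1, by simp⟩⟩
    exact ciSup_le fun σ => (mean_add_le hp σ P Q).trans
      (add_le_add (mean_le_norm hp P σ.2) (mean_le_norm hp Q σ.2))

variable (p : ℝ) [hp : Fact (1 ≤ p)]

noncomputable instance : SeminormedAddCommGroup (DirichletPolynomial p) :=
  SeminormedAddCommGroup.ofCore (seminormCore hp.out)

noncomputable instance : NormedSpace ℂ (DirichletPolynomial p) where
  norm_smul_le c P := ((seminormCore hp.out).norm_smul c P).le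

/-! ### The space and its coefficient functionals -/

theorem truncMean_one_le {p : ℝ} (hp : 1 ≤ p) (σ : ℝ) {f : ℂ → ℂ}
    (hf : Continuous fun t : ℝ => f (σ + t * Complex.I)) {T : ℝ} (hT : 0 < T) :
    1 / (2 * T) * (∫ t in (-T)..T, ‖f (σ + t * Complex.I)‖) ≤ truncMean p σ f T ^ (1 / p) := by
  have hp0 : 0 < p := by linarith
  have hpc : Continuous fun t : ℝ => ‖f (σ + t * Complex.I)‖ ^ p :=
    hf.norm.rpow_const fun _ => Or.inr hp0.le
  have hvol : volume (Set.Ioc (-T) T) = ENNReal.ofReal (2 * T) := by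
    rw [Real.volume_Ioc]; congr 1; ring
  have havg : ∀ h : ℝ → ℝ, ⨍ t in Set.Ioc (-T) T, h t = 1 / (2 * T) * ∫ t in (-T)..T, h t := by
    intro h
    rw [setAverage_eq, intervalIntegral.integral_of_le (by linarith), Measure.real, hvol,
      ENNReal.toReal_ofReal (by positivity), smul_eq_mul, one_div]
  have hJ := (convexOn_rpow hp).map_set_average_le (μ := volume) (t := Set.Ioc (-T) T)
    (f := fun t : ℝ => ‖f (σ + t * Complex.I)‖)
    (Real.continuous_rpow_const hp0.le).continuousOn isClosed_Ici
    (by rw [hvol]; simpa using hT) (by rw [hvol]; exact ENNReal.ofReal_ne_top)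
    (Eventually.of_forall fun t => norm_nonneg _)
    (hf.norm.integrableOn_Ioc) hpc.integrableOn_Ioc
  rw [havg, havg] at hJ
  have h0 : 0 ≤ 1 / (2 * T) * ∫ t in (-T)..T, ‖f (σ + t * Complex.I)‖ := by
    have := intervalIntegral.integral_nonneg (μ := volume) (by linarith : -T ≤ T)
      fun t _ => norm_nonneg (f (σ + t * Complex.I))
    positivity
  have h1 := Real.rpow_le_rpow (by positivity) hJ (by positivity : 0 ≤ 1 / p)
  rwa [← Real.rpow_mul h0, mul_one_div_cancel hp0.ne', Real.rpow_one] at h1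

theorem tendsto_coeff (P : ℕ+ →₀ ℂ) (σ : ℝ) (n : ℕ+) :
    Tendsto (fun T : ℝ => 1 / (2 * T : ℂ) * ∫ t in (-T)..T,
      evalPoly P (σ + t * Complex.I) * Complex.exp ((Real.log n : ℝ) * t * Complex.I)) atTop
      (𝓝 (P n * ((n : ℝ) ^ (-σ) : ℝ))) := by
  have h1 : ∀ m : ℕ+, Tendsto (fun T : ℝ => (P m * ((m : ℝ) ^ (-σ) : ℝ)) *
      (1 / (2 * T : ℂ) * ∫ t in (-T)..T,
        Complex.exp ((Real.log n - Real.log m : ℝ) * t * Complex.I))) atTop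
      (𝓝 ((P m * ((m : ℝ) ^ (-σ) : ℝ)) * if Real.log n - Real.log m = 0 then 1 else 0)) :=
    fun m => (tendsto_mean_exp _).const_mul _
  have h2 := tendsto_finsetSum P.support fun m _ => h1 m
  have h3 : ∑ m ∈ P.support, (P m * ((m : ℝ) ^ (-σ) : ℝ)) *
      (if Real.log n - Real.log m = 0 then 1 else 0 : ℂ) = P n * ((n : ℝ) ^ (-σ) : ℝ) := by
    rw [Finset.sum_eq_single n]
    · simp
    · intro m _ hmn
      rw [if_neg, mul_zero]
      intro h
      apply hmn
      have := Real.log_injOn_pos (by simp) (by simp) (sub_eq_zero.1 h)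
      exact_mod_cast this.symm
    · intro h
      simp [Finsupp.notMem_support_iff.1 h]
  rw [h3] at h2
  refine h2.congr fun T => ?_
  have h4 : (fun t : ℝ => evalPoly P (σ + t * Complex.I) *
      Complex.exp ((Real.log n : ℝ) * t * Complex.I)) = fun t : ℝ => ∑ m ∈ P.support,
        (P m * ((m : ℝ) ^ (-σ) : ℝ)) *
          Complex.exp ((Real.log n - Real.log m : ℝ) * t * Complex.I) := by
    ext t
    rw [evalPoly, Finsupp.sum, Finset.sum_mul]
    refine Finset.sum_congr rfl fun m _ => ?_
    rw [natCast_cpow_eq, mul_assoc, mul_assoc, ← Complex.exp_add, ← mul_assoc]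
    congr 2
    push_cast
    ring
  rw [h4, intervalIntegral.integral_finsetSum
    fun m _ => Continuous.intervalIntegrable (by fun_prop) _ _, Finset.mul_sum]
  refine Finset.sum_congr rfl fun m _ => ?_
  rw [intervalIntegral.integral_const_mul]
  ring

theorem norm_coeff_mul_le_mean {p : ℝ} (hp : 1 ≤ p) (σ : ℝ) (P : ℕ+ →₀ ℂ) (n : ℕ+) :
    ‖P n‖ * (n : ℝ) ^ (-σ) ≤ Mean p σ (evalPoly P) := by
  have hp0 : 0 < p := by linarith
  have hcont := continuous_of_mem_trig (evalPoly_line_mem_trig P σ)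
  have h1 := (tendsto_coeff P σ n).norm
  rw [norm_mul, Complex.norm_real, Real.norm_of_nonneg (by positivity)] at h1
  refine le_of_tendsto_of_tendsto h1 ((meanExists_evalPoly hp0 σ P).tendsto hp0) ?_
  filter_upwards [eventually_gt_atTop 0] with T hT
  refine le_trans ?_ (truncMean_one_le hp σ hcont hT)
  have h2 := intervalIntegral.norm_integral_le_integral_norm (μ := volume)
    (f := fun t : ℝ => evalPoly P (σ + t * Complex.I) *
      Complex.exp ((Real.log n : ℝ) * t * Complex.I)) (by linarith : -T ≤ T)
  have h3 : ∀ t : ℝ, ‖Complex.exp ((Real.log n : ℝ) * t * Complex.I)‖ = 1 := fun t => by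
    rw [← Complex.ofReal_mul]; exact Complex.norm_exp_ofReal_mul_I _
  simp only [norm_mul _ (Complex.exp _), h3, mul_one] at h2
  have h4 : ‖(1 / (2 * T) : ℂ)‖ = 1 / (2 * T) := by simp [abs_of_pos hT]
  rw [norm_mul, h4]
  gcongr

/-- The `n`-th coefficient of a Dirichlet polynomial. -/
def polyCoeff (n : ℕ+) (P : DirichletPolynomial p) : ℂ := (show ℕ+ →₀ ℂ from P) n

theorem norm_polyCoeff_le (n : ℕ+) (P : DirichletPolynomial p) : ‖polyCoeff p n P‖ ≤ ‖P‖ := by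
  have h : Tendsto (fun σ : ℝ => ‖polyCoeff p n P‖ * (n : ℝ) ^ (-σ)) (𝓝[>] 0)
      (𝓝 (‖polyCoeff p n P‖ * (n : ℝ) ^ (-0 : ℝ))) := by
    refine Tendsto.mono_left ?_ nhdsWithin_le_nhds
    have : Continuous fun σ : ℝ => ‖polyCoeff p n P‖ * (n : ℝ) ^ (-σ) :=
      continuous_const.mul (Real.continuous_const_rpow (by simp) |>.comp continuous_neg)
    exact this.tendsto 0
  rw [neg_zero, Real.rpow_zero, mul_one] at h
  refine le_of_tendsto h (eventually_nhdsWithin_of_forall fun σ hσ => ?_)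
  exact (norm_coeff_mul_le_mean hp.out σ P n).trans (mean_le_norm hp.out P hσ)

/-- The coefficient functionals are uniformly continuous, so that they extend to the completion. -/
theorem uniformContinuous_polyCoeff (n : ℕ+) : UniformContinuous (polyCoeff p n) := by
  refine (LipschitzWith.of_dist_le_mul (K := 1) fun P Q => ?_).uniformContinuous
  rw [dist_eq_norm, dist_eq_norm, NNReal.coe_one, one_mul]
  exact norm_polyCoeff_le p n (P - Q)

/-- The Hardy space of Dirichlet series: the closure (completion) of the Dirichlet polynomials in
the norm `‖·‖_p`. -/
abbrev HardySpace : Type := UniformSpace.Completion (DirichletPolynomial p)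

/-- The `n`-th Dirichlet coefficient of an element of the Hardy space: the continuous extension of
the `n`-th coefficient of Dirichlet polynomials. An element `F` is identified with the Dirichlet
series `∑ coeff n F n ^ (-s)`. -/
noncomputable def coeff (n : ℕ+) : HardySpace p → ℂ :=
  UniformSpace.Completion.extension (polyCoeff p n)

theorem coeff_coe (n : ℕ+) (P : DirichletPolynomial p) :
    coeff p n (P : HardySpace p) = polyCoeff p n P :=
  UniformSpace.Completion.extension_coe (uniformContinuous_polyCoeff p n) P

end DirichletHardy

/-!
The function `f` is compared with Dirichlet polynomials `P k`, obtained by convolving `f` along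
vertical lines with compressed copies of a Schwartz function whose Fourier transform is `1` near the
origin and has compact support. Where the Dirichlet series converges absolutely, the convolution
multiplies the coefficients by a cutoff function, so that it is a Dirichlet polynomial there, and
hence in the whole half-plane by the identity theorem (`vertConv_eq_evalPoly`). By Cauchy's formula
the derivative of `f` has bounded means too; so vertical translation is continuous in the mean, and
`P k` converges to `f` in the mean, uniformly for `T ≥ 1` and `Re s > δ` (`exists_approx`). This gives
the existence of the means of `f`, and reduces monotonicity and logarithmic convexity to polynomials.

For a polynomial `P`, the translates `P(· + z)` form an analytic function of `z` with values in the
polynomials normed by the mean on the imaginary axis. The mean is invariant under vertical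
translation, so the norm of this function depends on `Re z` only, and Hadamard's three lines theorem
applies (`mean_le_interp`). A bounded logarithmically convex function on a half-line is decreasing.

For every `η > 0` the approximation shows that the translate `F η = f(· + η)` belongs to the Hardy
space. It remains to see that `F η` converges as `η → 0+`; the means alone give only that the norms
converge. For `p > 1` uniform convexity would do; for `p = 1` analyticity is needed. The substitute
is complex uniform convexity (`circleAverage_norm_sub_rpow_le`): if the average of `|g| ^ p` over a
circle is not much larger than `|g c| ^ p` at the centre `c`, then `g` is close to `g c` on the
circle in the mean of order `p`. It follows from Jensen's inequality for `log |g|` and the mean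
value property of `Re g`, as `|w| ^ p - 1 - (p / 2) (Re w - 1) - (p / 2) log |w|` is positive except
at `w = 1`. The Cayley transform carries this over to a vertical line and the harmonic measure of a
point at distance `s` to the right of it. Averaged over vertical translations, it says that the
vertical translates of `F η` by `y` are close to `F (η + s)` for most `y` in the sense of that
measure. The same `y` serves for `F η` and `F η'`, and vertical translation is isometric. Hence
`F η - F η'` is small if the means vary little on `(0, 2 s]` and `F (s + η) - F (s + η')` is small
(`mean_shift_sub_rpow_le`). The former holds for small `s`, since the means have a limit at `0`, and
the latter for small `η` and `η'`, by continuity at `s` (`ApproxInMean.exists_boundary_value`).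
-/

namespace DirichletHardy

/-! ### Horizontal and vertical translation of Dirichlet polynomials -/

/-- The translation `P ↦ P(· + z)` of Dirichlet polynomials, on the level of coefficients:
`P n` is replaced by `n ^ (-z) * P n`. -/
noncomputable def shift (z : ℂ) : (ℕ+ →₀ ℂ) →ₗ[ℂ] (ℕ+ →₀ ℂ) :=
  Finsupp.lsum ℂ fun n => ((n : ℂ) ^ (-z)) • Finsupp.lsingle n

theorem shift_eq_sum (z : ℂ) (P : ℕ+ →₀ ℂ) :
    shift z P = ∑ n ∈ P.support, ((n : ℂ) ^ (-z)) • Finsupp.single n (P n) := by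
  simp [shift, Finsupp.lsum_apply, Finsupp.sum]

theorem shift_apply (z : ℂ) (P : ℕ+ →₀ ℂ) (n : ℕ+) : shift z P n = (n : ℂ) ^ (-z) * P n := by
  rw [shift_eq_sum, Finsupp.finsetSum_apply]
  simp only [Finsupp.smul_apply, smul_eq_mul, Finsupp.single_apply, mul_ite, mul_zero]
  rw [Finset.sum_ite_eq']
  split_ifs with h
  · rfl
  · simp [Finsupp.notMem_support_iff.1 h]

theorem evalPoly_shift (z s : ℂ) (P : ℕ+ →₀ ℂ) : evalPoly (shift z P) s = evalPoly P (z + s) := by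
  have h : ∀ Q : ℕ+ →₀ ℂ, Q.support ⊆ P.support →
      ∀ w, evalPoly Q w = ∑ n ∈ P.support, Q n * (n : ℂ) ^ (-w) := fun Q hQ w =>
    Finsupp.sum_of_support_subset _ hQ _ (by simp)
  rw [h _ _ s, h P subset_rfl]
  · refine Finset.sum_congr rfl fun n _ => ?_
    rw [shift_apply, neg_add, Complex.cpow_add _ _ (by simp)]
    ring
  · intro n hn
    rw [Finsupp.mem_support_iff, shift_apply] at hn
    exact Finsupp.mem_support_iff.2 (right_ne_zero_of_mul hn)

theorem shift_shift (z w : ℂ) (P : ℕ+ →₀ ℂ) : shift z (shift w P) = shift (z + w) P := by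
  ext n
  rw [shift_apply, shift_apply, shift_apply, neg_add, Complex.cpow_add _ _ (by simp), mul_assoc]

theorem truncMean_shift_ofReal (p σ η : ℝ) (P : ℕ+ →₀ ℂ) :
    truncMean p σ (evalPoly (shift η P)) = truncMean p (η + σ) (evalPoly P) := by
  funext T
  simp only [truncMean, evalPoly_shift]
  push_cast
  simp only [add_assoc]

theorem mean_shift_ofReal (p σ η : ℝ) (P : ℕ+ →₀ ℂ) :
    Mean p σ (evalPoly (shift η P)) = Mean p (η + σ) (evalPoly P) := by
  rw [Mean, Mean, truncMean_shift_ofReal]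

/-- The long-time mean of a bounded continuous function does not change under translation. -/
theorem tendsto_mean_translate_sub {h : ℝ → ℝ} (hc : Continuous h) {B : ℝ} (hB : ∀ t, |h t| ≤ B)
    (y : ℝ) :
    Tendsto (fun T : ℝ => 1 / (2 * T) * (∫ t in (-T)..T, h (t + y)) -
      1 / (2 * T) * ∫ t in (-T)..T, h t) atTop (𝓝 0) := by
  refine squeeze_zero_norm' (a := fun T : ℝ => (B * |y|) * T⁻¹) ?_ ?_
  · filter_upwards [eventually_gt_atTop 0] with T hT
    have hi : ∀ a b, IntervalIntegrable h volume a b := fun a b => hc.intervalIntegrable a b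
    have h1 := intervalIntegral.integral_interval_sub_interval_comm
      (hi (-T + y) (T + y)) (hi (-T) T) (hi (-T + y) (-T))
    have h2 := intervalIntegral.norm_integral_le_of_norm_le_const (a := -T + y) (b := -T)
      (f := h) (C := B) fun t _ => hB t
    have h3 := intervalIntegral.norm_integral_le_of_norm_le_const (a := T + y) (b := T)
      (f := h) (C := B) fun t _ => hB t
    rw [intervalIntegral.integral_comp_add_right, ← mul_sub, h1, norm_mul,
      Real.norm_of_nonneg (by positivity : 0 ≤ 1 / (2 * T))]
    have h4 : |(-T) - (-T + y)| = |y| := by rw [← abs_neg y]; congr 1; ring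
    have h5 : |T - (T + y)| = |y| := by rw [← abs_neg y]; congr 1; ring
    rw [h4] at h2
    rw [h5] at h3
    calc _ ≤ 1 / (2 * T) * (B * |y| + B * |y|) := by
          gcongr
          exact (norm_sub_le _ _).trans (add_le_add h2 h3)
      _ = _ := by field_simp; ring
  · simpa using tendsto_inv_atTop_zero.const_mul (B * |y|)

theorem exists_bound_evalPoly_line (P : ℕ+ →₀ ℂ) (σ : ℝ) :
    ∃ B : ℝ, 0 ≤ B ∧ ∀ t : ℝ, ‖evalPoly P (σ + t * Complex.I)‖ ≤ B := by
  obtain ⟨B, hB⟩ := exists_bound_of_mem_trig (evalPoly_line_mem_trig P σ)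
  exact ⟨B, (norm_nonneg _).trans (hB 0), hB⟩

theorem continuous_norm_evalPoly_rpow {p : ℝ} (hp : 0 ≤ p) (P : ℕ+ →₀ ℂ) (σ : ℝ) :
    Continuous fun t : ℝ => ‖evalPoly P (σ + t * Complex.I)‖ ^ p :=
  (continuous_of_mem_trig (evalPoly_line_mem_trig P σ)).norm.rpow_const fun _ => Or.inr hp

/-- The truncated means over a vertically translated line have the same limit. -/
theorem tendsto_truncMean_translate {p : ℝ} (hp : 0 < p) (σ y : ℝ) (P : ℕ+ →₀ ℂ) :
    Tendsto (fun T : ℝ => 1 / (2 * T) *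
      ∫ t in (-T)..T, ‖evalPoly P (σ + (t + y : ℝ) * Complex.I)‖ ^ p) atTop
      (𝓝 (Mean p σ (evalPoly P) ^ p)) := by
  obtain ⟨B, hB0, hB⟩ := exists_bound_evalPoly_line P σ
  have h1 := tendsto_mean_translate_sub (continuous_norm_evalPoly_rpow hp.le P σ) (B := B ^ p)
    (fun t => by
      rw [abs_of_nonneg (by positivity)]
      exact Real.rpow_le_rpow (norm_nonneg _) (hB t) hp.le) y
  have h2 := ((meanExists_evalPoly hp σ P).tendsto hp).rpow_const (p := p) (Or.inr hp.le)
  have h3 : Tendsto (truncMean p σ (evalPoly P)) atTop (𝓝 (Mean p σ (evalPoly P) ^ p)) := by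
    refine h2.congr' ?_
    filter_upwards [eventually_gt_atTop 0] with T hT
    rw [← Real.rpow_mul (truncMean_nonneg p σ _ hT), one_div_mul_cancel hp.ne', Real.rpow_one]
  simpa [truncMean] using h1.add h3

theorem mean_rpow_eq_of_tendsto {p : ℝ} (hp : 0 < p) {σ L : ℝ} {f : ℂ → ℂ}
    (h : Tendsto (truncMean p σ f) atTop (𝓝 (L ^ p))) (hL : 0 ≤ L) : Mean p σ f = L := by
  rw [Mean, h.limUnder_eq, ← Real.rpow_mul hL, mul_one_div_cancel hp.ne', Real.rpow_one]

theorem mean_shift {p : ℝ} (hp : 0 < p) (σ : ℝ) (z : ℂ) (P : ℕ+ →₀ ℂ) :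
    Mean p σ (evalPoly (shift z P)) = Mean p (z.re + σ) (evalPoly P) := by
  refine mean_rpow_eq_of_tendsto hp ?_ ((meanExists_evalPoly hp _ P).mean_nonneg hp)
  refine (tendsto_truncMean_translate hp (z.re + σ) z.im P).congr fun T => ?_
  simp only [truncMean, evalPoly_shift]
  congr 2
  ext t
  congr 3
  nth_rw 3 [← Complex.re_add_im z]
  push_cast
  ring

/-! ### The means of a Dirichlet polynomial are logarithmically convex -/

/-- Dirichlet polynomials, given by their coefficients, to be normed by the `p`-mean on the
imaginary axis. -/
def AxisPolynomial (_p : ℝ) : Type := ℕ+ →₀ ℂ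

noncomputable instance (p : ℝ) : AddCommGroup (AxisPolynomial p) :=
  inferInstanceAs (AddCommGroup (ℕ+ →₀ ℂ))

noncomputable instance (p : ℝ) : Module ℂ (AxisPolynomial p) :=
  inferInstanceAs (Module ℂ (ℕ+ →₀ ℂ))

noncomputable instance (p : ℝ) : Norm (AxisPolynomial p) where
  norm P := Mean p 0 (evalPoly P)

theorem axisCore {p : ℝ} (hp : 1 ≤ p) : SeminormedSpace.Core ℂ (AxisPolynomial p) where
  norm_nonneg P := (meanExists_evalPoly (by linarith) 0 P).mean_nonneg (by linarith)
  norm_smul c P := mean_smul hp 0 c P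
  norm_triangle P Q := mean_add_le hp 0 P Q

noncomputable instance (p : ℝ) [hp : Fact (1 ≤ p)] : SeminormedAddCommGroup (AxisPolynomial p) :=
  SeminormedAddCommGroup.ofCore (axisCore hp.out)

noncomputable instance (p : ℝ) [hp : Fact (1 ≤ p)] : NormedSpace ℂ (AxisPolynomial p) where
  norm_smul_le c P := ((axisCore hp.out).norm_smul c P).le

theorem natCast_cpow_neg_eq_exp (n : ℕ+) (z : ℂ) :
    (n : ℂ) ^ (-z) = Complex.exp (-(Real.log n : ℂ) * z) := by
  rw [Complex.cpow_def_of_ne_zero (by simp), ← Complex.natCast_log]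
  congr 1
  ring

theorem norm_natCast_cpow_neg (n : ℕ+) (z : ℂ) : ‖(n : ℂ) ^ (-z)‖ = (n : ℝ) ^ (-z.re) := by
  rw [Complex.norm_natCast_cpow_of_pos n.pos, Complex.neg_re]

theorem norm_evalPoly_le (P : ℕ+ →₀ ℂ) {s : ℂ} {σ : ℝ} (hs : σ ≤ s.re) :
    ‖evalPoly P s‖ ≤ ∑ n ∈ P.support, ‖P n‖ * (n : ℝ) ^ (-σ) := by
  refine (norm_sum_le _ _).trans (Finset.sum_le_sum fun n _ => ?_)
  rw [norm_mul, norm_natCast_cpow_neg]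
  gcongr
  exact_mod_cast n.pos

theorem mean_le_sum {p : ℝ} (hp : 1 ≤ p) (P : ℕ+ →₀ ℂ) {σ₀ σ : ℝ} (hσ : σ₀ ≤ σ) :
    Mean p σ (evalPoly P) ≤ ∑ n ∈ P.support, ‖P n‖ * (n : ℝ) ^ (-σ₀) :=
  mean_le_of_norm_le hp (Finset.sum_nonneg fun _ _ => by positivity)
    (meanExists_evalPoly (by linarith) σ P) fun t => norm_evalPoly_le P (by simpa using hσ)

/-- Logarithmic convexity. The family of translates of `P` is an analytic function with values in
the polynomials normed on the imaginary axis; its norm is the mean of `P` and so depends on the real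
part of the variable only. Hadamard's three lines theorem applies to it. -/
theorem mean_le_interp {p : ℝ} (hp : 1 ≤ p) (P : ℕ+ →₀ ℂ) {l u x : ℝ} (hlu : l < u)
    (hx : x ∈ Set.Icc l u) :
    Mean p x (evalPoly P) ≤ Mean p l (evalPoly P) ^ (1 - (x - l) / (u - l)) *
      Mean p u (evalPoly P) ^ ((x - l) / (u - l)) := by
  have : Fact (1 ≤ p) := ⟨hp⟩
  let F : ℂ → UniformSpace.Completion (AxisPolynomial p) :=
    fun z => UniformSpace.Completion.coe' (α := AxisPolynomial p) (shift z P)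
  have hnorm : ∀ z, ‖F z‖ = Mean p z.re (evalPoly P) := fun z => by
    rw [show ‖F z‖ = _ from UniformSpace.Completion.norm_coe _]
    change Mean p 0 (evalPoly (shift z P)) = _
    rw [mean_shift (by linarith), add_zero]
  have hF : F = fun z => ∑ n ∈ P.support, ((n : ℂ) ^ (-z)) •
      UniformSpace.Completion.coe' (α := AxisPolynomial p) (Finsupp.single n (P n)) := by
    funext z
    let L : AxisPolynomial p →L[ℂ] UniformSpace.Completion (AxisPolynomial p) :=
      UniformSpace.Completion.toComplL
    let v : ℕ+ → AxisPolynomial p := fun n => (Finsupp.single n (P n) : ℕ+ →₀ ℂ)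
    have h : (shift z P : AxisPolynomial p) = ∑ n ∈ P.support, ((n : ℂ) ^ (-z)) • v n :=
      shift_eq_sum z P
    change L (shift z P) = ∑ n ∈ P.support, ((n : ℂ) ^ (-z)) • L (v n)
    rw [h, map_sum]
    exact Finset.sum_congr rfl fun n _ => map_smul L _ _
  have hd : Differentiable ℂ F := by
    rw [hF]
    simp only [natCast_cpow_neg_eq_exp]
    fun_prop
  have h := Complex.HadamardThreeLines.norm_le_interp_of_mem_verticalClosedStrip' (f := F)
    (z := (x : ℂ)) (a := Mean p l (evalPoly P)) (b := Mean p u (evalPoly P)) hlu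
    (by simpa [Complex.HadamardThreeLines.verticalClosedStrip] using hx) hd.diffContOnCl
    (by
      refine ⟨∑ n ∈ P.support, ‖P n‖ * (n : ℝ) ^ (-l), ?_⟩
      rintro _ ⟨z, hz, rfl⟩
      simp only [Function.comp, hnorm]
      exact mean_le_sum hp P hz.1)
    (fun z hz => by rw [hnorm, show z.re = l from hz])
    (fun z hz => by rw [hnorm, show z.re = u from hz])
  simpa [hnorm] using h

/-- A bounded logarithmically convex function on a half-line is decreasing. -/
theorem antitoneOn_of_interp {M : ℝ → ℝ} {c B : ℝ} (h0 : ∀ x ∈ Set.Ici c, 0 ≤ M x)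
    (hB : ∀ x ∈ Set.Ici c, M x ≤ B)
    (h : ∀ l u x, l ∈ Set.Ici c → l < u → x ∈ Set.Icc l u →
      M x ≤ M l ^ (1 - (x - l) / (u - l)) * M u ^ ((x - l) / (u - l))) :
    AntitoneOn M (Set.Ici c) := by
  intro x hx y hy hxy
  rcases hxy.eq_or_lt with rfl | hlt
  · exact le_rfl
  -- the right end point of the interval tends to infinity, so that the weight of `M u` tends to `0`
  have hθ : Tendsto (fun u : ℝ => (y - x) / (u - x)) atTop (𝓝 0) :=
    tendsto_const_nhds.div_atTop (tendsto_atTop_add_const_right _ _ tendsto_id)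
  have hB1 : 0 < max B 1 := by positivity
  have h1 : Tendsto (fun u : ℝ => M x ^ (1 - (y - x) / (u - x)) * (max B 1) ^ ((y - x) / (u - x)))
      atTop (𝓝 (M x ^ (1 - 0 : ℝ) * (max B 1) ^ (0 : ℝ))) :=
    (tendsto_const_nhds.rpow (tendsto_const_nhds.sub hθ) (Or.inr (by norm_num))).mul
      (tendsto_const_nhds.rpow hθ (Or.inl hB1.ne'))
  rw [sub_zero, Real.rpow_one, Real.rpow_zero, mul_one] at h1
  refine ge_of_tendsto h1 ?_
  filter_upwards [eventually_gt_atTop y] with u hu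
  have hu' : u ∈ Set.Ici c := le_trans hy hu.le
  refine (h x u y hx (hlt.trans hu) ⟨hlt.le, hu.le⟩).trans ?_
  have := h0 x hx
  have := h0 u hu'
  have : 0 ≤ (y - x) / (u - x) := div_nonneg (by linarith) (by linarith)
  gcongr
  exact (hB u hu').trans (le_max_left _ _)

theorem antitoneOn_mean_evalPoly {p : ℝ} (hp : 1 ≤ p) (P : ℕ+ →₀ ℂ) :
    AntitoneOn (fun σ => Mean p σ (evalPoly P)) (Set.Ici 0) :=
  antitoneOn_of_interp
    (fun σ _ => (meanExists_evalPoly (by linarith) σ P).mean_nonneg (by linarith))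
    (fun _ hσ => mean_le_sum hp P hσ) (fun _ _ _ _ hlu hx => mean_le_interp hp P hlu hx)

/-! ### Complex uniform convexity on a circle -/

theorem le_mul_add_div_of_sq_le {Q A B ε : ℝ} (hA : 0 ≤ A) (hB : 0 ≤ B) (hε : 0 < ε)
    (h : Q ^ 2 ≤ A * B) : Q ≤ ε * A + B / (4 * ε) := by
  refine le_of_sq_le_sq (h.trans ?_) (by positivity)
  have : A * B = 4 * (ε * A) * (B / (4 * ε)) := by field_simp
  rw [this]
  nlinarith [sq_nonneg (ε * A - B / (4 * ε))]

theorem sq_div_le_sub_one_sub_log {y : ℝ} (hy : 0 < y) :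
    (y - 1) ^ 2 / (2 * (y + 1)) ≤ y - 1 - Real.log y := by
  have hs := Real.sq_sqrt hy.le
  have hs0 := Real.sqrt_pos.2 hy
  have h1 : Real.log y = 2 * Real.log (√y) := by
    rw [Real.log_sqrt hy.le]; ring
  have h2 := Real.log_le_sub_one_of_pos hs0
  have h3 : (y - 1) ^ 2 / (2 * (y + 1)) ≤ (√y - 1) ^ 2 := by
    rw [div_le_iff₀ (by positivity)]
    have : (y - 1) ^ 2 = (√y - 1) ^ 2 * (√y + 1) ^ 2 := by
      rw [← mul_pow]; congr 1; nlinarith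
    rw [this]
    gcongr
    nlinarith [sq_nonneg (√y - 1)]
  nlinarith

theorem add_rpow_le_two_rpow_mul {p a b : ℝ} (hp : 0 ≤ p) (ha : 0 ≤ a) (hb : 0 ≤ b) :
    (a + b) ^ p ≤ 2 ^ p * (a ^ p + b ^ p) := by
  have h : a + b ≤ 2 * max a b := by linarith [le_max_left a b, le_max_right a b]
  calc (a + b) ^ p ≤ (2 * max a b) ^ p := Real.rpow_le_rpow (by positivity) h hp
    _ = 2 ^ p * (max a b) ^ p := Real.mul_rpow (by norm_num) (by positivity)
    _ ≤ _ := by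
      gcongr
      rcases max_cases a b with ⟨h, _⟩ | ⟨h, _⟩ <;> rw [h]
      · linarith [Real.rpow_nonneg hb p]
      · linarith [Real.rpow_nonneg ha p]

theorem abs_sub_one_rpow_le {p x : ℝ} (hp : 1 ≤ p) (hx : 0 ≤ x) :
    |x - 1| ^ p ≤ |x ^ p - 1| := by
  rcases le_total 1 x with h | h
  · have := Real.add_rpow_le_rpow_add (sub_nonneg.2 h) zero_le_one hp
    rw [Real.one_rpow, sub_add_cancel] at this
    rw [abs_of_nonneg (sub_nonneg.2 h)]
    exact le_trans (by linarith) (le_abs_self _)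
  · have := Real.add_rpow_le_rpow_add (sub_nonneg.2 h) hx hp
    rw [sub_add_cancel, Real.one_rpow] at this
    rw [abs_sub_comm, abs_of_nonneg (sub_nonneg.2 h), abs_sub_comm]
    exact le_trans (by linarith) (le_abs_self _)

/-- The excess of `|w| ^ p` over the function `1 + (p / 2) (Re w - 1) + (p / 2) log |w|`. The latter
is subharmonic, and touches `|w| ^ p` from below at the point `1` only. -/
noncomputable def excess (p : ℝ) (w : ℂ) : ℝ :=
  ‖w‖ ^ p - 1 - p / 2 * (w.re - 1) - p / 2 * Real.log ‖w‖

/-- The first term bounds the radial, the second one the angular deviation of `w` from `1`. At `w = 0`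
the estimate may fail, since `Real.log 0` is `0` and not `-∞`. -/
theorem le_excess {p : ℝ} (hp : 1 ≤ p) {w : ℂ} (hw : w ≠ 0) :
    (‖w‖ ^ p - 1) ^ 2 / (4 * (‖w‖ ^ p + 1)) + (‖w‖ - w.re) / 2 ≤ excess p w := by
  have hx : 0 < ‖w‖ := norm_pos_iff.2 hw
  have hy : 0 < ‖w‖ ^ p := by positivity
  have h1 := sq_div_le_sub_one_sub_log hy
  rw [Real.log_rpow hx] at h1
  have h2 := one_add_mul_self_le_rpow_one_add (s := ‖w‖ - 1) (by linarith) hp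
  rw [add_sub_cancel] at h2
  have h3 := Complex.re_le_norm w
  have h4 : (‖w‖ ^ p - 1) ^ 2 / (4 * (‖w‖ ^ p + 1)) =
      (‖w‖ ^ p - 1) ^ 2 / (2 * (‖w‖ ^ p + 1)) / 2 := by
    rw [div_div]; congr 1; ring
  rw [h4, excess]
  nlinarith

/-- The excess controls the distance from `1`. -/
theorem norm_sub_one_rpow_le {p : ℝ} (hp : 1 ≤ p) {w : ℂ} (hw : w ≠ 0) {ε : ℝ} (hε : 0 < ε) :
    ‖w - 1‖ ^ p ≤ 2 ^ p * (2 * ε * (‖w‖ ^ p + 1) + 25 * 2 ^ (3 * p) / ε * excess p w) := by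
  have hp0 : 0 ≤ p := by linarith
  have hx : 0 < ‖w‖ := norm_pos_iff.2 hw
  have hD := le_excess hp hw
  set x := ‖w‖ with hxdef
  set y := x ^ p with hydef
  set D := excess p w
  have hy : 0 < y := by positivity
  have hre : w.re ≤ x := Complex.re_le_norm w
  have hre' : -x ≤ w.re := (abs_le.1 (Complex.abs_re_le_norm w)).1
  have hD1 : (y - 1) ^ 2 / (4 * (y + 1)) ≤ D := by linarith
  have hD2 : (x - w.re) / 2 ≤ D := by
    have : 0 ≤ (y - 1) ^ 2 / (4 * (y + 1)) := by positivity
    linarith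
  have hD0 : 0 ≤ D := by linarith
  have h2p : (1 : ℝ) ≤ 2 ^ (3 * p) := Real.one_le_rpow (by norm_num) (by positivity)
  -- the radial part
  have hrad : |x - 1| ^ p ≤ ε * (y + 1) + D / ε := by
    refine (abs_sub_one_rpow_le hp hx.le).trans ?_
    have := le_mul_add_div_of_sq_le (Q := |y - 1|) (A := y + 1) (B := 4 * D) (by positivity)
      (by positivity) hε (by
        rw [sq_abs]
        rw [div_le_iff₀ (by positivity)] at hD1
        linarith)
    rwa [mul_div_mul_left _ _ (by norm_num : (4 : ℝ) ≠ 0)] at this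
  -- the angular part
  have hnsq : ‖w - (x : ℂ)‖ ^ 2 = 2 * x * (x - w.re) := by
    have : x ^ 2 = w.re ^ 2 + w.im ^ 2 := by
      rw [hxdef, Complex.sq_norm, Complex.normSq_apply]; ring
    rw [Complex.sq_norm, Complex.normSq_apply]
    simp only [Complex.sub_re, Complex.ofReal_re, Complex.sub_im, Complex.ofReal_im, sub_zero]
    linarith
  have hn2 : ‖w - (x : ℂ)‖ ≤ 2 * x := by
    refine (norm_sub_le _ _).trans ?_
    rw [Complex.norm_real, Real.norm_of_nonneg hx.le]; linarith
  have hang : (‖w - (x : ℂ)‖ ^ p) ^ 2 ≤ (y + 1) * (24 * 2 ^ (3 * p) * D) := by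
    have e1 : (‖w - (x : ℂ)‖ ^ p) ^ 2 = (‖w - (x : ℂ)‖ ^ (p - 1)) ^ 2 * ‖w - (x : ℂ)‖ ^ 2 := by
      rw [← mul_pow]
      congr 1
      rcases (norm_nonneg (w - (x : ℂ))).eq_or_lt with h | h
      · rw [← h, Real.zero_rpow (by linarith), mul_zero]
      · rw [Real.rpow_sub_one h.ne', div_mul_cancel₀ _ h.ne']
    have e2 : (‖w - (x : ℂ)‖ ^ p) ^ 2 ≤ ((2 * x) ^ (p - 1)) ^ 2 * (2 * x * (x - w.re)) := by
      rw [e1, hnsq]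
      have := Real.rpow_le_rpow (norm_nonneg _) hn2 (sub_nonneg.2 hp)
      have : 0 ≤ x - w.re := by linarith
      gcongr
    have e3 : ((2 * x) ^ (p - 1)) * (2 * x) = 2 ^ p * y := by
      rw [Real.rpow_sub_one (by positivity), div_mul_cancel₀ _ (by positivity),
        Real.mul_rpow (by norm_num) hx.le]
    refine e2.trans ?_
    rcases le_total x 2 with h | h
    · have e4 : (2 * x) ^ (p - 1) ≤ 2 ^ (2 * p) := by
        calc (2 * x) ^ (p - 1) ≤ (4 : ℝ) ^ (p - 1) :=
              Real.rpow_le_rpow (by positivity) (by linarith) (by linarith)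
          _ ≤ (4 : ℝ) ^ p := Real.rpow_le_rpow_of_exponent_le (by norm_num) (by linarith)
          _ = 2 ^ (2 * p) := by rw [Real.rpow_mul (by norm_num)]; norm_num
      calc ((2 * x) ^ (p - 1)) ^ 2 * (2 * x * (x - w.re))
          = (2 * x) ^ (p - 1) * ((2 * x) ^ (p - 1) * (2 * x)) * (x - w.re) := by ring
        _ ≤ 2 ^ (2 * p) * (2 ^ p * (y + 1)) * (24 * D) := by
          rw [e3]
          gcongr
          · linarith
          · linarith
        _ = (y + 1) * (24 * (2 ^ (2 * p) * 2 ^ p) * D) := by ring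
        _ = _ := by rw [← Real.rpow_add (by norm_num)]; ring_nf
    · have hy2 : 2 ≤ y := h.trans (by
        simpa using Real.rpow_le_rpow_of_exponent_le (by linarith : 1 ≤ x) hp)
      have e4 : y / 24 ≤ D := by
        refine le_trans ?_ hD1
        rw [div_le_div_iff₀ (by norm_num) (by positivity)]
        nlinarith
      calc ((2 * x) ^ (p - 1)) ^ 2 * (2 * x * (x - w.re))
          ≤ ((2 * x) ^ (p - 1)) ^ 2 * (2 * x * (2 * x)) := by gcongr; linarith
        _ = ((2 * x) ^ (p - 1) * (2 * x)) ^ 2 := by ring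
        _ = (2 ^ p * 2 ^ p) * y * y := by rw [e3]; ring
        _ ≤ (2 ^ (3 * p)) * (y + 1) * (24 * D) := by
          rw [← Real.rpow_add (by norm_num)]
          gcongr
          · norm_num
          · linarith
          · linarith
          · linarith
        _ = _ := by ring
  have hang' := le_mul_add_div_of_sq_le (ε := ε) (by positivity) (by positivity) hε hang
  have htri : ‖w - 1‖ ≤ ‖w - (x : ℂ)‖ + |x - 1| := by
    have := norm_sub_le_norm_sub_add_norm_sub w (x : ℂ) 1
    rwa [← Complex.ofReal_one, ← Complex.ofReal_sub, Complex.norm_real, Real.norm_eq_abs,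
      Complex.ofReal_one] at this
  calc ‖w - 1‖ ^ p ≤ (‖w - (x : ℂ)‖ + |x - 1|) ^ p :=
        Real.rpow_le_rpow (norm_nonneg _) htri hp0
    _ ≤ 2 ^ p * (‖w - (x : ℂ)‖ ^ p + |x - 1| ^ p) :=
        add_rpow_le_two_rpow_mul hp0 (norm_nonneg _) (abs_nonneg _)
    _ ≤ 2 ^ p * ((ε * (y + 1) + 24 * 2 ^ (3 * p) * D / (4 * ε)) + (ε * (y + 1) + D / ε)) := by
        gcongr
    _ ≤ _ := by
        refine mul_le_mul_of_nonneg_left ?_ (by positivity)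
        have : 24 * 2 ^ (3 * p) * D / (4 * ε) = 6 * 2 ^ (3 * p) / ε * D := by field_simp; ring
        have h5 : D / ε ≤ 2 ^ (3 * p) / ε * D := by
          rw [div_mul_eq_mul_div]
          gcongr
          nlinarith
        have h6 : 0 ≤ 2 ^ (3 * p) / ε * D := by positivity
        rw [this]
        have : 25 * 2 ^ (3 * p) / ε * D = 25 * (2 ^ (3 * p) / ε * D) := by ring
        have : 6 * 2 ^ (3 * p) / ε * D = 6 * (2 ^ (3 * p) / ε * D) := by ring
        linarith

/-- The constant in the complex uniform convexity inequality: that of `norm_sub_one_rpow_le`, with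
the weight `ε` there replaced by `ε / (2 ^ p * 2)`. -/
noncomputable def convexityConst (p : ℝ) : ℝ := 2 ^ p * (25 * 2 ^ (3 * p)) * (2 ^ p * 2)

theorem convexityConst_pos (p : ℝ) : 0 < convexityConst p := by unfold convexityConst; positivity

/-- The excess controls the distance from `a`, for general `a` by homogeneity. -/
theorem norm_sub_rpow_le {p : ℝ} (hp : 1 ≤ p) {z a : ℂ} (hz : z ≠ 0) (ha : a ≠ 0) {ε : ℝ}
    (hε : 0 < ε) :
    ‖z - a‖ ^ p ≤ ε * (‖z‖ ^ p + ‖a‖ ^ p) + convexityConst p / ε * (‖z‖ ^ p - ‖a‖ ^ p -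
      p / 2 * ‖a‖ ^ p * ((z / a).re - 1) -
      p / 2 * ‖a‖ ^ p * (Real.log ‖z‖ - Real.log ‖a‖)) := by
  have hp0 : 0 ≤ p := by linarith
  have ha' : 0 < ‖a‖ := norm_pos_iff.2 ha
  have h2 : (0 : ℝ) < 2 ^ p := by positivity
  have h := norm_sub_one_rpow_le hp (div_ne_zero hz ha) (ε := ε / (2 ^ p * 2)) (by positivity)
  have e1 : ‖z - a‖ ^ p = ‖a‖ ^ p * ‖z / a - 1‖ ^ p := by
    rw [← Real.mul_rpow (norm_nonneg _) (norm_nonneg _), ← norm_mul]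
    congr 2; field_simp
  have e2 : ‖z‖ ^ p = ‖a‖ ^ p * ‖z / a‖ ^ p := by
    rw [← Real.mul_rpow (norm_nonneg _) (norm_nonneg _), ← norm_mul]
    congr 2; field_simp
  have e3 : Real.log ‖z / a‖ = Real.log ‖z‖ - Real.log ‖a‖ := by
    rw [norm_div, Real.log_div (norm_ne_zero_iff.2 hz) ha'.ne']
  rw [e1, e2]
  calc _ ≤ _ := mul_le_mul_of_nonneg_left h (by positivity)
    _ = _ := by
      rw [excess, e3, convexityConst]
      field_simp

/-- Jensen's inequality: `log |g|` lies below its average. -/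
theorem log_norm_le_circleAverage {c : ℂ} {R : ℝ} (hR : 0 < R) {g : ℂ → ℂ}
    (hg : AnalyticOnNhd ℂ g (Metric.closedBall c R)) (h0 : g c ≠ 0) :
    Real.log ‖g c‖ ≤ Real.circleAverage (fun z => Real.log ‖g z‖) c R := by
  have hg' : AnalyticOnNhd ℂ g (Metric.closedBall c |R|) := by rwa [abs_of_pos hR]
  rw [hg'.circleAverage_log_norm hR.ne' h0]
  refine le_add_of_nonneg_left (finsum_nonneg fun u => ?_)
  by_cases hu : u ∈ Metric.closedBall c |R|
  · refine mul_nonneg (by exact_mod_cast MeromorphicOn.AnalyticOnNhd.divisor_nonneg hg' u) ?_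
    rcases eq_or_ne c u with rfl | hne
    · simp
    have hpos : 0 < ‖c - u‖ := norm_pos_iff.2 (sub_ne_zero.2 hne)
    refine Real.log_nonneg ?_
    rw [← div_eq_mul_inv, one_le_div hpos, ← dist_eq_norm, dist_comm]
    rwa [abs_of_pos hR] at hu
  · simp [hu]

/-- Complex uniform convexity on a circle: if the average of `|g| ^ p` exceeds the value at the
centre by little only, then `g` is close to its value at the centre. -/
theorem circleAverage_norm_sub_rpow_le {p : ℝ} (hp : 1 ≤ p) {c : ℂ} {R : ℝ} (hR : 0 < R)
    {g : ℂ → ℂ} (hg : AnalyticOnNhd ℂ g (Metric.closedBall c R)) {ε : ℝ} (hε : 0 < ε)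
    (hε1 : ε ≤ convexityConst p) :
    Real.circleAverage (fun z => ‖g z - g c‖ ^ p) c R ≤
      ε * (Real.circleAverage (fun z => ‖g z‖ ^ p) c R + ‖g c‖ ^ p) +
      convexityConst p / ε * (Real.circleAverage (fun z => ‖g z‖ ^ p) c R - ‖g c‖ ^ p) := by
  have hp0 : 0 < p := by linarith
  set C := convexityConst p
  have hC : 0 < C := convexityConst_pos p
  have hcont : ContinuousOn g (Metric.closedBall c R) := hg.continuousOn
  have hconts : ContinuousOn g (Metric.sphere c |R|) :=
    hcont.mono (by rw [abs_of_pos hR]; exact Metric.sphere_subset_closedBall)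
  have i1 : CircleIntegrable (fun z => ‖g z - g c‖ ^ p) c R :=
    ContinuousOn.circleIntegrable' ((hconts.sub continuousOn_const).norm.rpow_const
      fun _ _ => Or.inr hp0.le)
  have i2 : CircleIntegrable (fun z => ‖g z‖ ^ p) c R :=
    ContinuousOn.circleIntegrable' (hconts.norm.rpow_const fun _ _ => Or.inr hp0.le)
  -- if `g c = 0`, both sides are multiples of the same average, and `ε ≤ C` is what is needed
  by_cases h0 : g c = 0
  · simp only [h0, sub_zero, norm_zero, Real.zero_rpow hp0.ne', add_zero]
    have hA : 0 ≤ Real.circleAverage (fun z => ‖g z‖ ^ p) c R :=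
      Real.circleAverage_nonneg_of_nonneg fun z _ => by positivity
    have h1 : 1 ≤ C / ε := by rwa [one_le_div hε]
    nlinarith
  have hg' : AnalyticOnNhd ℂ g (Metric.closedBall c |R|) := by rwa [abs_of_pos hR]
  have i3 : CircleIntegrable (fun z => Real.log ‖g z‖) c R :=
    (hg'.mono Metric.sphere_subset_closedBall).meromorphicOn.circleIntegrable_log_norm
  have i4 : CircleIntegrable (fun z => (g z / g c).re) c R :=
    ContinuousOn.circleIntegrable' (Complex.continuous_re.comp_continuousOn
      (hconts.div_const _))
  have hre : Real.circleAverage (fun z => (g z / g c).re) c R = 1 := by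
    have h1 : Real.circleAverage (fun z => g z / g c) c R = g c / g c :=
      DiffContOnCl.circleAverage (f := fun z => g z / g c) (DifferentiableOn.diffContOnCl
        (((hg'.mono (closure_minimal Metric.ball_subset_closedBall
          Metric.isClosed_closedBall)).div_const).differentiableOn))
    have h2 := Complex.reCLM.circleAverage_comp_comm (f := fun z => g z / g c) (c := c) (R := R)
      (ContinuousOn.circleIntegrable' (hconts.div_const _))
    have h3 : Real.circleAverage (fun z => (g z / g c).re) c R =
      (Real.circleAverage (fun z => g z / g c) c R).re := h2
    rw [h3, h1, div_self h0, Complex.one_re]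
  have hlog := log_norm_le_circleAverage hR hg h0
  let K := p / 2 * ‖g c‖ ^ p
  have hK : 0 ≤ K := by positivity
  let rhs : ℂ → ℝ := fun z => (ε + C / ε) * ‖g z‖ ^ p + (-(C / ε * K)) * (g z / g c).re +
    (-(C / ε * K)) * Real.log ‖g z‖ + (ε * ‖g c‖ ^ p + C / ε * (-‖g c‖ ^ p + K + K *
      Real.log ‖g c‖))
  have i2' : CircleIntegrable (fun z => (ε + C / ε) * ‖g z‖ ^ p) c R := i2.const_mul _
  have i4' : CircleIntegrable (fun z => (-(C / ε * K)) * (g z / g c).re) c R := i4.const_mul _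
  have i3' : CircleIntegrable (fun z => (-(C / ε * K)) * Real.log ‖g z‖) c R := i3.const_mul _
  have irhs : CircleIntegrable rhs c R :=
    ((i2'.add i4').add i3').add (circleIntegrable_const _ _ _)
  have hne : ∀ᶠ z in codiscreteWithin (Metric.sphere c |R|), g z ≠ 0 := by
    refine Filter.codiscreteWithin_mono Metric.sphere_subset_closedBall ?_
    exact hg'.preimage_zero_mem_codiscreteWithin h0 (by simp)
      ((convex_closedBall c |R|).isConnected ⟨c, by simp⟩)
  -- the pointwise inequality may fail at zeros of `g`, where `Real.log` has the value `0`
  have hmax : (fun z => max (‖g z - g c‖ ^ p) (rhs z)) =ᶠ[codiscreteWithin (Metric.sphere c |R|)]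
      rhs := by
    filter_upwards [hne] with z hz
    refine max_eq_right ((norm_sub_rpow_le hp hz h0 hε).trans_eq ?_)
    simp only [rhs, K, C]
    ring
  have imax := (circleIntegrable_congr_codiscreteWithin hmax).2 irhs
  have hle := Real.circleAverage_mono i1 imax fun z _ => le_max_left _ _
  rw [Real.circleAverage_congr_codiscreteWithin hmax hR.ne'] at hle
  refine hle.trans ?_
  have hval : Real.circleAverage rhs c R =
      (ε + C / ε) * Real.circleAverage (fun z => ‖g z‖ ^ p) c R + (-(C / ε * K)) * 1 +
      (-(C / ε * K)) * Real.circleAverage (fun z => Real.log ‖g z‖) c R +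
      (ε * ‖g c‖ ^ p + C / ε * (-‖g c‖ ^ p + K + K * Real.log ‖g c‖)) := by
    have e : ∀ (k : ℝ) (u : ℂ → ℝ), Real.circleAverage (fun z => k * u z) c R =
      k * Real.circleAverage u c R := fun k u => Real.circleAverage_fun_smul (a := k) (f := u)
    have i24 : CircleIntegrable (fun z => (ε + C / ε) * ‖g z‖ ^ p +
      (-(C / ε * K)) * (g z / g c).re) c R := i2'.add i4'
    rw [← hre, ← e, ← e, ← e, ← Real.circleAverage_fun_add i2' i4',
      ← Real.circleAverage_fun_add i24 i3']
    refine (Real.circleAverage_fun_add ((i2'.add i4').add i3')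
      (circleIntegrable_const _ _ _)).trans ?_
    rw [Real.circleAverage_const]
    rfl
  rw [hval]
  have : 0 ≤ C / ε * K := by positivity
  nlinarith

/-! ### Complex uniform convexity on a vertical line -/

/-- The conformal map `z ↦ (1 + z) / (1 - z)` of the unit disc onto the right half-plane. -/
noncomputable def cayley (z : ℂ) : ℂ := (1 + z) / (1 - z)

/-- The ordinate of the point of the imaginary axis that the map `cayley` assigns to the point
`exp (i θ)` of the circle; it equals `cot (θ / 2)`. -/
noncomputable def cayleyOrd (θ : ℝ) : ℝ := (cayley (circleMap 0 1 θ)).im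

theorem measurable_cayley : Measurable cayley := by
  unfold cayley; fun_prop

theorem measurable_cayleyOrd : Measurable cayleyOrd :=
  Complex.measurable_im.comp (measurable_cayley.comp (continuous_circleMap 0 1).measurable)

theorem re_cayley (z : ℂ) : (cayley z).re = (1 - ‖z‖ ^ 2) / Complex.normSq (1 - z) := by
  rw [cayley, Complex.div_re, ← add_div]
  congr 1
  rw [Complex.sq_norm, Complex.normSq_apply]
  simp only [Complex.add_re, Complex.one_re, Complex.sub_re, Complex.add_im, Complex.one_im,
    Complex.sub_im]
  ring

theorem re_cayley_nonneg {z : ℂ} (hz : ‖z‖ ≤ 1) : 0 ≤ (cayley z).re := by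
  rw [re_cayley]
  have : ‖z‖ ^ 2 ≤ 1 := pow_le_one₀ (norm_nonneg _) hz
  exact div_nonneg (by linarith) (Complex.normSq_nonneg _)

theorem cayley_circleMap (θ : ℝ) : cayley (circleMap 0 1 θ) = cayleyOrd θ * Complex.I := by
  apply Complex.ext
  · rw [re_cayley]
    simp
  · simp [cayleyOrd]

theorem cayley_zero : cayley 0 = 1 := by simp [cayley]

theorem analyticAt_cayley {z : ℂ} (hz : z ≠ 1) : AnalyticAt ℂ cayley z := by
  have : (1 : ℂ) - z ≠ 0 := sub_ne_zero.2 hz.symm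
  unfold cayley
  fun_prop (disch := assumption)

/-- The averages over the circles of radius `ρ < 1`, transplanted to the half-plane, converge to the
integral of the boundary values: the integral over the line `Re z = η` with respect to the harmonic
measure of the point `η + s`, written in the angular variable of the circle. -/
theorem tendsto_circleAverage_cayley {u : ℂ → ℝ} (hu : Continuous u) {η s B : ℝ} (hs : 0 ≤ s)
    (hB : ∀ z : ℂ, η ≤ z.re → |u z| ≤ B) :
    Tendsto (fun ρ : ℝ => Real.circleAverage (fun z => u (η + s * cayley z)) 0 ρ) (𝓝[<] 1)
      (𝓝 ((2 * Real.pi)⁻¹ * ∫ θ in 0..(2 * Real.pi), u (η + (s * cayleyOrd θ : ℝ) * Complex.I))) := by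
  simp only [Real.circleAverage_def, smul_eq_mul]
  refine Tendsto.const_mul _ ?_
  refine intervalIntegral.tendsto_integral_filter_of_dominated_convergence (fun _ => B) ?_ ?_
    intervalIntegrable_const ?_
  · refine Eventually.of_forall fun ρ => Measurable.aestronglyMeasurable ?_
    exact hu.measurable.comp (((measurable_cayley.comp
      (continuous_circleMap 0 ρ).measurable).const_mul _).const_add _)
  · filter_upwards [Ioo_mem_nhdsLT (show (0 : ℝ) < 1 by norm_num)] with ρ hρ
    refine Eventually.of_forall fun θ _ => hB _ ?_
    have h1 : ‖circleMap 0 ρ θ‖ ≤ 1 := by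
      rw [norm_circleMap_zero, abs_of_pos hρ.1]; exact hρ.2.le
    have := re_cayley_nonneg h1
    simp only [Complex.add_re, Complex.ofReal_re, Complex.re_ofReal_mul, le_add_iff_nonneg_right]
    positivity
  · -- the Cayley transform is continuous on the circle except at `1`
    have hne : ∀ᵐ θ : ℝ, θ ≠ 2 * Real.pi := by
      simp [ae_iff]
    filter_upwards [hne] with θ hθ hmem
    rw [Set.uIoc_of_le (by positivity)] at hmem
    have h1 : circleMap 0 1 θ ≠ 1 := by
      intro h
      rw [circleMap_zero, Complex.ofReal_one, one_mul, Complex.exp_eq_one_iff] at h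
      obtain ⟨n, hn⟩ := h
      have h2 : θ = n * (2 * Real.pi) := by
        have h3 : (θ : ℂ) * Complex.I = ((n * (2 * Real.pi) : ℝ) : ℂ) * Complex.I := by
          rw [hn]; push_cast; ring
        exact_mod_cast mul_right_cancel₀ Complex.I_ne_zero h3
      have hpi := Real.pi_pos
      have h4 : (0 : ℝ) < n := by
        by_contra hcon
        have : (n : ℝ) * (2 * Real.pi) ≤ 0 :=
          mul_nonpos_of_nonpos_of_nonneg (not_lt.1 hcon) (by positivity)
        linarith [hmem.1]
      have h5 : (n : ℝ) < 2 := by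
        by_contra hcon
        have : 2 * (2 * Real.pi) ≤ (n : ℝ) * (2 * Real.pi) := by gcongr; exact not_lt.1 hcon
        linarith [hmem.2]
      have h6 : n = 1 := by
        have : 0 < n := by exact_mod_cast h4
        have : n < 2 := by exact_mod_cast h5
        omega
      rw [h6] at h2
      exact hθ (by simpa using h2)
    have h2 : Tendsto (fun ρ : ℝ => circleMap 0 ρ θ) (𝓝[<] 1) (𝓝 (circleMap 0 1 θ)) := by
      refine Tendsto.mono_left ?_ nhdsWithin_le_nhds
      exact Continuous.tendsto (by unfold circleMap; fun_prop) 1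
    have h3 := ((analyticAt_cayley h1).continuousAt.tendsto.comp h2)
    have h4 := (hu.tendsto (η + s * cayley (circleMap 0 1 θ))).comp
      ((h3.const_mul (s : ℂ)).const_add (η : ℂ))
    have h5 : (η : ℂ) + (s * cayleyOrd θ : ℝ) * Complex.I = η + s * cayley (circleMap 0 1 θ) := by
      rw [cayley_circleMap]
      push_cast
      ring
    rw [h5]
    exact h4

/-- Complex uniform convexity on the line `Re z = η` with respect to harmonic measure of the point
`η + s`, for bounded analytic functions. -/
theorem integral_line_norm_sub_rpow_le {p : ℝ} (hp : 1 ≤ p) {h : ℂ → ℂ} (hd : Differentiable ℂ h)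
    {η s B : ℝ} (hs : 0 < s) (hB : ∀ z : ℂ, η ≤ z.re → ‖h z‖ ≤ B) {ε : ℝ} (hε : 0 < ε)
    (hε1 : ε ≤ convexityConst p) :
    (2 * Real.pi)⁻¹ * ∫ θ in 0..(2 * Real.pi),
        ‖h (η + (s * cayleyOrd θ : ℝ) * Complex.I) - h (η + s)‖ ^ p ≤
      (ε + convexityConst p / ε) * ((2 * Real.pi)⁻¹ * ∫ θ in 0..(2 * Real.pi),
        ‖h (η + (s * cayleyOrd θ : ℝ) * Complex.I)‖ ^ p) +
      (ε - convexityConst p / ε) * ‖h (η + s)‖ ^ p := by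
  have hp0 : 0 ≤ p := by linarith
  have hc := hd.continuous
  have t1 := tendsto_circleAverage_cayley (u := fun z => ‖h z - h (η + s)‖ ^ p) (η := η)
    (B := (B + ‖h (η + s)‖) ^ p)
    ((hc.sub continuous_const).norm.rpow_const fun _ => Or.inr hp0) hs.le fun z hz => by
      rw [abs_of_nonneg (by positivity)]
      exact Real.rpow_le_rpow (norm_nonneg _) ((norm_sub_le _ _).trans (by gcongr; exact hB z hz))
        hp0
  have t2 := tendsto_circleAverage_cayley (u := fun z => ‖h z‖ ^ p) (η := η) (B := B ^ p)
    (hc.norm.rpow_const fun _ => Or.inr hp0) hs.le fun z hz => by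
      rw [abs_of_nonneg (by positivity)]
      exact Real.rpow_le_rpow (norm_nonneg _) (hB z hz) hp0
  -- the inequality on circles is used for `ρ < 1`, where the transplanted function is analytic up to
  -- the boundary
  refine le_of_tendsto_of_tendsto t1 ((t2.const_mul _).add_const _) ?_
  filter_upwards [Ioo_mem_nhdsLT (show (0 : ℝ) < 1 by norm_num)] with ρ hρ
  have hg : AnalyticOnNhd ℂ (fun z => h (η + s * cayley z)) (Metric.closedBall 0 ρ) := by
    intro z hz
    have hz1 : z ≠ 1 := by
      rintro rfl
      rw [mem_closedBall_zero_iff, norm_one] at hz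
      linarith [hρ.2]
    have h1 : AnalyticAt ℂ (fun z => (η : ℂ) + s * cayley z) z :=
      analyticAt_const.add (analyticAt_const.mul (analyticAt_cayley hz1))
    exact (hd.analyticAt _).fun_comp h1
  have key := circleAverage_norm_sub_rpow_le hp hρ.1 hg hε hε1
  simp only [cayley_zero, mul_one] at key
  refine key.trans_eq ?_
  ring

/-! ### The Cauchy estimate for horizontal translates -/

theorem differentiable_evalPoly (P : ℕ+ →₀ ℂ) : Differentiable ℂ (evalPoly P) := by
  unfold evalPoly Finsupp.sum
  simp only [natCast_cpow_neg_eq_exp]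
  fun_prop

theorem evalPoly_sub (P Q : ℕ+ →₀ ℂ) (s : ℂ) :
    evalPoly (P - Q) s = evalPoly P s - evalPoly Q s :=
  Finsupp.sum_sub_index (by intros; ring)

theorem continuous_evalPoly (P : ℕ+ →₀ ℂ) : Continuous (evalPoly P) :=
  (differentiable_evalPoly P).continuous

theorem integrableOn_prod_of_bound {F : ℝ → ℝ → ℝ} (hF : Measurable (Function.uncurry F)) {B : ℝ}
    (hB : ∀ t θ, |F t θ| ≤ B) (a b c d : ℝ) :
    IntegrableOn (Function.uncurry F) (Set.uIoc a b ×ˢ Set.uIoc c d) := by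
  refine Measure.integrableOn_of_bounded (M := B) ?_ hF.aestronglyMeasurable
    (Eventually.of_forall fun x => hB x.1 x.2)
  rw [Measure.volume_eq_prod, Measure.prod_prod]
  simp [Set.uIoc, ENNReal.mul_eq_top]

theorem intervalIntegrable_integral {F : ℝ → ℝ → ℝ} {a b c d : ℝ}
    (hF : IntegrableOn (Function.uncurry F) (Set.uIoc a b ×ˢ Set.uIoc c d)) (hcd : c ≤ d) :
    IntervalIntegrable (fun t => ∫ θ in c..d, F t θ) volume a b := by
  rw [intervalIntegrable_iff, IntegrableOn]
  simp only [intervalIntegral.integral_of_le hcd]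
  rw [Set.uIoc_of_le hcd, IntegrableOn, Measure.volume_eq_prod, ← Measure.prod_restrict] at hF
  exact hF.integral_prod_left

/-- The uniform convexity inequality after averaging over vertical translates. -/
theorem integral_truncMean_le {p : ℝ} (hp : 1 ≤ p) (P : ℕ+ →₀ ℂ) (η : ℝ) {s : ℝ} (hs : 0 < s)
    {ε : ℝ} (hε : 0 < ε) (hε1 : ε ≤ convexityConst p) {T : ℝ} (hT : 0 < T) :
    (2 * Real.pi)⁻¹ * ∫ θ in 0..(2 * Real.pi), truncMean p 0
        (evalPoly (shift (η + (s * cayleyOrd θ : ℝ) * Complex.I) P - shift (η + s) P)) T ≤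
      (ε + convexityConst p / ε) * ((2 * Real.pi)⁻¹ * ∫ θ in 0..(2 * Real.pi), 1 / (2 * T) *
        ∫ t in (-T)..T, ‖evalPoly P (η + (t + s * cayleyOrd θ : ℝ) * Complex.I)‖ ^ p) +
      (ε - convexityConst p / ε) * truncMean p (η + s) (evalPoly P) T := by
  have hp0 : 0 ≤ p := by linarith
  have hc := continuous_evalPoly P
  obtain ⟨B, hB⟩ : ∃ B : ℝ, ∀ z : ℂ, η ≤ z.re → ‖evalPoly P z‖ ≤ B :=
    ⟨_, fun z hz => norm_evalPoly_le P hz⟩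
  let F₁ : ℝ → ℝ → ℝ := fun t θ => ‖evalPoly P (η + (t + s * cayleyOrd θ : ℝ) * Complex.I) -
    evalPoly P (η + s + t * Complex.I)‖ ^ p
  let F₂ : ℝ → ℝ → ℝ := fun t θ => ‖evalPoly P (η + (t + s * cayleyOrd θ : ℝ) * Complex.I)‖ ^ p
  let G : ℝ → ℝ := fun t => ‖evalPoly P (η + s + t * Complex.I)‖ ^ p
  have hY' : Measurable fun x : ℝ × ℝ => (η : ℂ) + (x.1 + s * cayleyOrd x.2 : ℝ) * Complex.I :=
    (Complex.measurable_ofReal.comp (measurable_fst.add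
      ((measurable_cayleyOrd.comp measurable_snd).const_mul s))).mul_const _ |>.const_add _
  have hX' : Measurable fun x : ℝ × ℝ => (η : ℂ) + s + (x.1 : ℂ) * Complex.I := by fun_prop
  have m₁ : Measurable (Function.uncurry F₁) :=
    ((hc.measurable.comp hY').sub (hc.measurable.comp hX')).norm.pow_const p
  have m₂ : Measurable (Function.uncurry F₂) := (hc.measurable.comp hY').norm.pow_const p
  have hcG : Continuous G := Continuous.rpow_const (by fun_prop) fun _ => Or.inr hp0
  have b₂ : ∀ t θ, |F₂ t θ| ≤ B ^ p := fun t θ => by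
    simp only [F₂]
    have h1 : η ≤ ((η : ℂ) + (t + s * cayleyOrd θ : ℝ) * Complex.I).re := by simp
    rw [abs_of_nonneg (Real.rpow_nonneg (norm_nonneg _) _)]
    exact Real.rpow_le_rpow (norm_nonneg _) (hB _ h1) hp0
  have b₁ : ∀ t θ, |F₁ t θ| ≤ (B + B) ^ p := fun t θ => by
    simp only [F₁]
    have h1 : η ≤ ((η : ℂ) + (t + s * cayleyOrd θ : ℝ) * Complex.I).re := by simp
    have h2 : η ≤ ((η : ℂ) + s + t * Complex.I).re := by simp [hs.le]
    rw [abs_of_nonneg (Real.rpow_nonneg (norm_nonneg _) _)]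
    exact Real.rpow_le_rpow (norm_nonneg _)
      ((norm_sub_le _ _).trans (add_le_add (hB _ h1) (hB _ h2))) hp0
  have I₁ := integrableOn_prod_of_bound m₁ b₁ (-T) T 0 (2 * Real.pi)
  have I₂ := integrableOn_prod_of_bound m₂ b₂ (-T) T 0 (2 * Real.pi)
  have hpi : (0 : ℝ) ≤ 2 * Real.pi := by positivity
  have hTT : -T ≤ T := by linarith
  have J₁ := intervalIntegrable_integral I₁ hpi
  have J₂ := intervalIntegrable_integral I₂ hpi
  have hpt : ∀ t : ℝ, (2 * Real.pi)⁻¹ * (∫ θ in 0..(2 * Real.pi), F₁ t θ) ≤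
      (ε + convexityConst p / ε) * ((2 * Real.pi)⁻¹ * ∫ θ in 0..(2 * Real.pi), F₂ t θ) +
      (ε - convexityConst p / ε) * G t := by
    intro t
    have := integral_line_norm_sub_rpow_le hp (h := fun z => evalPoly P (z + t * Complex.I))
      ((differentiable_evalPoly P).comp (by fun_prop : Differentiable ℂ fun z : ℂ =>
        z + t * Complex.I)) hs (η := η) (B := B) (fun z hz => hB _ (by simpa using hz)) hε hε1
    refine le_trans (le_of_eq ?_) (this.trans (le_of_eq ?_))
    · simp only [F₁]
      congr 3; ext θ; congr 4; push_cast; ring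
    · simp only [F₂, G]
      congr 4; ext θ; congr 3; push_cast; ring
  have hint := intervalIntegral.integral_mono_on hTT (J₁.const_mul _)
    (((J₂.const_mul _).const_mul _).add ((hcG.intervalIntegrable _ _).const_mul _))
    fun t _ => hpt t
  rw [intervalIntegral.integral_add ((J₂.const_mul _).const_mul _)
    ((hcG.intervalIntegrable _ _).const_mul _)] at hint
  simp only [intervalIntegral.integral_const_mul] at hint
  rw [intervalIntegral_intervalIntegral_swap I₁, intervalIntegral_intervalIntegral_swap I₂] at hint
  have hint2 := mul_le_mul_of_nonneg_left hint (by positivity : 0 ≤ 1 / (2 * T))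
  have e1 : ∀ θ, truncMean p 0 (evalPoly (shift (η + (s * cayleyOrd θ : ℝ) * Complex.I) P -
      shift (η + s) P)) T = 1 / (2 * T) * ∫ t in (-T)..T, F₁ t θ := by
    intro θ
    simp only [truncMean, evalPoly_sub, evalPoly_shift, F₁]
    congr 2; ext t; congr 4 <;> push_cast <;> ring
  have e2 : truncMean p (η + s) (evalPoly P) T = 1 / (2 * T) * ∫ t in (-T)..T, G t := by
    simp only [truncMean, G]
    push_cast
    rfl
  simp only [e1, e2, intervalIntegral.integral_const_mul]
  refine le_trans (le_of_eq ?_) (hint2.trans (le_of_eq ?_)) <;> ring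

theorem tendsto_truncMean_evalPoly {p : ℝ} (hp : 0 < p) (σ : ℝ) (P : ℕ+ →₀ ℂ) :
    Tendsto (truncMean p σ (evalPoly P)) atTop (𝓝 (Mean p σ (evalPoly P) ^ p)) := by
  refine (tendsto_truncMean_translate hp σ 0 P).congr fun T => ?_
  simp only [add_zero]
  rfl

theorem truncMean_le_of_norm_le {p σ B : ℝ} (hp : 0 ≤ p) {f : ℂ → ℂ}
    (hB : ∀ t : ℝ, ‖f (σ + t * Complex.I)‖ ≤ B) {T : ℝ} (hT : 0 < T) :
    truncMean p σ f T ≤ B ^ p := by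
  have h1 := intervalIntegral.norm_integral_le_of_norm_le_const (a := -T) (b := T)
    (f := fun t : ℝ => ‖f (σ + t * Complex.I)‖ ^ p) (C := B ^ p) fun t _ => by
      rw [Real.norm_of_nonneg (by positivity)]
      exact Real.rpow_le_rpow (norm_nonneg _) (hB t) hp
  rw [show T - -T = 2 * T by ring, abs_of_pos (by positivity : 0 < 2 * T)] at h1
  calc _ ≤ 1 / (2 * T) * (B ^ p * (2 * T)) := by
        unfold truncMean
        gcongr
        exact (le_abs_self _).trans h1
    _ = B ^ p := by field_simp

theorem measurable_truncMean_shift (p : ℝ) (P R : ℕ+ →₀ ℂ) {w : ℝ → ℂ} (hw : Measurable w) {T : ℝ}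
    (hT : 0 < T) : Measurable fun θ => truncMean p 0 (evalPoly (shift (w θ) P - R)) T := by
  have h1 : Measurable fun x : ℝ × ℝ => w x.1 + ((0 : ℝ) + (x.2 : ℂ) * Complex.I) :=
    (hw.comp measurable_fst).add (by fun_prop)
  have h2 : Measurable fun x : ℝ × ℝ => ((0 : ℝ) : ℂ) + (x.2 : ℂ) * Complex.I := by fun_prop
  have h3 : Measurable fun x : ℝ × ℝ => ‖evalPoly P (w x.1 + ((0 : ℝ) + (x.2 : ℂ) * Complex.I)) -
      evalPoly R ((0 : ℝ) + (x.2 : ℂ) * Complex.I)‖ ^ p :=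
    (((continuous_evalPoly P).measurable.comp h1).sub
      ((continuous_evalPoly R).measurable.comp h2)).norm.pow_const p
  simp only [truncMean, evalPoly_sub, evalPoly_shift,
    intervalIntegral.integral_of_le (show -T ≤ T by linarith)]
  exact (h3.stronglyMeasurable.integral_prod_right
    (ν := volume.restrict (Set.Ioc (-T) T))).measurable.const_mul _

/-- Dominated convergence, as the length of the truncated means tends to infinity. -/
theorem tendsto_integral_truncMean_shift {p : ℝ} (hp : 1 ≤ p) (P R : ℕ+ →₀ ℂ) {w : ℝ → ℂ}
    (hw : Measurable w) {η : ℝ} (hη : ∀ θ, (w θ).re = η) :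
    IntervalIntegrable (fun θ => Mean p 0 (evalPoly (shift (w θ) P - R)) ^ p) volume
      0 (2 * Real.pi) ∧
    Tendsto (fun T => ∫ θ in 0..(2 * Real.pi), truncMean p 0 (evalPoly (shift (w θ) P - R)) T) atTop
      (𝓝 (∫ θ in 0..(2 * Real.pi), Mean p 0 (evalPoly (shift (w θ) P - R)) ^ p)) := by
  have hp0 : 0 < p := by linarith
  obtain ⟨B, -, hB⟩ := exists_bound_evalPoly_line R 0
  obtain ⟨A, hA⟩ : ∃ A : ℝ, ∀ z : ℂ, η ≤ z.re → ‖evalPoly P z‖ ≤ A :=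
    ⟨_, fun z hz => norm_evalPoly_le P hz⟩
  have hQ : ∀ θ (t : ℝ), ‖evalPoly (shift (w θ) P - R) ((0 : ℝ) + t * Complex.I)‖ ≤ A + B := by
    intro θ t
    rw [evalPoly_sub, evalPoly_shift]
    exact (norm_sub_le _ _).trans (add_le_add (hA _ (by simp [hη])) (hB t))
  have hlim : ∀ θ, Tendsto (truncMean p 0 (evalPoly (shift (w θ) P - R))) atTop
      (𝓝 (Mean p 0 (evalPoly (shift (w θ) P - R)) ^ p)) := fun θ =>
    tendsto_truncMean_evalPoly hp0 0 _
  have hbd : ∀ θ, ∀ T > 0, ‖truncMean p 0 (evalPoly (shift (w θ) P - R)) T‖ ≤ (A + B) ^ p := by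
    intro θ T hT
    rw [Real.norm_of_nonneg (truncMean_nonneg _ _ _ hT)]
    exact truncMean_le_of_norm_le hp0.le (hQ θ) hT
  constructor
  · have hm : AEStronglyMeasurable (fun θ => Mean p 0 (evalPoly (shift (w θ) P - R)) ^ p)
        volume := by
      refine aestronglyMeasurable_of_tendsto_ae (u := (atTop : Filter ℕ))
        (f := fun k θ => truncMean p 0 (evalPoly (shift (w θ) P - R)) ((k : ℝ) + 1))
        (fun k => (measurable_truncMean_shift p P R hw (by positivity)).aestronglyMeasurable)
        (Eventually.of_forall fun θ => (hlim θ).comp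
          (tendsto_atTop_add_const_right _ _ tendsto_natCast_atTop_atTop))
    refine (intervalIntegrable_const (c := (A + B) ^ p)).mono_fun' hm.restrict
      (Eventually.of_forall fun θ => ?_)
    exact le_of_tendsto (hlim θ).norm ((eventually_gt_atTop 0).mono fun T hT => hbd θ T hT)
  · refine intervalIntegral.tendsto_integral_filter_of_dominated_convergence
      (fun _ => (A + B) ^ p) ?_ ?_ intervalIntegrable_const
      (Eventually.of_forall fun θ _ => hlim θ)
    · filter_upwards [eventually_gt_atTop 0] with T hT
      exact (measurable_truncMean_shift p P R hw hT).aestronglyMeasurable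
    · filter_upwards [eventually_gt_atTop 0] with T hT
      exact Eventually.of_forall fun θ _ => hbd θ T hT

/-- Complex uniform convexity for the means of Dirichlet polynomials. On the right-hand side the
harmonic measure disappears, since the mean does not depend on the vertical position. -/
theorem integral_mean_sub_rpow_le {p : ℝ} (hp : 1 ≤ p) (P : ℕ+ →₀ ℂ) (η : ℝ) {s : ℝ} (hs : 0 < s)
    {ε : ℝ} (hε : 0 < ε) (hε1 : ε ≤ convexityConst p) :
    (2 * Real.pi)⁻¹ * ∫ θ in 0..(2 * Real.pi), Mean p 0
        (evalPoly (shift (η + (s * cayleyOrd θ : ℝ) * Complex.I) P - shift (η + s) P)) ^ p ≤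
      (ε + convexityConst p / ε) * Mean p η (evalPoly P) ^ p +
      (ε - convexityConst p / ε) * Mean p (η + s) (evalPoly P) ^ p := by
  have hp0 : 0 < p := by linarith
  have hw : Measurable fun θ => (η : ℂ) + (s * cayleyOrd θ : ℝ) * Complex.I :=
    ((Complex.measurable_ofReal.comp (measurable_cayleyOrd.const_mul s)).mul_const _).const_add _
  have hre : ∀ θ, ((η : ℂ) + (s * cayleyOrd θ : ℝ) * Complex.I).re = η := fun θ => by simp
  have t1 := (tendsto_integral_truncMean_shift hp P (shift (η + s) P) hw hre).2.const_mul
    (2 * Real.pi)⁻¹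
  have t2 := ((tendsto_integral_truncMean_shift hp P 0 hw hre).2.const_mul
    (2 * Real.pi)⁻¹).const_mul (ε + convexityConst p / ε)
  have t3 := (tendsto_truncMean_evalPoly hp0 (η + s) P).const_mul (ε - convexityConst p / ε)
  have hval : (2 * Real.pi)⁻¹ * ∫ θ in 0..(2 * Real.pi), Mean p 0
      (evalPoly (shift (η + (s * cayleyOrd θ : ℝ) * Complex.I) P - 0)) ^ p =
      Mean p η (evalPoly P) ^ p := by
    simp only [sub_zero, mean_shift hp0, hre, add_zero, intervalIntegral.integral_const,
      smul_eq_mul]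
    field_simp
  rw [hval] at t2
  refine le_of_tendsto_of_tendsto t1 (t2.add t3) ?_
  filter_upwards [eventually_gt_atTop 0] with T hT
  refine (integral_truncMean_le hp P η hs hε hε1 hT).trans_eq ?_
  congr 4
  ext θ
  simp only [truncMean, sub_zero, evalPoly_shift]
  congr 2
  ext t
  congr 3
  push_cast
  ring

theorem mean_neg {p : ℝ} (hp : 1 ≤ p) (σ : ℝ) (P : ℕ+ →₀ ℂ) :
    Mean p σ (evalPoly (-P)) = Mean p σ (evalPoly P) := by
  simpa using mean_smul hp σ (-1) P

theorem add_add_rpow_le {p a b c : ℝ} (hp : 0 ≤ p) (ha : 0 ≤ a) (hb : 0 ≤ b) (hc : 0 ≤ c) :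
    (a + b + c) ^ p ≤ 4 ^ p * (a ^ p + b ^ p + c ^ p) := by
  have h1 := add_rpow_le_two_rpow_mul hp (add_nonneg ha hb) hc
  have h2 := add_rpow_le_two_rpow_mul hp ha hb
  have h3 : (1 : ℝ) ≤ 2 ^ p := Real.one_le_rpow (by norm_num) hp
  have h4 : (4 : ℝ) ^ p = 2 ^ p * 2 ^ p := by
    rw [← Real.mul_rpow (by norm_num) (by norm_num)]; norm_num
  have h5 : 0 ≤ c ^ p := Real.rpow_nonneg hc p
  have h6 : 0 ≤ (2 : ℝ) ^ p := by positivity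
  have h7 := mul_le_mul_of_nonneg_left h2 h6
  have h8 := mul_le_mul_of_nonneg_left (le_mul_of_one_le_left h5 h3) h6
  rw [h4]
  linarith

/-- The vertical shift by `y` is the same on both lines and does not affect the mean. -/
theorem mean_shift_sub_le_add {p : ℝ} (hp : 1 ≤ p) (P : ℕ+ →₀ ℂ) (η η' s : ℝ) {y : ℂ}
    (hy : y.re = 0) :
    Mean p 0 (evalPoly (shift η P - shift η' P)) ≤
      Mean p 0 (evalPoly (shift (η + y) P - shift (η + s) P)) +
      Mean p 0 (evalPoly (shift (η' + y) P - shift (η' + s) P)) +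
      Mean p s (evalPoly (shift η P - shift η' P)) := by
  have hp0 : 0 < p := by linarith
  set U := shift (η + y) P - shift (η + s) P with hU
  set U' := shift (η' + y) P - shift (η' + s) P with hU'
  have h1 : shift y (shift η P - shift η' P) = U + -U' + shift s (shift η P - shift η' P) := by
    rw [hU, hU', map_sub, map_sub, shift_shift, shift_shift, shift_shift, shift_shift,
      add_comm y, add_comm y, add_comm (s : ℂ), add_comm (s : ℂ)]
    abel
  have h2 := mean_shift hp0 0 y (shift η P - shift η' P)
  have h3 := mean_shift hp0 0 s (shift η P - shift η' P)
  rw [hy, zero_add] at h2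
  rw [Complex.ofReal_re, add_zero] at h3
  rw [← h2, ← h3, h1, ← mean_neg hp 0 U']
  exact (mean_add_le hp 0 _ _).trans (add_le_add_left (mean_add_le hp 0 U (-U')) _)

/-- Two horizontal translates of a Dirichlet polynomial are close to each other if the means do not
vary much, and if the translates further to the right are close. Since the mean depends on the real
part only, the point of comparison for each of the two translates may be moved vertically; on both
lines the same harmonic measure is used, and so the vertical shifts agree. -/
theorem mean_shift_sub_rpow_le {p : ℝ} (hp : 1 ≤ p) (P : ℕ+ →₀ ℂ) (η η' : ℝ) {s : ℝ} (hs : 0 < s)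
    {ε : ℝ} (hε : 0 < ε) (hε1 : ε ≤ convexityConst p) :
    Mean p 0 (evalPoly (shift η P - shift η' P)) ^ p ≤ 4 ^ p *
      ((ε + convexityConst p / ε) * Mean p η (evalPoly P) ^ p +
        (ε - convexityConst p / ε) * Mean p (η + s) (evalPoly P) ^ p +
      ((ε + convexityConst p / ε) * Mean p η' (evalPoly P) ^ p +
        (ε - convexityConst p / ε) * Mean p (η' + s) (evalPoly P) ^ p) +
      Mean p s (evalPoly (shift η P - shift η' P)) ^ p) := by
  have hp0 : 0 < p := by linarith
  have hN0 : ∀ Q : ℕ+ →₀ ℂ, 0 ≤ Mean p 0 (evalPoly Q) := fun Q =>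
    (meanExists_evalPoly hp0 0 Q).mean_nonneg hp0
  set D := Mean p 0 (evalPoly (shift η P - shift η' P))
  set E := Mean p s (evalPoly (shift η P - shift η' P))
  have hE0 : 0 ≤ E := (meanExists_evalPoly hp0 s _).mean_nonneg hp0
  let A : ℝ → ℝ → ℝ := fun η θ => Mean p 0
    (evalPoly (shift (η + (s * cayleyOrd θ : ℝ) * Complex.I) P - shift (η + s) P)) ^ p
  have hw : ∀ η : ℝ, Measurable fun θ => (η : ℂ) + (s * cayleyOrd θ : ℝ) * Complex.I := fun η =>
    ((Complex.measurable_ofReal.comp (measurable_cayleyOrd.const_mul s)).mul_const _).const_add _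
  have hA : ∀ η, IntervalIntegrable (A η) volume 0 (2 * Real.pi) := fun η =>
    (tendsto_integral_truncMean_shift hp P (shift (η + s) P) (hw η) (η := η)
      (fun θ => by simp)).1
  have hpt : ∀ θ, D ^ p ≤ 4 ^ p * (A η θ + A η' θ + E ^ p) := fun θ =>
    (Real.rpow_le_rpow (hN0 _) (mean_shift_sub_le_add hp P η η' s
      (y := (s * cayleyOrd θ : ℝ) * Complex.I) (by simp)) hp0.le).trans
      (add_add_rpow_le hp0.le (hN0 _) (hN0 _) hE0)
  have hint := intervalIntegral.integral_mono_on (by positivity : (0 : ℝ) ≤ 2 * Real.pi)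
    intervalIntegrable_const ((((hA η).add (hA η')).add
      (intervalIntegrable_const (c := E ^ p))).const_mul (4 ^ p)) fun θ _ => hpt θ
  rw [intervalIntegral.integral_const_mul, intervalIntegral.integral_add ((hA η).add (hA η'))
    intervalIntegrable_const, intervalIntegral.integral_add (hA η) (hA η'),
    intervalIntegral.integral_const, intervalIntegral.integral_const, smul_eq_mul, smul_eq_mul,
    sub_zero] at hint
  have k1 := integral_mean_sub_rpow_le hp P η hs hε hε1
  have k2 := integral_mean_sub_rpow_le hp P η' hs hε hε1
  have hpi : 0 < 2 * Real.pi := by positivity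
  have h3 := mul_le_mul_of_nonneg_left hint (inv_pos.2 hpi).le
  rw [inv_mul_cancel_left₀ hpi.ne'] at h3
  refine h3.trans ?_
  calc _ = 4 ^ p * ((2 * Real.pi)⁻¹ * (∫ θ in 0..(2 * Real.pi), A η θ) +
        (2 * Real.pi)⁻¹ * (∫ θ in 0..(2 * Real.pi), A η' θ) + E ^ p) := by
        field_simp
    _ ≤ _ := by gcongr

/-! ### Hölder's inequality for weighted integrals -/

/-- Hölder's inequality for the measure with density `‖K‖`. -/
theorem norm_integral_mul_rpow_le {α : Type*} [MeasurableSpace α] {μ : Measure α} {p : ℝ}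
    (hp : 1 ≤ p) {h K : α → ℂ} (hh : AEStronglyMeasurable h μ) (hK : Integrable K μ)
    (hhK : Integrable (fun x => ‖h x‖ ^ p * ‖K x‖) μ) :
    ‖∫ x, h x * K x ∂μ‖ ^ p ≤ (∫ x, ‖K x‖ ∂μ) ^ (p - 1) * ∫ x, ‖h x‖ ^ p * ‖K x‖ ∂μ := by
  have hp0 : 0 < p := by linarith
  have hn : ‖∫ x, h x * K x ∂μ‖ ≤ ∫ x, ‖h x‖ * ‖K x‖ ∂μ := by
    simpa only [norm_mul] using norm_integral_le_integral_norm (μ := μ) fun x => h x * K x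
  have hA : 0 ≤ ∫ x, ‖K x‖ ∂μ := integral_nonneg fun x => norm_nonneg _
  have hB : 0 ≤ ∫ x, ‖h x‖ ^ p * ‖K x‖ ∂μ := integral_nonneg fun x => by positivity
  rcases hp.eq_or_lt with rfl | hp1
  · simpa using hn
  have hq := Real.HolderConjugate.conjExponent hp1
  set q := p.conjExponent
  have hq0 : 0 < q := hq.symm.pos
  have hm1 : MemLp (fun x => ‖h x‖ * ‖K x‖ ^ (1 / p)) (ENNReal.ofReal p) μ := by
    have hm : AEStronglyMeasurable (fun x => ‖h x‖ * ‖K x‖ ^ (1 / p)) μ :=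
      hh.norm.mul (hK.aestronglyMeasurable.norm.aemeasurable.pow_const _).aestronglyMeasurable
    rw [← integrable_norm_rpow_iff hm (by simpa using hp0) ENNReal.ofReal_ne_top,
      ENNReal.toReal_ofReal hp0.le]
    refine hhK.congr (Eventually.of_forall fun x => ?_)
    dsimp only
    rw [Real.norm_of_nonneg (by positivity), Real.mul_rpow (norm_nonneg _) (by positivity),
      ← Real.rpow_mul (norm_nonneg _), one_div_mul_cancel hp0.ne', Real.rpow_one]
  have hm2 : MemLp (fun x => ‖K x‖ ^ (1 / q)) (ENNReal.ofReal q) μ := by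
    rw [← integrable_norm_rpow_iff (hK.aestronglyMeasurable.norm.aemeasurable.pow_const
      _).aestronglyMeasurable (by simpa using hq0) ENNReal.ofReal_ne_top,
      ENNReal.toReal_ofReal hq0.le]
    refine hK.norm.congr (Eventually.of_forall fun x => ?_)
    dsimp only
    rw [Real.norm_of_nonneg (by positivity),
      ← Real.rpow_mul (norm_nonneg _), one_div_mul_cancel hq0.ne', Real.rpow_one]
  have hH := integral_mul_le_Lp_mul_Lq_of_nonneg hq (Eventually.of_forall fun x => by
    simp only [Pi.zero_apply]; positivity) (Eventually.of_forall fun x => by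
    simp only [Pi.zero_apply]; positivity) hm1 hm2
  have e1 : ∀ x, ‖h x‖ * ‖K x‖ ^ (1 / p) * ‖K x‖ ^ (1 / q) = ‖h x‖ * ‖K x‖ := fun x => by
    have h1 : 1 / p + 1 / q = 1 := by
      have := hq.inv_add_inv_eq_one
      simpa [one_div] using this
    rw [mul_assoc, ← Real.rpow_add_of_nonneg (norm_nonneg _) (by positivity) (by positivity), h1,
      Real.rpow_one]
  have e2 : ∀ x, (‖h x‖ * ‖K x‖ ^ (1 / p)) ^ p = ‖h x‖ ^ p * ‖K x‖ := fun x => by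
    rw [Real.mul_rpow (norm_nonneg _) (by positivity),
      ← Real.rpow_mul (norm_nonneg _), one_div_mul_cancel hp0.ne', Real.rpow_one]
  have e3 : ∀ x, (‖K x‖ ^ (1 / q)) ^ q = ‖K x‖ := fun x => by
    rw [← Real.rpow_mul (norm_nonneg _), one_div_mul_cancel hq0.ne', Real.rpow_one]
  simp only [e1, e2, e3] at hH
  calc _ ≤ ((∫ x, ‖h x‖ ^ p * ‖K x‖ ∂μ) ^ (1 / p) * (∫ x, ‖K x‖ ∂μ) ^ (1 / q)) ^ p :=
        Real.rpow_le_rpow (norm_nonneg _) (hn.trans hH) hp0.le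
    _ = _ := by
      rw [Real.mul_rpow (by positivity) (by positivity), ← Real.rpow_mul hB, ← Real.rpow_mul hA,
        one_div_mul_cancel hp0.ne', Real.rpow_one, mul_comm]
      congr 2
      have := hq.symm.sub_one_mul_conj
      have h1 : q = p / (p - 1) := rfl
      have : p - 1 ≠ 0 := by linarith
      rw [h1]; field_simp

theorem norm_intervalIntegral_rpow_le {p : ℝ} (hp : 1 ≤ p) {h : ℝ → ℂ} (hh : Continuous h) {a b : ℝ}
    (hab : a ≤ b) :
    ‖∫ x in a..b, h x‖ ^ p ≤ (b - a) ^ (p - 1) * ∫ x in a..b, ‖h x‖ ^ p := by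
  have hc : Continuous fun x => ‖h x‖ ^ p := hh.norm.rpow_const fun _ => Or.inr (by linarith)
  have := norm_integral_mul_rpow_le (μ := volume.restrict (Set.Ioc a b)) hp (h := h)
    (K := fun _ => 1) hh.aestronglyMeasurable (integrable_const _)
    (by simpa only [norm_one, mul_one] using! hc.integrableOn_Ioc (a := a) (b := b))
  rw [intervalIntegral.integral_of_le hab, intervalIntegral.integral_of_le hab]
  simpa [hab] using this

/-! ### Analytic functions with bounded means -/

/-- The function `f` is analytic to the right of the line `Re s = σ₀`, and its means of order `p`
over the segments `[σ - iT, σ + iT]` with `σ > σ₀` and `T ≥ 1` do not exceed `C`. -/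
structure BoundedMeans (p σ₀ C : ℝ) (f : ℂ → ℂ) : Prop where
  differentiableOn : DifferentiableOn ℂ f {s | σ₀ < s.re}
  integral_le : ∀ σ, σ₀ < σ → ∀ T, 1 ≤ T →
    ∫ t in (-T)..T, ‖f (σ + t * Complex.I)‖ ^ p ≤ 2 * T * C

theorem isOpen_re_gt (σ₀ : ℝ) : IsOpen {s : ℂ | σ₀ < s.re} :=
  isOpen_lt continuous_const Complex.continuous_re

namespace BoundedMeans

variable {p σ₀ C : ℝ} {f : ℂ → ℂ}

theorem continuous_comp {X : Type*} [TopologicalSpace X] (hf : BoundedMeans p σ₀ C f) {φ : X → ℂ}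
    (hφ : Continuous φ) (h : ∀ x, σ₀ < (φ x).re) : Continuous fun x => f (φ x) :=
  hf.differentiableOn.continuousOn.comp_continuous hφ h

theorem differentiableAt (hf : BoundedMeans p σ₀ C f) {s : ℂ} (hs : σ₀ < s.re) :
    DifferentiableAt ℂ f s :=
  hf.differentiableOn.differentiableAt ((isOpen_re_gt σ₀).mem_nhds hs)

theorem mono (hf : BoundedMeans p σ₀ C f) {σ₁ : ℝ} (h : σ₀ ≤ σ₁) : BoundedMeans p σ₁ C f where
  differentiableOn := hf.differentiableOn.mono fun _ hs => lt_of_le_of_lt h hs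
  integral_le σ hσ := hf.integral_le σ (h.trans_lt hσ)

theorem continuous_line (hf : BoundedMeans p σ₀ C f) {σ : ℝ} (hσ : σ₀ < σ) (y : ℝ) :
    Continuous fun t : ℝ => f (σ + (t + y : ℝ) * Complex.I) :=
  hf.continuous_comp (by fun_prop) (by simpa using hσ)

/-- The bound on a segment that is centred at height `y`. -/
theorem integral_line_le (hf : BoundedMeans p σ₀ C f) (hp : 0 ≤ p) {σ : ℝ} (hσ : σ₀ < σ) {T : ℝ}
    (hT : 1 ≤ T) (y : ℝ) :
    ∫ t in (-T)..T, ‖f (σ + (t + y : ℝ) * Complex.I)‖ ^ p ≤ 2 * (T + |y|) * C := by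
  have hc : Continuous fun t : ℝ => ‖f (σ + t * Complex.I)‖ ^ p := by
    simpa using ((hf.continuous_line hσ 0).norm.rpow_const fun _ => Or.inr hp)
  rw [intervalIntegral.integral_comp_add_right (fun t : ℝ => ‖f (σ + t * Complex.I)‖ ^ p)]
  refine le_trans ?_ (hf.integral_le σ hσ (T + |y|) (by linarith [abs_nonneg y]))
  have h1 := le_abs_self y
  have h2 := neg_abs_le y
  exact intervalIntegral.integral_mono_interval (by linarith) (by linarith) (by linarith)
    (Eventually.of_forall fun t => by simp only [Pi.zero_apply]; positivity)
    (hc.intervalIntegrable _ _)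

theorem const_nonneg (hf : BoundedMeans p σ₀ C f) : 0 ≤ C := by
  have h1 := hf.integral_le (σ₀ + 1) (by linarith) 1 le_rfl
  have h2 := intervalIntegral.integral_nonneg (μ := volume) (by norm_num : (-1 : ℝ) ≤ 1)
    fun t _ => Real.rpow_nonneg (norm_nonneg (f ((σ₀ + 1 : ℝ) + t * Complex.I))) p
  linarith

end BoundedMeans

/-- Cauchy's integral formula for the derivative. -/
theorem norm_deriv_le_integral {f : ℂ → ℂ} {U : Set ℂ} (hU : IsOpen U)
    (hf : DifferentiableOn ℂ f U) {s : ℂ} {r : ℝ} (hr : 0 < r) (hs : Metric.closedBall s r ⊆ U) :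
    ‖deriv f s‖ ≤ (2 * Real.pi * r)⁻¹ * ∫ θ in 0..(2 * Real.pi), ‖f (s + circleMap 0 r θ)‖ := by
  rw [← Complex.two_pi_I_inv_smul_circleIntegral_sub_sq_inv_smul_of_differentiable hU hs hf
    (Metric.mem_ball_self hr), norm_smul, circleIntegral]
  have h1 : ‖(2 * Real.pi * Complex.I : ℂ)⁻¹‖ = (2 * Real.pi)⁻¹ := by
    simp [abs_of_pos Real.pi_pos]
  have h2 : ∀ θ, ‖deriv (circleMap s r) θ • ((circleMap s r θ - s) ^ 2)⁻¹ • f (circleMap s r θ)‖ =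
      r⁻¹ * ‖f (s + circleMap 0 r θ)‖ := fun θ => by
    have h3 : circleMap s r θ = s + circleMap 0 r θ := by simp [circleMap]
    rw [norm_smul, norm_smul, deriv_circleMap, circleMap_sub_center, norm_inv, norm_pow, norm_mul,
      norm_circleMap_zero, Complex.norm_I, abs_of_pos hr, h3]
    field_simp
  have h4 := intervalIntegral.norm_integral_le_integral_norm (μ := volume) (a := 0)
    (b := 2 * Real.pi) (f := fun θ => deriv (circleMap s r) θ •
      ((circleMap s r θ - s) ^ 2)⁻¹ • f (circleMap s r θ)) (by positivity)
  simp only [h2] at h4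
  rw [intervalIntegral.integral_const_mul] at h4
  rw [h1, show (2 * Real.pi * r)⁻¹ = (2 * Real.pi)⁻¹ * r⁻¹ from mul_inv _ _, mul_assoc]
  exact mul_le_mul_of_nonneg_left h4 (by positivity)

theorem integrableOn_prod_of_continuous {F : ℝ → ℝ → ℝ} (hF : Continuous (Function.uncurry F))
    (a b c d : ℝ) : IntegrableOn (Function.uncurry F) (Set.uIoc a b ×ˢ Set.uIoc c d) :=
  (hF.continuousOn.integrableOn_compact
    ((isCompact_uIcc (a := a) (b := b)).prod (isCompact_uIcc (a := c) (b := d)))).mono_set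
    (Set.prod_mono Set.uIoc_subset_uIcc Set.uIoc_subset_uIcc)

theorem continuous_uncurry_swap {F : ℝ → ℝ → ℝ} (hF : Continuous (Function.uncurry F)) :
    Continuous (Function.uncurry fun θ t => F t θ) :=
  hF.comp continuous_swap

/-- The derivative has bounded means, by Cauchy's integral formula on circles of radius `r`. These
reach out of the segment of half-length `T` by at most `r ≤ r * T`; hence the factor `1 + r`. -/
theorem BoundedMeans.deriv {p σ₀ C : ℝ} {f : ℂ → ℂ} (hf : BoundedMeans p σ₀ C f) (hp : 1 ≤ p)
    {r : ℝ} (hr : 0 < r) : BoundedMeans p (σ₀ + r) (r⁻¹ ^ p * ((1 + r) * C)) (deriv f) where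
  differentiableOn := (hf.differentiableOn.deriv (isOpen_re_gt σ₀)).mono fun s hs => by
    simp only [Set.mem_ofPred_eq] at hs ⊢; linarith
  integral_le σ hσ T hT := by
    have hp0 : 0 < p := by linarith
    have hpi : (0 : ℝ) < 2 * Real.pi := by positivity
    have hC := hf.const_nonneg
    have hre : ∀ θ, |(circleMap 0 r θ).re| ≤ r := fun θ =>
      (Complex.abs_re_le_norm _).trans (by rw [norm_circleMap_zero, abs_of_pos hr])
    have him : ∀ θ, |(circleMap 0 r θ).im| ≤ r := fun θ =>
      (Complex.abs_im_le_norm _).trans (by rw [norm_circleMap_zero, abs_of_pos hr])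
    have hre' : ∀ θ, σ₀ < σ + (circleMap 0 r θ).re := fun θ => by
      have := (abs_le.1 (hre θ)).1; linarith
    let F : ℝ → ℝ → ℝ := fun t θ => ‖f (σ + t * Complex.I + circleMap 0 r θ)‖ ^ p
    have hcF' : Continuous fun x : ℝ × ℝ => f (σ + x.1 * Complex.I + circleMap 0 r x.2) :=
      hf.continuous_comp (by have := continuous_circleMap 0 r; fun_prop)
        (fun x => by simpa using hre' x.2)
    have hcF : Continuous (Function.uncurry F) := hcF'.norm.rpow_const fun _ => Or.inr hp0.le
    have hd : ∀ t : ℝ, ‖_root_.deriv f (σ + t * Complex.I)‖ ^ p ≤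
        r⁻¹ ^ p * ((2 * Real.pi)⁻¹ * ∫ θ in 0..(2 * Real.pi), F t θ) := by
      intro t
      have h1 := norm_deriv_le_integral (isOpen_re_gt σ₀) hf.differentiableOn (s := σ +
        t * Complex.I) hr (fun z hz => by
          have h2 := (Complex.abs_re_le_norm (z - (σ + t * Complex.I))).trans
            (mem_closedBall_iff_norm.1 hz)
          have h3 := (abs_le.1 h2).1
          simp only [Set.mem_ofPred_eq]
          simp at h3
          linarith)
      have hct : Continuous fun θ => f (σ + t * Complex.I + circleMap 0 r θ) :=
        hcF'.comp (by fun_prop : Continuous fun θ : ℝ => (t, θ))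
      have h4 := norm_intervalIntegral_rpow_le hp
        (h := fun θ => (‖f (σ + t * Complex.I + circleMap 0 r θ)‖ : ℂ))
        (Complex.continuous_ofReal.comp hct.norm) hpi.le
      rw [intervalIntegral.integral_ofReal, Complex.norm_real, Real.norm_of_nonneg
        (intervalIntegral.integral_nonneg hpi.le fun θ _ => norm_nonneg _)] at h4
      simp only [Complex.norm_real, norm_norm, sub_zero] at h4
      calc _ ≤ ((2 * Real.pi * r)⁻¹ *
            ∫ θ in 0..(2 * Real.pi), ‖f (σ + t * Complex.I + circleMap 0 r θ)‖) ^ p :=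
            Real.rpow_le_rpow (norm_nonneg _) h1 hp0.le
        _ = r⁻¹ ^ p * (((2 * Real.pi)⁻¹) ^ p *
            (∫ θ in 0..(2 * Real.pi), ‖f (σ + t * Complex.I + circleMap 0 r θ)‖) ^ p) := by
            rw [Real.mul_rpow (by positivity)
              (intervalIntegral.integral_nonneg hpi.le fun θ _ => norm_nonneg _), mul_inv,
              Real.mul_rpow (by positivity) (by positivity)]
            ring
        _ ≤ r⁻¹ ^ p * (((2 * Real.pi)⁻¹) ^ p * ((2 * Real.pi) ^ (p - 1) *
            ∫ θ in 0..(2 * Real.pi), F t θ)) := by gcongr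
        _ = _ := by
            rw [Real.rpow_sub_one hpi.ne', Real.inv_rpow hpi.le]
            field_simp
    have hI := integrableOn_prod_of_continuous hcF (-T) T 0 (2 * Real.pi)
    have hcd : Continuous fun t : ℝ => _root_.deriv f (σ + t * Complex.I) :=
      ((hf.differentiableOn.deriv (isOpen_re_gt σ₀)).continuousOn).comp_continuous (by fun_prop)
        (fun t => by simp; linarith)
    have hinner : ∀ θ, ∫ t in (-T)..T, F t θ ≤ 2 * T * ((1 + r) * C) := by
      intro θ
      have h1 := hf.integral_line_le hp0.le (hre' θ) hT (circleMap 0 r θ).im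
      have h2 : ∀ t : ℝ, F t θ = ‖f ((σ + (circleMap 0 r θ).re : ℝ) +
          (t + (circleMap 0 r θ).im : ℝ) * Complex.I)‖ ^ p := fun t => by
        simp only [F]
        congr 3
        nth_rw 1 [← Complex.re_add_im (circleMap 0 r θ)]
        push_cast
        ring
      simp only [h2]
      refine h1.trans ?_
      have h3 := him θ
      have h4 : T + |(circleMap 0 r θ).im| ≤ T * (1 + r) := by nlinarith
      nlinarith
    calc ∫ t in (-T)..T, ‖_root_.deriv f (σ + t * Complex.I)‖ ^ p
        ≤ ∫ t in (-T)..T, r⁻¹ ^ p * ((2 * Real.pi)⁻¹ * ∫ θ in 0..(2 * Real.pi), F t θ) :=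
          intervalIntegral.integral_mono_on (by linarith)
            ((hcd.norm.rpow_const fun _ => Or.inr hp0.le).intervalIntegrable _ _)
            (((intervalIntegrable_integral hI hpi.le).const_mul _).const_mul _) fun t _ => hd t
      _ = r⁻¹ ^ p * ((2 * Real.pi)⁻¹ * ∫ θ in 0..(2 * Real.pi), ∫ t in (-T)..T, F t θ) := by
          rw [intervalIntegral.integral_const_mul, intervalIntegral.integral_const_mul,
            intervalIntegral_intervalIntegral_swap hI]
      _ ≤ r⁻¹ ^ p * ((2 * Real.pi)⁻¹ * ∫ θ in 0..(2 * Real.pi), 2 * T * ((1 + r) * C)) := by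
          have hI' : Continuous (Function.uncurry fun θ t => F t θ) :=
            continuous_uncurry_swap hcF
          have hI2 := intervalIntegrable_integral (F := fun θ t => F t θ)
            (integrableOn_prod_of_continuous hI' 0 (2 * Real.pi) (-T) T)
            (show -T ≤ T by linarith)
          have := intervalIntegral.integral_mono_on hpi.le hI2
            (intervalIntegrable_const (c := 2 * T * ((1 + r) * C))) fun θ _ => hinner θ
          exact mul_le_mul_of_nonneg_left (mul_le_mul_of_nonneg_left this (by positivity))
            (by positivity)
      _ = _ := by
          rw [intervalIntegral.integral_const, smul_eq_mul]
          field_simp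
          ring

/-! ### Growth and vertical translation -/

theorem le_one_add_rpow {x p : ℝ} (hx : 0 ≤ x) (hp : 1 ≤ p) : x ≤ 1 + x ^ p := by
  rcases le_total x 1 with h | h
  · linarith [Real.rpow_nonneg hx p]
  · have := Real.rpow_le_rpow_of_exponent_le h hp
    rw [Real.rpow_one] at this
    linarith

namespace BoundedMeans

variable {p σ₀ C : ℝ} {f : ℂ → ℂ}

theorem continuous_line_zero (hf : BoundedMeans p σ₀ C f) {σ : ℝ} (hσ : σ₀ < σ) :
    Continuous fun t : ℝ => f (σ + t * Complex.I) := by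
  simpa using hf.continuous_line hσ 0

theorem integral_unit_le (hf : BoundedMeans p σ₀ C f) (hp : 1 ≤ p) {σ : ℝ} (hσ : σ₀ < σ) (τ : ℝ) :
    ∫ t in τ..(τ + 1), ‖f (σ + t * Complex.I)‖ ≤ 1 + 2 * (|τ| + 1) * C := by
  have hc := (hf.continuous_line_zero hσ).norm
  have hcp : Continuous fun t : ℝ => ‖f (σ + t * Complex.I)‖ ^ p :=
    hc.rpow_const fun _ => Or.inr (by linarith)
  have h1 := le_abs_self τ
  have h2 := neg_abs_le τ
  calc ∫ t in τ..(τ + 1), ‖f (σ + t * Complex.I)‖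
      ≤ ∫ t in τ..(τ + 1), (1 + ‖f (σ + t * Complex.I)‖ ^ p) :=
        intervalIntegral.integral_mono_on (by linarith) (hc.intervalIntegrable _ _)
          ((continuous_const.add hcp).intervalIntegrable _ _)
          fun t _ => le_one_add_rpow (norm_nonneg _) hp
    _ = 1 + ∫ t in τ..(τ + 1), ‖f (σ + t * Complex.I)‖ ^ p := by
        rw [intervalIntegral.integral_add intervalIntegrable_const (hcp.intervalIntegrable _ _)]
        simp
    _ ≤ 1 + ∫ t in (-(|τ| + 1))..(|τ| + 1), ‖f (σ + t * Complex.I)‖ ^ p := by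
        gcongr
        exact intervalIntegral.integral_mono_interval (by linarith) (by linarith) (by linarith)
          (Eventually.of_forall fun t => by simp only [Pi.zero_apply]; positivity)
          (hcp.intervalIntegrable _ _)
    _ ≤ _ := by
        gcongr
        exact hf.integral_le σ hσ _ (by linarith [abs_nonneg τ])

theorem hasDerivAt_line (hf : BoundedMeans p σ₀ C f) {σ : ℝ} (hσ : σ₀ < σ) (t : ℝ) :
    HasDerivAt (fun t : ℝ => f (σ + t * Complex.I))
      (_root_.deriv f (σ + t * Complex.I) * Complex.I) t := by
  have h1 : HasDerivAt (fun t : ℝ => (σ : ℂ) + t * Complex.I) Complex.I t := by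
    simpa using ((Complex.ofRealCLM.hasDerivAt (x := t)).mul_const Complex.I).const_add (σ : ℂ)
  have h2 := (hf.differentiableAt (s := σ + t * Complex.I) (by simpa using hσ)).hasDerivAt
  exact h2.comp t h1

/-- A function with bounded means grows at most linearly in vertical direction. -/
theorem exists_growth (hf : BoundedMeans p σ₀ C f) (hp : 1 ≤ p) {σ₁ : ℝ} (h : σ₀ < σ₁) :
    ∃ G : ℝ, 0 ≤ G ∧ ∀ s : ℂ, σ₁ < s.re → ‖f s‖ ≤ G * (1 + |s.im|) := by
  have hr : 0 < σ₁ - σ₀ := sub_pos.2 h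
  have hd := hf.deriv hp hr
  rw [add_sub_cancel] at hd
  set C' := (σ₁ - σ₀)⁻¹ ^ p * ((1 + (σ₁ - σ₀)) * C)
  have hC := hf.const_nonneg
  have hC' := hd.const_nonneg
  refine ⟨2 + 2 * C + 2 * C', by positivity, fun s hs => ?_⟩
  obtain ⟨σ, τ, rfl⟩ : ∃ σ τ : ℝ, s = σ + τ * Complex.I := ⟨s.re, s.im, (Complex.re_add_im s).symm⟩
  have hσ : σ₁ < σ := by simpa using hs
  have hcd := hd.continuous_line_zero hσ
  have hpt : ∀ u ∈ Set.Icc τ (τ + 1), ‖f (σ + τ * Complex.I)‖ ≤ ‖f (σ + u * Complex.I)‖ +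
      ∫ t in τ..(τ + 1), ‖_root_.deriv f (σ + t * Complex.I)‖ := by
    intro u hu
    have h1 := intervalIntegral.integral_eq_sub_of_hasDerivAt (a := τ) (b := u)
      (fun t _ => hf.hasDerivAt_line (h.trans hσ) t)
      ((hcd.mul continuous_const).intervalIntegrable _ _)
    have h2 := intervalIntegral.norm_integral_le_integral_norm (μ := volume) (f := fun t : ℝ =>
      _root_.deriv f (σ + t * Complex.I) * Complex.I) hu.1
    simp only [norm_mul, Complex.norm_I, mul_one] at h2
    have h3 : ∫ t in τ..u, ‖_root_.deriv f (σ + t * Complex.I)‖ ≤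
        ∫ t in τ..(τ + 1), ‖_root_.deriv f (σ + t * Complex.I)‖ :=
      intervalIntegral.integral_mono_interval le_rfl hu.1 hu.2
        (Eventually.of_forall fun t => by simp only [Pi.zero_apply]; positivity)
        (hcd.norm.intervalIntegrable _ _)
    rw [h1] at h2
    have h4 := norm_sub_norm_le (f (σ + τ * Complex.I)) (f (σ + u * Complex.I))
    rw [norm_sub_rev] at h4
    linarith
  have hc := (hf.continuous_line_zero (h.trans hσ)).norm
  have h5 := intervalIntegral.integral_mono_on (μ := volume) (by linarith : τ ≤ τ + 1)
    intervalIntegrable_const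
    ((hc.intervalIntegrable _ _).add intervalIntegrable_const) hpt
  rw [intervalIntegral.integral_add (hc.intervalIntegrable _ _) intervalIntegrable_const] at h5
  simp only [intervalIntegral.integral_const, add_sub_cancel_left, one_smul] at h5
  have h6 := hf.integral_unit_le hp (h.trans hσ) τ
  have h7 := hd.integral_unit_le hp hσ τ
  have h8 : ((σ : ℂ) + τ * Complex.I).im = τ := by simp
  rw [h8]
  nlinarith [abs_nonneg τ]

/-- Vertical translation is continuous in the mean, with a bound coming from the derivative. -/
theorem integral_norm_sub_le {C' : ℝ} (hf : BoundedMeans p σ₀ C f) (hp : 1 ≤ p)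
    (hd : BoundedMeans p σ₀ C' (_root_.deriv f)) {σ : ℝ} (hσ : σ₀ < σ) {T : ℝ} (hT : 1 ≤ T)
    (u : ℝ) :
    ∫ t in (-T)..T, ‖f (σ + (t + u : ℝ) * Complex.I) - f (σ + t * Complex.I)‖ ^ p ≤
      |u| ^ p * (2 * (T + |u|) * C') := by
  have hp0 : 0 < p := by linarith
  have hC' := hd.const_nonneg
  let F : ℝ → ℝ → ℝ := fun t x => ‖_root_.deriv f (σ + (t + x * u : ℝ) * Complex.I)‖ ^ p
  have hcF' : Continuous fun x : ℝ × ℝ => _root_.deriv f (σ + (x.1 + x.2 * u : ℝ) * Complex.I) :=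
    hd.continuous_comp (by fun_prop) (fun x => by simpa using hσ)
  have hcF : Continuous (Function.uncurry F) := hcF'.norm.rpow_const fun _ => Or.inr hp0.le
  have hI := integrableOn_prod_of_continuous hcF (-T) T 0 1
  have hpt : ∀ t : ℝ, ‖f (σ + (t + u : ℝ) * Complex.I) - f (σ + t * Complex.I)‖ ^ p ≤
      |u| ^ p * ∫ x in 0..1, F t x := by
    intro t
    have hcx : Continuous fun x : ℝ => _root_.deriv f (σ + (t + x * u : ℝ) * Complex.I) :=
      hcF'.comp (by fun_prop : Continuous fun x : ℝ => (t, x))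
    have h1 := intervalIntegral.integral_eq_sub_of_hasDerivAt (a := 0) (b := 1)
      (f := fun x : ℝ => f (σ + (t + x * u : ℝ) * Complex.I))
      (f' := fun x : ℝ => _root_.deriv f (σ + (t + x * u : ℝ) * Complex.I) * (u * Complex.I))
      (fun x _ => by
        have h2 := hf.hasDerivAt_line hσ (t + x * u)
        have h3 : HasDerivAt (fun x : ℝ => t + x * u) u x := by
          simpa using ((hasDerivAt_id x).mul_const u).const_add t
        have := h2.scomp x h3
        refine this.congr_deriv ?_
        rw [Complex.real_smul]; ring)
      ((hcx.mul continuous_const).intervalIntegrable _ _)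
    simp only [one_mul, zero_mul, add_zero] at h1
    rw [← h1, intervalIntegral.integral_mul_const, norm_mul, mul_comm,
      Real.mul_rpow (norm_nonneg _) (norm_nonneg _)]
    have h4 := norm_intervalIntegral_rpow_le hp hcx zero_le_one
    rw [sub_zero, Real.one_rpow, one_mul] at h4
    have h5 : ‖(u * Complex.I : ℂ)‖ = |u| := by simp
    rw [h5]
    exact mul_le_mul_of_nonneg_left h4 (by positivity)
  have hinner : ∀ x ∈ Set.Icc (0 : ℝ) 1, ∫ t in (-T)..T, F t x ≤ 2 * (T + |u|) * C' := by
    intro x hx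
    refine (hd.integral_line_le hp0.le hσ hT (x * u)).trans ?_
    have : |x * u| ≤ |u| := by
      rw [abs_mul, abs_of_nonneg hx.1]
      exact mul_le_of_le_one_left (abs_nonneg _) hx.2
    gcongr
  have hc1 : Continuous fun t : ℝ =>
      ‖f (σ + (t + u : ℝ) * Complex.I) - f (σ + t * Complex.I)‖ ^ p :=
    ((hf.continuous_line hσ u).sub (hf.continuous_line_zero hσ)).norm.rpow_const
      fun _ => Or.inr hp0.le
  have hI2 := intervalIntegrable_integral (F := fun x t => F t x)
    (integrableOn_prod_of_continuous (continuous_uncurry_swap hcF) 0 1 (-T) T)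
    (show -T ≤ T by linarith)
  have h6 := intervalIntegral.integral_mono_on zero_le_one hI2
    (intervalIntegrable_const (c := 2 * (T + |u|) * C')) hinner
  rw [intervalIntegral.integral_const, sub_zero, one_smul] at h6
  calc _ ≤ ∫ t in (-T)..T, |u| ^ p * ∫ x in 0..1, F t x :=
        intervalIntegral.integral_mono_on (by linarith) (hc1.intervalIntegrable _ _)
          ((intervalIntegrable_integral hI zero_le_one).const_mul _) fun t _ => hpt t
    _ = |u| ^ p * ∫ x in 0..1, ∫ t in (-T)..T, F t x := by
        rw [intervalIntegral.integral_const_mul, intervalIntegral_intervalIntegral_swap hI]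
    _ ≤ _ := mul_le_mul_of_nonneg_left h6 (by positivity)

end BoundedMeans

/-! ### Vertical convolution with a Schwartz function -/

theorem integrable_one_add_abs_rpow_mul (K : SchwartzMap ℝ ℂ) {q : ℝ} (hq : 0 ≤ q) :
    Integrable fun v : ℝ => (1 + |v|) ^ q * ‖K v‖ := by
  obtain ⟨m, hm⟩ := exists_nat_ge q
  have h1 := (SchwartzMap.integrable_pow_mul volume K 0).add
    (SchwartzMap.integrable_pow_mul volume K m)
  refine (h1.const_mul (2 ^ (m : ℝ))).mono' ?_ (Eventually.of_forall fun v => ?_)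
  · refine Continuous.aestronglyMeasurable ?_
    exact ((continuous_const.add continuous_abs).rpow_const fun _ => Or.inr hq).mul
      K.continuous.norm
  · rw [Real.norm_of_nonneg (by positivity)]
    have h2 : (1 + |v|) ^ q ≤ (1 + |v|) ^ (m : ℝ) :=
      Real.rpow_le_rpow_of_exponent_le (by linarith [abs_nonneg v]) hm
    have h3 := add_rpow_le_two_rpow_mul (p := m) (by positivity) zero_le_one (abs_nonneg v)
    rw [Real.one_rpow, Real.rpow_natCast |v|] at h3
    calc _ ≤ (2 ^ (m : ℝ) * (1 + |v| ^ m)) * ‖K v‖ := by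
          gcongr
          exact h2.trans h3
      _ = _ := by simp; ring

/-- The convolution of `f` with the kernel `K`, compressed by the factor `X`, along vertical
lines. -/
noncomputable def vertConv (K : SchwartzMap ℝ ℂ) (X : ℝ) (f : ℂ → ℂ) (s : ℂ) : ℂ :=
  ∫ v : ℝ, f (s + (v / X : ℝ) * Complex.I) * K v

theorem abs_div_le {v X : ℝ} (hX : 1 ≤ X) : |v / X| ≤ |v| := by
  rw [abs_div]
  exact div_le_self (abs_nonneg v) (hX.trans (le_abs_self X))

namespace BoundedMeans

variable {p σ₀ C : ℝ} {f : ℂ → ℂ}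

theorem continuous_vert (hf : BoundedMeans p σ₀ C f) {s : ℂ} (hs : σ₀ < s.re) (X : ℝ) :
    Continuous fun v : ℝ => f (s + (v / X : ℝ) * Complex.I) :=
  hf.continuous_comp (by fun_prop) (fun v => by simpa using hs)

theorem integrable_vertConv (hf : BoundedMeans p σ₀ C f) (hp : 1 ≤ p) {X : ℝ} (hX : 1 ≤ X) {s : ℂ}
    (hs : σ₀ < s.re) (K : SchwartzMap ℝ ℂ) :
    Integrable fun v : ℝ => f (s + (v / X : ℝ) * Complex.I) * K v := by
  obtain ⟨σ₁, h1, h2⟩ := exists_between hs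
  obtain ⟨G, hG, hGb⟩ := hf.exists_growth hp h1
  refine ((integrable_one_add_abs_rpow_mul K zero_le_one).const_mul (G * (1 + |s.im|))).mono'
    ((hf.continuous_vert hs X).mul K.continuous).aestronglyMeasurable
    (Eventually.of_forall fun v => ?_)
  have h3 := hGb (s + (v / X : ℝ) * Complex.I) (by simpa using h2)
  have h4 : |(s + (v / X : ℝ) * Complex.I).im| ≤ |s.im| + |v| := by
    simp only [Complex.add_im, Complex.im_ofReal_mul, Complex.I_im, mul_one]
    exact (abs_add_le _ _).trans (add_le_add le_rfl (abs_div_le hX))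
  rw [norm_mul, Real.rpow_one, ← mul_assoc]
  gcongr
  calc _ ≤ G * (1 + (|s.im| + |v|)) := h3.trans (by gcongr)
    _ ≤ G * ((1 + |s.im|) * (1 + |v|)) := by
      gcongr
      nlinarith [abs_nonneg s.im, abs_nonneg v]
    _ = _ := by ring

theorem differentiableOn_vertConv (hf : BoundedMeans p σ₀ C f) (hp : 1 ≤ p) {X : ℝ} (hX : 1 ≤ X)
    (K : SchwartzMap ℝ ℂ) : DifferentiableOn ℂ (vertConv K X f) {s | σ₀ < s.re} := by
  intro s hs
  have hs' : σ₀ < s.re := hs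
  obtain ⟨σ₁, h1, h2⟩ := exists_between hs'
  have hd := hf.deriv hp (sub_pos.2 h1)
  rw [add_sub_cancel] at hd
  obtain ⟨σ₂, h3, h4⟩ := exists_between h2
  obtain ⟨G, hG, hGb⟩ := hd.exists_growth hp h3
  have hU : {z : ℂ | σ₂ < z.re} ∩ Metric.ball s 1 ∈ 𝓝 s :=
    inter_mem ((isOpen_re_gt σ₂).mem_nhds h4) (Metric.ball_mem_nhds s one_pos)
  have key := hasDerivAt_integral_of_dominated_loc_of_deriv_le (𝕜 := ℂ) (μ := volume)
    (F := fun z (v : ℝ) => f (z + (v / X : ℝ) * Complex.I) * K v)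
    (F' := fun z (v : ℝ) => _root_.deriv f (z + (v / X : ℝ) * Complex.I) * K v)
    (bound := fun v => (G * (2 + |s.im|)) * ((1 + |v|) ^ (1 : ℝ) * ‖K v‖))
    hU ?_ (hf.integrable_vertConv hp hX hs' K) ?_ (Eventually.of_forall fun v z hz => ?_)
    ((integrable_one_add_abs_rpow_mul K zero_le_one).const_mul _)
    (Eventually.of_forall fun v z hz => ?_)
  · exact key.2.differentiableAt.differentiableWithinAt
  · filter_upwards [(isOpen_re_gt σ₀).mem_nhds hs'] with z hz
    exact ((hf.continuous_vert hz X).mul K.continuous).aestronglyMeasurable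
  · exact ((hd.continuous_vert h2 X).mul K.continuous).aestronglyMeasurable
  · have h5 := hGb (z + (v / X : ℝ) * Complex.I) (by simpa using hz.1)
    have h6 : |z.im| ≤ |s.im| + 1 := by
      have h7 := (Complex.abs_im_le_norm (z - s)).trans (mem_ball_iff_norm.1 hz.2).le
      have h8 := abs_add_le (z - s).im s.im
      rw [Complex.sub_im, sub_add_cancel] at h8
      rw [Complex.sub_im] at h7
      linarith
    have h9 : |(z + (v / X : ℝ) * Complex.I).im| ≤ |s.im| + 1 + |v| := by
      simp only [Complex.add_im, Complex.im_ofReal_mul, Complex.I_im, mul_one]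
      exact (abs_add_le _ _).trans (add_le_add h6 (abs_div_le hX))
    rw [norm_mul, Real.rpow_one, ← mul_assoc]
    gcongr
    calc _ ≤ G * (1 + (|s.im| + 1 + |v|)) := h5.trans (by gcongr)
      _ ≤ G * ((2 + |s.im|) * (1 + |v|)) := by
        gcongr
        nlinarith [abs_nonneg s.im, abs_nonneg v]
      _ = _ := by ring
  · have hz' : σ₀ < (z + (v / X : ℝ) * Complex.I).re := by
      have : σ₂ < z.re := hz.1
      simp; linarith
    have h5 := (hf.differentiableAt hz').hasDerivAt
    have h6 : HasDerivAt (fun z : ℂ => z + (v / X : ℝ) * Complex.I) 1 z :=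
      (hasDerivAt_id z).add_const _
    have h7 := h5.comp z h6
    rw [mul_one] at h7
    exact h7.mul_const (K v)

/-- The convolution converges to the function in the mean, at a rate that is uniform in every
smaller half-plane. The linear growth of `f` makes the double integral absolutely convergent; the
rate comes from the estimate for vertical translation by `v / X`. -/
theorem exists_integral_vertConv_sub_le (hf : BoundedMeans p σ₀ C f) (hp : 1 ≤ p) {σ₁ : ℝ}
    (h01 : σ₀ < σ₁) (K : SchwartzMap ℝ ℂ) (hK : ∫ v, K v = 1) :
    ∃ A : ℝ, 0 ≤ A ∧ ∀ X, 1 ≤ X → ∀ σ, σ₁ < σ → ∀ T, 1 ≤ T →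
      ∫ t in (-T)..T, ‖vertConv K X f (σ + t * Complex.I) - f (σ + t * Complex.I)‖ ^ p ≤
        2 * T * (A * X⁻¹ ^ p) := by
  have hp0 : 0 < p := by linarith
  have hd := hf.deriv hp (sub_pos.2 h01)
  rw [add_sub_cancel] at hd
  set C' := (σ₁ - σ₀)⁻¹ ^ p * ((1 + (σ₁ - σ₀)) * C)
  have hC' := hd.const_nonneg
  obtain ⟨G, hG, hGb⟩ := hf.exists_growth hp h01
  set N := ∫ v, ‖K v‖
  set N' := ∫ v, (1 + |v|) ^ (p + 1) * ‖K v‖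
  have hN : 0 ≤ N := integral_nonneg fun v => norm_nonneg _
  have hN' : 0 ≤ N' := integral_nonneg fun v => by positivity
  refine ⟨N ^ (p - 1) * (C' * N'), by positivity, fun X hX σ hσ T hT => ?_⟩
  have hf1 := hf.mono h01.le
  have hX0 : 0 < X := by linarith
  let Φ : ℝ → ℝ → ℝ := fun t v =>
    ‖f (σ + (t + v / X : ℝ) * Complex.I) - f (σ + t * Complex.I)‖ ^ p * ‖K v‖
  have hcΦ : Continuous (Function.uncurry Φ) := by
    have h1 : Continuous fun x : ℝ × ℝ => f (σ + (x.1 + x.2 / X : ℝ) * Complex.I) :=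
      hf1.continuous_comp (by fun_prop) (fun x => by simpa using hσ)
    have h2 : Continuous fun x : ℝ × ℝ => f (σ + x.1 * Complex.I) :=
      hf1.continuous_comp (by fun_prop) (fun x => by simpa using hσ)
    exact ((h1.sub h2).norm.rpow_const fun _ => Or.inr hp0.le).mul
      (K.continuous.norm.comp continuous_snd)
  have hΦ0 : ∀ t v, 0 ≤ Φ t v := fun t v => by positivity
  have hbd : ∀ t v, Φ t v ≤ (2 * G * (1 + |t|)) ^ p * ((1 + |v|) ^ p * ‖K v‖) := by
    intro t v
    have h1 := hGb (σ + (t + v / X : ℝ) * Complex.I) (by simpa using hσ)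
    have h2 := hGb (σ + t * Complex.I) (by simpa using hσ)
    have h3 : ((σ : ℂ) + (t + v / X : ℝ) * Complex.I).im = t + v / X := by simp
    have h4 : ((σ : ℂ) + t * Complex.I).im = t := by simp
    rw [h3] at h1
    rw [h4] at h2
    have h5 : |t + v / X| ≤ |t| + |v| := (abs_add_le _ _).trans (add_le_add le_rfl (abs_div_le hX))
    have h6 : ‖f (σ + (t + v / X : ℝ) * Complex.I) - f (σ + t * Complex.I)‖ ≤
        2 * G * (1 + |t|) * (1 + |v|) := by
      refine (norm_sub_le _ _).trans ?_
      have h7 : G * (1 + |t + v / X|) ≤ G * (1 + (|t| + |v|)) := by gcongr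
      have h8 : 0 ≤ G * (|t| * |v|) := by positivity
      have h9 : 0 ≤ G * |v| := by positivity
      nlinarith
    simp only [Φ]
    rw [← mul_assoc, ← Real.mul_rpow (by positivity) (by positivity)]
    gcongr
  have hKp := integrable_one_add_abs_rpow_mul K hp0.le
  have hIt : ∀ t, Integrable (Φ t) := fun t =>
    (hKp.const_mul ((2 * G * (1 + |t|)) ^ p)).mono'
      (hcΦ.comp (by fun_prop : Continuous fun v : ℝ => (t, v))).aestronglyMeasurable
      (Eventually.of_forall fun v => by
        rw [Real.norm_of_nonneg (hΦ0 t v)]; exact hbd t v)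
  have hI : Integrable (Function.uncurry Φ) ((volume.restrict (Set.Ioc (-T) T)).prod volume) := by
    have h1 : Integrable (fun x : ℝ × ℝ => (2 * G * (1 + T)) ^ p * ((1 + |x.2|) ^ p * ‖K x.2‖))
        ((volume.restrict (Set.Ioc (-T) T)).prod volume) :=
      (integrable_const ((2 * G * (1 + T)) ^ p)).mul_prod hKp
    refine h1.mono' hcΦ.aestronglyMeasurable ?_
    have h2 : ∀ᵐ x ∂((volume.restrict (Set.Ioc (-T) T)).prod (volume : Measure ℝ)),
        x.1 ∈ Set.Ioc (-T) T :=
      Measure.quasiMeasurePreserving_fst.ae (ae_restrict_mem measurableSet_Ioc)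
    filter_upwards [h2] with x hx
    have h3 : |x.1| ≤ T := abs_le.2 ⟨hx.1.le, hx.2⟩
    change ‖Φ x.1 x.2‖ ≤ _
    rw [Real.norm_of_nonneg (hΦ0 x.1 x.2)]
    refine (hbd x.1 x.2).trans ?_
    gcongr
  have hpt : ∀ t : ℝ, ‖vertConv K X f (σ + t * Complex.I) - f (σ + t * Complex.I)‖ ^ p ≤
      N ^ (p - 1) * ∫ v, Φ t v := by
    intro t
    have hs : σ₁ < ((σ : ℂ) + t * Complex.I).re := by simpa using hσ
    have h1 : vertConv K X f (σ + t * Complex.I) - f (σ + t * Complex.I) =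
        ∫ v : ℝ, (f (σ + (t + v / X : ℝ) * Complex.I) - f (σ + t * Complex.I)) * K v := by
      have h2 := integral_sub (hf1.integrable_vertConv hp hX hs K)
        (K.integrable.const_mul (f (σ + t * Complex.I)))
      rw [integral_const_mul, hK, mul_one] at h2
      rw [vertConv, ← h2]
      congr 1
      ext v
      rw [sub_mul]
      congr 3
      push_cast
      ring
    have h3 : Continuous fun v : ℝ =>
        f (σ + (t + v / X : ℝ) * Complex.I) - f (σ + t * Complex.I) :=
      (hf1.continuous_comp (by fun_prop) (fun v => by simpa using hσ)).sub continuous_const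
    rw [h1]
    exact norm_integral_mul_rpow_le hp h3.aestronglyMeasurable K.integrable (hIt t)
  have hinner : ∀ v, ∫ t in Set.Ioc (-T) T, Φ t v ≤
      2 * T * (C' * X⁻¹ ^ p) * ((1 + |v|) ^ (p + 1) * ‖K v‖) := by
    intro v
    have h1 := hf1.integral_norm_sub_le hp hd hσ hT (v / X)
    rw [intervalIntegral.integral_of_le (by linarith)] at h1
    simp only [Φ]
    rw [integral_mul_const, ← mul_assoc]
    refine mul_le_mul_of_nonneg_right (h1.trans ?_) (norm_nonneg _)
    have h2 : |v / X| ^ p = X⁻¹ ^ p * |v| ^ p := by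
      rw [abs_div, abs_of_pos hX0, div_eq_inv_mul, Real.mul_rpow (by positivity) (by positivity)]
    have h3 : |v| ^ p ≤ (1 + |v|) ^ p :=
      Real.rpow_le_rpow (abs_nonneg v) (by linarith [abs_nonneg v]) hp0.le
    have h4 : T + |v / X| ≤ T * (1 + |v|) := by
      have := abs_div_le (v := v) hX
      nlinarith [abs_nonneg v]
    have h5 : (1 + |v|) ^ (p + 1) = (1 + |v|) ^ p * (1 + |v|) := by
      rw [Real.rpow_add_one (by positivity)]
    rw [h2, h5]
    calc X⁻¹ ^ p * |v| ^ p * (2 * (T + |v / X|) * C')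
        ≤ X⁻¹ ^ p * (1 + |v|) ^ p * (2 * (T * (1 + |v|)) * C') := by gcongr
      _ = _ := by ring
  have hcG : ContinuousOn (vertConv K X f) {s | σ₁ < s.re} :=
    (hf1.differentiableOn_vertConv hp hX K).continuousOn
  have hcL : Continuous fun t : ℝ =>
      ‖vertConv K X f (σ + t * Complex.I) - f (σ + t * Complex.I)‖ ^ p :=
    ((hcG.comp_continuous (by fun_prop) (fun t => by simpa using hσ)).sub
      (hf1.continuous_line_zero hσ)).norm.rpow_const fun _ => Or.inr hp0.le
  rw [intervalIntegral.integral_of_le (by linarith)]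
  calc _ ≤ ∫ t in Set.Ioc (-T) T, N ^ (p - 1) * ∫ v, Φ t v :=
        integral_mono hcL.integrableOn_Ioc (hI.integral_prod_left.const_mul _) hpt
    _ = N ^ (p - 1) * ∫ v, ∫ t in Set.Ioc (-T) T, Φ t v := by
        rw [integral_const_mul, integral_integral_swap hI]
    _ ≤ N ^ (p - 1) * ∫ v, 2 * T * (C' * X⁻¹ ^ p) * ((1 + |v|) ^ (p + 1) * ‖K v‖) := by
        refine mul_le_mul_of_nonneg_left ?_ (by positivity)
        exact integral_mono hI.integral_prod_right
          ((integrable_one_add_abs_rpow_mul K (by linarith)).const_mul _) hinner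
    _ = _ := by
        rw [integral_const_mul]
        ring

end BoundedMeans

/-! ### Convolution turns the Dirichlet series into Dirichlet polynomials -/

/-- A Dirichlet series that converges in some half-plane converges absolutely in a smaller one. -/
theorem exists_hasSum {a : ℕ → ℂ} {f : ℂ → ℂ}
    (h : ∃ κ : ℝ, ∀ s : ℂ, κ < s.re → SeriesConvergesTo a s (f s)) :
    ∃ κ : ℝ, ∀ s : ℂ, κ < s.re → HasSum (fun n : ℕ+ => a n * (n : ℂ) ^ (-s)) (f s) := by
  obtain ⟨κ, hκ⟩ := h
  have h0 := hκ (κ + 1 : ℝ) (by simp)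
  have h1 : Tendsto (fun N : ℕ => a (N + 1) * ((N + 1 : ℕ) : ℂ) ^ (-((κ + 1 : ℝ) : ℂ))) atTop
      (𝓝 0) := by
    have h2 := ((tendsto_add_atTop_iff_nat 1).2 h0).sub h0
    rw [sub_self] at h2
    refine h2.congr fun N => ?_
    rw [Finset.sum_Icc_succ_top (by omega), add_sub_cancel_left]
  obtain ⟨B, hB⟩ := h1.norm.bddAbove_range
  have hB' : ∀ n : ℕ+, ‖a n‖ * (n : ℝ) ^ (-(κ + 1)) ≤ B := by
    intro n
    have := hB ⟨n.natPred, rfl⟩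
    simp only [PNat.natPred_add_one, norm_mul] at this
    rwa [norm_natCast_cpow_neg, Complex.ofReal_re] at this
  refine ⟨κ + 3, fun s hs => ?_⟩
  have hsum : Summable fun n : ℕ+ => a n * (n : ℂ) ^ (-s) := by
    have h3 : Summable fun n : ℕ+ => B * ((n : ℕ) : ℝ) ^ (-2 : ℝ) :=
      ((Real.summable_nat_rpow.2 (by norm_num)).comp_injective PNat.coe_injective).mul_left B
    refine h3.of_norm_bounded fun n => ?_
    have hn : (1 : ℝ) ≤ (n : ℕ) := by exact_mod_cast n.pos
    rw [norm_mul, norm_natCast_cpow_neg]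
    have h4 : ((n : ℕ) : ℝ) ^ (-s.re) ≤ ((n : ℕ) : ℝ) ^ (-(κ + 1)) * ((n : ℕ) : ℝ) ^ (-2 : ℝ) := by
      rw [← Real.rpow_add (by linarith)]
      exact Real.rpow_le_rpow_of_exponent_le hn (by linarith)
    calc _ ≤ ‖a n‖ * (((n : ℕ) : ℝ) ^ (-(κ + 1)) * ((n : ℕ) : ℝ) ^ (-2 : ℝ)) := by gcongr
      _ = (‖a n‖ * ((n : ℕ) : ℝ) ^ (-(κ + 1))) * ((n : ℕ) : ℝ) ^ (-2 : ℝ) := by ring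
      _ ≤ _ := by gcongr; exact hB' n
  obtain ⟨ℓ, hℓ⟩ := hsum
  have h5 : HasSum (fun n : ℕ => if n = 0 then 0 else a n * (n : ℂ) ^ (-s)) ℓ := by
    rw [← PNat.coe_injective.hasSum_iff]
    · have h6 : ((fun n : ℕ => if n = 0 then 0 else a n * (n : ℂ) ^ (-s)) ∘ fun n : ℕ+ => (n : ℕ)) =
          fun n : ℕ+ => a n * (n : ℂ) ^ (-s) := by
        ext n
        simp [n.ne_zero]
      rw [h6]
      exact hℓ
    · intro n hn
      rw [if_pos]
      by_contra h
      exact hn ⟨⟨n, Nat.pos_of_ne_zero h⟩, rfl⟩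
  have h6 := (tendsto_add_atTop_iff_nat 1).2 h5.tendsto_sum_nat
  have h7 : ℓ = f s := by
    refine tendsto_nhds_unique h6 ((hκ s (by linarith)).congr fun N => ?_)
    rw [Finset.range_eq_Ico, Finset.sum_eq_sum_Ico_succ_bot (by omega), if_pos rfl, zero_add]
    refine Finset.sum_congr (by ext; simp) fun n hn => ?_
    rw [if_neg (by simp at hn; omega)]
  rwa [h7] at hℓ

open FourierTransform in
theorem integral_cpow_mul (K : SchwartzMap ℝ ℂ) (X : ℝ) (n : ℕ+) (s : ℂ) :
    ∫ v : ℝ, (n : ℂ) ^ (-(s + (v / X : ℝ) * Complex.I)) * K v =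
      (n : ℂ) ^ (-s) * (𝓕 K) (Real.log n / (2 * Real.pi * X)) := by
  rw [SchwartzMap.fourier_coe, Real.fourier_eq', ← integral_const_mul]
  congr 1
  ext v
  rw [neg_add, Complex.cpow_add _ _ (by simp), natCast_cpow_neg_eq_exp n (_ * Complex.I),
    smul_eq_mul, mul_assoc]
  congr 3
  have hpi : (Real.pi : ℂ) ≠ 0 := by exact_mod_cast Real.pi_ne_zero
  simp only [RCLike.inner_apply, conj_trivial]
  push_cast
  rcases eq_or_ne X 0 with rfl | hX
  · simp
  have hX' : (X : ℂ) ≠ 0 := by exact_mod_cast hX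
  field_simp

open FourierTransform in
/-- In the half-plane of absolute convergence the convolution acts on the coefficients as a
multiplier. -/
theorem hasSum_vertConv {a : ℕ → ℂ} {f : ℂ → ℂ} {κ : ℝ}
    (h : ∀ s : ℂ, κ < s.re → HasSum (fun n : ℕ+ => a n * (n : ℂ) ^ (-s)) (f s))
    (K : SchwartzMap ℝ ℂ) (X : ℝ) {s : ℂ} (hs : κ < s.re) :
    HasSum (fun n : ℕ+ => (a n * (𝓕 K) (Real.log n / (2 * Real.pi * X))) * (n : ℂ) ^ (-s))
      (vertConv K X f s) := by
  have hre : ∀ v : ℝ, (s + (v / X : ℝ) * Complex.I).re = s.re := fun v => by simp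
  have hF : ∀ n : ℕ+, Integrable fun v : ℝ =>
      a n * (n : ℂ) ^ (-(s + (v / X : ℝ) * Complex.I)) * K v := by
    intro n
    refine (K.integrable.norm.const_mul (‖a n‖ * (n : ℝ) ^ (-s.re))).mono' ?_
      (Eventually.of_forall fun v => ?_)
    · refine Continuous.aestronglyMeasurable ?_
      simp only [natCast_cpow_neg_eq_exp]
      have := K.continuous
      fun_prop
    · rw [norm_mul, norm_mul, norm_natCast_cpow_neg, hre]
  have hnorm : ∀ n : ℕ+, ∫ v : ℝ, ‖a n * (n : ℂ) ^ (-(s + (v / X : ℝ) * Complex.I)) * K v‖ =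
      ‖a n * (n : ℂ) ^ (-s)‖ * ∫ v, ‖K v‖ := by
    intro n
    rw [← integral_const_mul]
    congr 1
    ext v
    rw [norm_mul, norm_mul, norm_natCast_cpow_neg, hre, norm_mul, norm_natCast_cpow_neg]
  have key := hasSum_integral_of_summable_integral_norm hF (by
    simp only [hnorm]
    exact ((h s hs).summable.norm).mul_right _)
  have h1 : ∀ v : ℝ, ∑' n : ℕ+, a n * (n : ℂ) ^ (-(s + (v / X : ℝ) * Complex.I)) * K v =
      f (s + (v / X : ℝ) * Complex.I) * K v := fun v =>
    ((h _ (by rw [hre]; exact hs)).mul_right _).tsum_eq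
  have h2 : ∀ n : ℕ+, ∫ v : ℝ, a n * (n : ℂ) ^ (-(s + (v / X : ℝ) * Complex.I)) * K v =
      (a n * (𝓕 K) (Real.log n / (2 * Real.pi * X))) * (n : ℂ) ^ (-s) := fun n => by
    simp only [mul_assoc, integral_const_mul, integral_cpow_mul]
    ring
  simpa only [h1, h2, vertConv] using key

/-- A smooth function on the line that is `1` near `0` and has compact support. -/
noncomputable def cutoff : ContDiffBump (0 : ℝ) := ⟨1, 2, one_pos, one_lt_two⟩

theorem hasCompactSupport_cutoff : HasCompactSupport fun x : ℝ => (cutoff x : ℂ) :=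
  cutoff.hasCompactSupport.comp_left (g := fun x : ℝ => (x : ℂ)) Complex.ofReal_zero

theorem contDiff_cutoff : ContDiff ℝ (⊤ : ℕ∞) fun x : ℝ => (cutoff x : ℂ) :=
  Complex.ofRealCLM.contDiff.comp cutoff.contDiff

open FourierTransform in
/-- The inverse Fourier transform of the cutoff function. Convolution with it cuts off the
coefficients of a Dirichlet series. -/
noncomputable def kernel : SchwartzMap ℝ ℂ :=
  𝓕⁻ (hasCompactSupport_cutoff.toSchwartzMap contDiff_cutoff)

open FourierTransform in
theorem fourier_kernel (x : ℝ) : (𝓕 kernel : SchwartzMap ℝ ℂ) x = (cutoff x : ℂ) := by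
  rw [kernel, FourierInvPair.fourier_fourierInv_eq]
  rfl

open FourierTransform in
theorem integral_kernel : ∫ v, kernel v = 1 := by
  have h := fourier_kernel 0
  rw [SchwartzMap.fourier_coe, Real.fourier_eq', cutoff.one_of_mem_closedBall (by simp [cutoff])]
    at h
  simpa using h

/-- The Dirichlet polynomial with coefficients `a n`, cut off smoothly between
`n = exp (2 * π * X)` and `n = exp (4 * π * X)`. It is meant for `X ≥ 1` only; the value `0` for other
`X` ensures that the support is finite. -/
noncomputable def cutoffPoly (a : ℕ → ℂ) (X : ℝ) : ℕ+ →₀ ℂ :=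
  Finsupp.onFinset (Finset.Icc 1 ⌈Real.exp (4 * Real.pi * X)⌉₊.succPNat)
    (fun n => if 1 ≤ X then a n * cutoff (Real.log n / (2 * Real.pi * X)) else 0) fun n hn => by
    split_ifs at hn with hX
    · have h1 : (cutoff (Real.log n / (2 * Real.pi * X)) : ℂ) ≠ 0 := right_ne_zero_of_mul hn
      have h2 : Real.log n / (2 * Real.pi * X) < 2 := by
        by_contra hcon
        refine h1 ?_
        rw [cutoff.zero_of_le_dist, Complex.ofReal_zero]
        rw [Real.dist_eq, sub_zero]
        exact (not_lt.1 hcon).trans (le_abs_self _)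
      have hpos : 0 < 2 * Real.pi * X := by positivity
      rw [div_lt_iff₀ hpos] at h2
      have h3 : ((n : ℕ) : ℝ) < Real.exp (4 * Real.pi * X) := by
        rw [← Real.log_lt_iff_lt_exp (by exact_mod_cast n.pos)]
        linarith
      have h4 : ((n : ℕ) : ℝ) < (⌈Real.exp (4 * Real.pi * X)⌉₊ : ℕ) := h3.trans_le (Nat.le_ceil _)
      have h5 : (n : ℕ) < ⌈Real.exp (4 * Real.pi * X)⌉₊ := by exact_mod_cast h4
      rw [Finset.mem_Icc]
      refine ⟨one_le, ?_⟩
      rw [← PNat.coe_le_coe]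
      change (n : ℕ) ≤ ⌈Real.exp (4 * Real.pi * X)⌉₊ + 1
      omega
    · exact absurd rfl hn

theorem cutoffPoly_apply (a : ℕ → ℂ) {X : ℝ} (hX : 1 ≤ X) (n : ℕ+) :
    cutoffPoly a X n = a n * cutoff (Real.log n / (2 * Real.pi * X)) := by
  simp [cutoffPoly, hX]

theorem tendsto_cutoffPoly (a : ℕ → ℂ) (n : ℕ+) :
    Tendsto (fun X : ℝ => cutoffPoly a X n) atTop (𝓝 (a n)) := by
  have h1 : Tendsto (fun X : ℝ => Real.log n / (2 * Real.pi * X)) atTop (𝓝 0) :=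
    tendsto_const_nhds.div_atTop (tendsto_id.const_mul_atTop (by positivity))
  have h2 := ((Complex.continuous_ofReal.comp cutoff.continuous).tendsto 0).comp h1
  rw [Function.comp_apply, cutoff.one_of_mem_closedBall (by simp [cutoff])] at h2
  have h3 := h2.const_mul (a n)
  rw [Complex.ofReal_one, mul_one] at h3
  refine h3.congr' ?_
  filter_upwards [eventually_ge_atTop 1] with X hX
  rw [cutoffPoly_apply a hX]
  rfl

/-- The convolution of `f` is a Dirichlet polynomial in the half-plane of absolute convergence, and
by the identity theorem in the whole half-plane `Re s > 0`. -/
theorem vertConv_eq_evalPoly {p C κ : ℝ} (hp : 1 ≤ p) {a : ℕ → ℂ} {f : ℂ → ℂ}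
    (hf : BoundedMeans p 0 C f)
    (h : ∀ s : ℂ, κ < s.re → HasSum (fun n : ℕ+ => a n * (n : ℂ) ^ (-s)) (f s))
    {X : ℝ} (hX : 1 ≤ X) {s : ℂ} (hs : 0 < s.re) :
    vertConv kernel X f s = evalPoly (cutoffPoly a X) s := by
  have hU := isOpen_re_gt 0
  have h1 : AnalyticOnNhd ℂ (vertConv kernel X f) {s | 0 < s.re} :=
    (hf.differentiableOn_vertConv hp hX kernel).analyticOnNhd hU
  have h2 : AnalyticOnNhd ℂ (evalPoly (cutoffPoly a X)) {s | 0 < s.re} :=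
    (differentiable_evalPoly _).differentiableOn.analyticOnNhd hU
  have hz : max κ 0 < (((max κ 0 + 1 : ℝ) : ℂ)).re := by simp
  refine h1.eqOn_of_preconnected_of_eventuallyEq h2
    (convex_halfSpace_re_gt 0).isPreconnected (z₀ := ((max κ 0 + 1 : ℝ) : ℂ))
    (lt_of_le_of_lt (le_max_right _ _) hz) ?_ hs
  filter_upwards [(isOpen_re_gt (max κ 0)).mem_nhds hz] with z hz
  have h3 := hasSum_vertConv h kernel X (lt_of_le_of_lt (le_max_left _ _) hz)
  simp only [fourier_kernel, ← cutoffPoly_apply a hX] at h3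
  refine h3.unique (hasSum_sum_of_ne_finset_zero (s := (cutoffPoly a X).support) fun n hn => ?_)
  rw [Finsupp.notMem_support_iff.1 hn, zero_mul]

/-- A function with bounded means that is the sum of a Dirichlet series is approximated in the mean
by Dirichlet polynomials, uniformly in every half-plane `Re s > δ > 0`. -/
theorem exists_approx {p C : ℝ} (hp : 1 ≤ p) {a : ℕ → ℂ} {f : ℂ → ℂ}
    (hf : BoundedMeans p 0 C f)
    (h : ∃ κ : ℝ, ∀ s : ℂ, κ < s.re → SeriesConvergesTo a s (f s)) :
    ∃ P : ℕ → ℕ+ →₀ ℂ, (∀ n, Tendsto (fun k => P k n) atTop (𝓝 (a n))) ∧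
      ∀ δ > 0, ∃ e : ℕ → ℝ, Tendsto e atTop (𝓝 0) ∧
        ∀ k σ, δ < σ → ∀ T, 1 ≤ T →
          truncMean p σ (fun s => evalPoly (P k) s - f s) T ^ (1 / p) ≤ e k := by
  have hp0 : 0 < p := by linarith
  obtain ⟨κ, hκ⟩ := exists_hasSum h
  have hX : Tendsto (fun k : ℕ => (k : ℝ) + 1) atTop atTop :=
    tendsto_atTop_add_const_right _ _ tendsto_natCast_atTop_atTop
  refine ⟨fun k => cutoffPoly a (k + 1), fun n => (tendsto_cutoffPoly a n).comp hX,
    fun δ hδ => ?_⟩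
  obtain ⟨A, hA, hAb⟩ := hf.exists_integral_vertConv_sub_le hp hδ kernel integral_kernel
  refine ⟨fun k => A ^ (1 / p) * ((k : ℝ) + 1)⁻¹, ?_,
    fun k σ hσ T hT => ?_⟩
  · simpa using (tendsto_inv_atTop_zero.comp hX).const_mul (A ^ (1 / p))
  · have h1 : (1 : ℝ) ≤ (k : ℝ) + 1 := by
      have : (0 : ℝ) ≤ k := Nat.cast_nonneg k
      linarith
    have h2 := hAb _ h1 σ hσ T hT
    have h3 : truncMean p σ (fun s => evalPoly (cutoffPoly a (k + 1)) s - f s) T ≤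
        A * ((k : ℝ) + 1)⁻¹ ^ p := by
      have hT0 : 0 < T := by linarith
      have h4 : ∀ t : ℝ, vertConv kernel ((k : ℝ) + 1) f (σ + t * Complex.I) =
          evalPoly (cutoffPoly a (k + 1)) (σ + t * Complex.I) := fun t =>
        vertConv_eq_evalPoly hp hf hκ h1 (by simp; linarith)
      simp only [h4] at h2
      rw [truncMean, one_div, inv_mul_le_iff₀ (by positivity)]
      exact h2
    calc _ ≤ (A * ((k : ℝ) + 1)⁻¹ ^ p) ^ (1 / p) :=
          Real.rpow_le_rpow (truncMean_nonneg _ _ _ (by linarith)) h3 (by positivity)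
      _ = _ := by
          rw [Real.mul_rpow hA (by positivity), ← Real.rpow_mul (by positivity),
            mul_one_div_cancel hp0.ne', Real.rpow_one]

/-! ### Means of limits of Dirichlet polynomials -/

theorem truncMean_sub_comm (p σ : ℝ) (f g : ℂ → ℂ) :
    truncMean p σ (fun s => f s - g s) = truncMean p σ (fun s => g s - f s) := by
  funext T
  simp only [truncMean, norm_sub_rev (f _)]

theorem truncMean_rpow_le_add {p : ℝ} (hp : 1 ≤ p) (σ : ℝ) {f g : ℂ → ℂ}
    (hf : Continuous fun t : ℝ => f (σ + t * Complex.I))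
    (hg : Continuous fun t : ℝ => g (σ + t * Complex.I)) {T : ℝ} (hT : 0 < T) :
    truncMean p σ f T ^ (1 / p) ≤
      truncMean p σ g T ^ (1 / p) + truncMean p σ (fun s => f s - g s) T ^ (1 / p) := by
  have h := truncMean_add_le (f := g) (g := fun s => f s - g s) hp σ hg (hf.sub hg) hT
  simpa using h

theorem continuous_evalPoly_line (P : ℕ+ →₀ ℂ) (σ : ℝ) :
    Continuous fun t : ℝ => evalPoly P (σ + t * Complex.I) :=
  continuous_of_mem_trig (evalPoly_line_mem_trig P σ)

/-- A function that is approximated in the mean by Dirichlet polynomials has a mean, and it is the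
limit of the means of the polynomials. -/
theorem meanExists_of_approx {p : ℝ} (hp : 1 ≤ p) {σ : ℝ} {f : ℂ → ℂ}
    (hf : Continuous fun t : ℝ => f (σ + t * Complex.I)) {P : ℕ → ℕ+ →₀ ℂ} {e : ℕ → ℝ}
    (he : Tendsto e atTop (𝓝 0))
    (h : ∀ k, ∀ T, 1 ≤ T → truncMean p σ (fun s => evalPoly (P k) s - f s) T ^ (1 / p) ≤ e k) :
    MeanExists p σ f ∧
      Tendsto (fun k => Mean p σ (evalPoly (P k))) atTop (𝓝 (Mean p σ f)) := by
  have hp0 : 0 < p := by linarith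
  have hclose : ∀ k, ∀ T, 1 ≤ T →
      |truncMean p σ f T ^ (1 / p) - truncMean p σ (evalPoly (P k)) T ^ (1 / p)| ≤ e k := by
    intro k T hT
    have hT0 : 0 < T := by linarith
    have hc := continuous_evalPoly_line (P k) σ
    have h1 := truncMean_rpow_le_add hp σ hf hc hT0
    have h2 := truncMean_rpow_le_add hp σ hc hf hT0
    rw [truncMean_sub_comm] at h1
    have h3 := h k T hT
    rw [abs_le]
    constructor <;> linarith
  have hlim := fun k => (meanExists_evalPoly hp0 σ (P k)).tendsto hp0
  obtain ⟨L, hL⟩ : ∃ L, Tendsto (fun T => truncMean p σ f T ^ (1 / p)) atTop (𝓝 L) := by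
    refine cauchySeq_tendsto_of_complete (Metric.cauchySeq_iff'.2 fun r hr => ?_)
    obtain ⟨k, hk⟩ := (he.eventually (gt_mem_nhds (by positivity : 0 < r / 4))).exists
    obtain ⟨N, hN⟩ := eventually_atTop.1 (((hlim k).eventually (Metric.ball_mem_nhds _
      (by positivity : 0 < r / 4))).and (eventually_ge_atTop 1))
    refine ⟨N, fun T hT => ?_⟩
    have a1 := abs_le.1 (hclose k T (hN T hT).2)
    have a2 := abs_le.1 (hclose k N (hN N le_rfl).2)
    have b1 := (hN T hT).1
    have b2 := (hN N le_rfl).1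
    rw [Real.dist_eq, abs_lt] at b1 b2
    rw [Real.dist_eq, abs_lt]
    constructor <;> linarith [a1.1, a1.2, a2.1, a2.2, b1.1, b1.2, b2.1, b2.2]
  have hL0 : 0 ≤ L := ge_of_tendsto hL ((eventually_gt_atTop 0).mono fun T hT =>
    Real.rpow_nonneg (truncMean_nonneg p σ f hT) _)
  have hLp : Tendsto (truncMean p σ f) atTop (𝓝 (L ^ p)) := by
    refine (hL.rpow_const (Or.inr hp0.le)).congr' ?_
    filter_upwards [eventually_gt_atTop 0] with T hT
    rw [← Real.rpow_mul (truncMean_nonneg p σ _ hT), one_div_mul_cancel hp0.ne', Real.rpow_one]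
  refine ⟨⟨_, hLp⟩, ?_⟩
  rw [mean_rpow_eq_of_tendsto hp0 hLp hL0, tendsto_iff_dist_tendsto_zero]
  refine squeeze_zero (fun _ => dist_nonneg) (fun k => ?_) he
  rw [dist_comm, Real.dist_eq]
  exact le_of_tendsto (hL.sub (hlim k)).abs
    ((eventually_ge_atTop 1).mono fun T hT => hclose k T hT)

/-- Polynomials that approximate the same function in the mean form a Cauchy sequence. -/
theorem mean_sub_le_of_approx {p : ℝ} (hp : 1 ≤ p) {σ : ℝ} {f : ℂ → ℂ}
    (hf : Continuous fun t : ℝ => f (σ + t * Complex.I)) {P : ℕ → ℕ+ →₀ ℂ} {e : ℕ → ℝ}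
    (h : ∀ k, ∀ T, 1 ≤ T → truncMean p σ (fun s => evalPoly (P k) s - f s) T ^ (1 / p) ≤ e k)
    (j k : ℕ) : Mean p σ (evalPoly (P j - P k)) ≤ e j + e k := by
  have hp0 : 0 < p := by linarith
  refine le_of_tendsto ((meanExists_evalPoly hp0 σ (P j - P k)).tendsto hp0)
    ((eventually_ge_atTop 1).mono fun T hT => ?_)
  have h1 := truncMean_add_le (f := fun s => evalPoly (P j) s - f s)
    (g := fun s => f s - evalPoly (P k) s) hp σ ((continuous_evalPoly_line _ σ).sub hf)
    (hf.sub (continuous_evalPoly_line _ σ)) (T := T) (by linarith)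
  rw [truncMean_sub_comm p σ f] at h1
  have h2 : evalPoly (P j - P k) =
      fun s => evalPoly (P j) s - f s + (f s - evalPoly (P k) s) := by
    ext s; rw [evalPoly_sub]; ring
  rw [h2]
  exact h1.trans (add_le_add (h j T hT) (h k T hT))

/-! ### The norm of translated polynomials in the Hardy space -/

section HardySpace

variable (p : ℝ) [hp : Fact (1 ≤ p)]

/-- The polynomial `P(· + η)` as an element of the Hardy space. -/
noncomputable def translate (η : ℝ) (P : ℕ+ →₀ ℂ) : HardySpace p :=
  UniformSpace.Completion.coe' (α := DirichletPolynomial p) (shift η P)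

/-- By monotonicity, the supremum over `σ > 0` that defines the norm does not exceed the mean on the
imaginary axis. -/
theorem norm_le_mean_zero (P : DirichletPolynomial p) : ‖P‖ ≤ Mean p 0 (evalPoly P) := by
  have : Nonempty (Set.Ioi (0 : ℝ)) := ⟨⟨1, by simp⟩⟩
  exact ciSup_le fun σ => antitoneOn_mean_evalPoly hp.out P (Set.mem_Ici.2 le_rfl)
    (Set.mem_Ici.2 (Set.mem_Ioi.1 σ.2).le) (Set.mem_Ioi.1 σ.2).le

theorem norm_translate (η : ℝ) (P : ℕ+ →₀ ℂ) :
    ‖translate p η P‖ = norm (E := DirichletPolynomial p) (shift η P) :=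
  UniformSpace.Completion.norm_coe (E := DirichletPolynomial p) _

theorem translate_sub (η : ℝ) (P Q : ℕ+ →₀ ℂ) :
    translate p η (P - Q) = translate p η P - translate p η Q := by
  have h : (shift η (P - Q) : ℕ+ →₀ ℂ) = shift η P - shift η Q := map_sub _ _ _
  rw [translate, h]
  exact UniformSpace.Completion.coe_sub (α := DirichletPolynomial p) _ _

theorem norm_translate_le (η : ℝ) (P : ℕ+ →₀ ℂ) :
    ‖translate p η P‖ ≤ Mean p η (evalPoly P) := by
  rw [norm_translate]
  refine (norm_le_mean_zero p _).trans_eq ?_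
  rw [mean_shift_ofReal, add_zero]

theorem mean_le_norm_translate {η σ : ℝ} (h : η < σ) (P : ℕ+ →₀ ℂ) :
    Mean p σ (evalPoly P) ≤ ‖translate p η P‖ := by
  rw [norm_translate]
  refine le_trans (le_of_eq ?_) (mean_le_norm hp.out _ (sub_pos.2 h))
  rw [mean_shift_ofReal, add_sub_cancel]

theorem translate_sub_translate (η η' : ℝ) (P : ℕ+ →₀ ℂ) :
    translate p η P - translate p η' P =
      UniformSpace.Completion.coe' (α := DirichletPolynomial p) (shift η P - shift η' P) :=
  (UniformSpace.Completion.coe_sub (α := DirichletPolynomial p) _ _).symm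

theorem norm_translate_sub_translate_le (η η' : ℝ) (P : ℕ+ →₀ ℂ) :
    ‖translate p η P - translate p η' P‖ ≤ Mean p 0 (evalPoly (shift η P - shift η' P)) := by
  rw [translate_sub_translate]
  exact (UniformSpace.Completion.norm_coe (E := DirichletPolynomial p) _).trans_le
    (norm_le_mean_zero p _)

theorem mean_shift_sub_le_norm {s τ : ℝ} (h : τ < s) (η η' : ℝ) (P : ℕ+ →₀ ℂ) :
    Mean p s (evalPoly (shift η P - shift η' P)) ≤
      ‖translate p (τ + η) P - translate p (τ + η') P‖ := by
  refine (mean_le_norm_translate p h _).trans_eq ?_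
  rw [translate_sub]
  have h1 : ∀ x : ℝ, translate p τ (shift x P) = translate p (τ + x) P := fun x => by
    rw [translate, translate, shift_shift, ← Complex.ofReal_add]
  rw [h1, h1]

theorem continuous_translate (P : ℕ+ →₀ ℂ) : Continuous fun η : ℝ => translate p η P := by
  let L : DirichletPolynomial p →L[ℂ] HardySpace p := UniformSpace.Completion.toComplL
  let v : ℕ+ → DirichletPolynomial p := fun n => (Finsupp.single n (P n) : ℕ+ →₀ ℂ)
  have h : (fun η : ℝ => translate p η P) =
      fun η : ℝ => ∑ n ∈ P.support, ((n : ℂ) ^ (-(η : ℂ))) • L (v n) := by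
    funext η
    have h1 : (shift η P : DirichletPolynomial p) =
        ∑ n ∈ P.support, ((n : ℂ) ^ (-(η : ℂ))) • v n := shift_eq_sum η P
    change L (shift η P) = _
    rw [h1, map_sum]
    exact Finset.sum_congr rfl fun n _ => map_smul L _ _
  rw [h]
  simp only [natCast_cpow_neg_eq_exp]
  fun_prop

theorem continuous_coeff (n : ℕ+) : Continuous (coeff p n) :=
  UniformSpace.Completion.continuous_extension

theorem coeff_translate (n : ℕ+) (η : ℝ) (P : ℕ+ →₀ ℂ) :
    coeff p n (translate p η P) = (n : ℂ) ^ (-(η : ℂ)) * P n :=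
  (coeff_coe p n _).trans (shift_apply η P n)

end HardySpace

/-! ### Functions approximated in the mean by Dirichlet polynomials -/

theorem tendsto_two_mul_nhdsGT_zero : Tendsto (fun x : ℝ => 2 * x) (𝓝[>] 0) (𝓝[>] 0) := by
  have h : Tendsto (fun x : ℝ => 2 * x) (𝓝 0) (𝓝 (2 * 0)) := Continuous.tendsto (by fun_prop) _
  rw [mul_zero] at h
  exact tendsto_nhdsWithin_iff.2 ⟨h.mono_left nhdsWithin_le_nhds,
    eventually_nhdsWithin_of_forall fun x hx => Set.mem_Ioi.2 (mul_pos two_pos hx)⟩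

/-- The Dirichlet polynomials `P k` converge to `f` in the mean of order `p` over long vertical
segments, uniformly in every half-plane `Re s > δ > 0`. -/
structure ApproxInMean (p : ℝ) (f : ℂ → ℂ) (P : ℕ → ℕ+ →₀ ℂ) : Prop where
  continuous_line : ∀ σ : ℝ, 0 < σ → Continuous fun t : ℝ => f (σ + t * Complex.I)
  exists_error : ∀ δ > 0, ∃ e : ℕ → ℝ, Tendsto e atTop (𝓝 0) ∧
    ∀ k σ, δ < σ → ∀ T, 1 ≤ T →
      truncMean p σ (fun s => evalPoly (P k) s - f s) T ^ (1 / p) ≤ e k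

namespace ApproxInMean

section Mean

variable {p : ℝ} {f : ℂ → ℂ} {P : ℕ → ℕ+ →₀ ℂ}

theorem meanExists_and_tendsto (h : ApproxInMean p f P) (hp : 1 ≤ p) {σ : ℝ} (hσ : 0 < σ) :
    MeanExists p σ f ∧
      Tendsto (fun k => Mean p σ (evalPoly (P k))) atTop (𝓝 (Mean p σ f)) := by
  obtain ⟨e, he, hb⟩ := h.exists_error (σ / 2) (by positivity)
  exact meanExists_of_approx hp (h.continuous_line σ hσ) he
    fun k T hT => hb k σ (by linarith) T hT

theorem mean_nonneg (h : ApproxInMean p f P) (hp : 1 ≤ p) {σ : ℝ} (hσ : 0 < σ) :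
    0 ≤ Mean p σ f :=
  (h.meanExists_and_tendsto hp hσ).1.mean_nonneg (by linarith)

theorem antitoneOn_mean (h : ApproxInMean p f P) (hp : 1 ≤ p) :
    AntitoneOn (fun σ => Mean p σ f) (Set.Ioi 0) := fun _ hx _ hy hxy =>
  le_of_tendsto_of_tendsto' (h.meanExists_and_tendsto hp hy).2 (h.meanExists_and_tendsto hp hx).2
    fun k => antitoneOn_mean_evalPoly hp (P k) (Set.mem_Ici.2 (Set.mem_Ioi.1 hx).le)
      (Set.mem_Ici.2 (Set.mem_Ioi.1 hy).le) hxy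

theorem mean_le_interp (h : ApproxInMean p f P) (hp : 1 ≤ p) {l u x : ℝ} (hl : 0 < l)
    (hlu : l < u) (hx : x ∈ Set.Icc l u) :
    Mean p x f ≤ Mean p l f ^ (1 - (x - l) / (u - l)) * Mean p u f ^ ((x - l) / (u - l)) := by
  have h1 : 0 ≤ (x - l) / (u - l) := div_nonneg (by linarith [hx.1]) (by linarith)
  have h2 : (x - l) / (u - l) ≤ 1 := (div_le_one (by linarith)).2 (by linarith [hx.2])
  exact le_of_tendsto_of_tendsto' (h.meanExists_and_tendsto hp (hl.trans_le hx.1)).2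
    (((h.meanExists_and_tendsto hp hl).2.rpow_const (Or.inr (by linarith))).mul
      ((h.meanExists_and_tendsto hp (hl.trans hlu)).2.rpow_const (Or.inr h1)))
    fun k => DirichletHardy.mean_le_interp hp (P k) hlu hx

theorem norm_coeff_mul_le_mean (h : ApproxInMean p f P) (hp : 1 ≤ p) {σ : ℝ} (hσ : 0 < σ)
    {n : ℕ+} {c : ℂ} (hc : Tendsto (fun k => P k n) atTop (𝓝 c)) :
    ‖c‖ * (n : ℝ) ^ (-σ) ≤ Mean p σ f :=
  le_of_tendsto_of_tendsto' (hc.norm.mul_const _) (h.meanExists_and_tendsto hp hσ).2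
    fun k => DirichletHardy.norm_coeff_mul_le_mean hp σ (P k) n

theorem convexOn_log_mean (h : ApproxInMean p f P) (hp : 1 ≤ p)
    (hpos : ∀ σ : ℝ, 0 < σ → 0 < Mean p σ f) :
    ConvexOn ℝ (Set.Ioi 0) fun σ : ℝ => Real.log (Mean p σ f) := by
  refine LinearOrder.convexOn_of_lt (convex_Ioi 0) fun l hl u hu hlu α β hα hβ hαβ => ?_
  have hl' : 0 < l := hl
  have hu' : 0 < u := hu
  have hd : 0 < u - l := sub_pos.2 hlu
  simp only [smul_eq_mul]
  have hβ' : (α * l + β * u - l) / (u - l) = β := by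
    rw [div_eq_iff hd.ne']
    obtain rfl : α = 1 - β := by linarith
    ring
  have hx : α * l + β * u ∈ Set.Icc l u := by
    obtain rfl : α = 1 - β := by linarith
    constructor <;> nlinarith
  have h1 := h.mean_le_interp hp hl' hlu hx
  rw [hβ', show 1 - β = α by linarith] at h1
  have h2 := Real.log_le_log (hpos _ (hl'.trans_le hx.1)) h1
  rwa [Real.log_mul (Real.rpow_pos_of_pos (hpos _ hl') _).ne'
    (Real.rpow_pos_of_pos (hpos _ hu') _).ne', Real.log_rpow (hpos _ hl'),
    Real.log_rpow (hpos _ hu')] at h2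

end Mean

/-! ### The boundary value in the Hardy space -/

variable {p : ℝ} [hp : Fact (1 ≤ p)] {f : ℂ → ℂ} {P : ℕ → ℕ+ →₀ ℂ}

/-- The translates `f(· + η)` are elements `F η` of the Hardy space, approximated by the translates
of the polynomials uniformly in `η > δ > 0`. -/
theorem exists_translate (h : ApproxInMean p f P) : ∃ F : ℝ → HardySpace p,
    ∀ δ > 0, ∃ e : ℕ → ℝ, Tendsto e atTop (𝓝 0) ∧
      ∀ k η, δ < η → ‖F η - translate p η (P k)‖ ≤ e k := by
  have hsub : ∀ δ > 0, ∃ e : ℕ → ℝ, Tendsto e atTop (𝓝 0) ∧ ∀ j k η, δ < η →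
      ‖translate p η (P j) - translate p η (P k)‖ ≤ e j + e k := by
    intro δ hδ
    obtain ⟨e, he, hb⟩ := h.exists_error δ hδ
    refine ⟨e, he, fun j k η hη => ?_⟩
    rw [← translate_sub]
    exact (norm_translate_le p η _).trans (mean_sub_le_of_approx hp.out
      (h.continuous_line η (hδ.lt.trans hη)) (fun k T hT => hb k η hη T hT) j k)
  have hlim : ∀ η : ℝ, ∃ G : HardySpace p, 0 < η →
      Tendsto (fun k => translate p η (P k)) atTop (𝓝 G) := by
    intro η
    by_cases hη : 0 < η
    · obtain ⟨e, he, hb⟩ := hsub (η / 2) (by positivity)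
      obtain ⟨G, hG⟩ : ∃ G, Tendsto (fun k => translate p η (P k)) atTop (𝓝 G) := by
        refine cauchySeq_tendsto_of_complete (Metric.cauchySeq_iff.2 fun r hr => ?_)
        obtain ⟨N, hN⟩ := eventually_atTop.1 (he.eventually (gt_mem_nhds (half_pos hr)))
        refine ⟨N, fun j hj k hk => ?_⟩
        rw [dist_eq_norm]
        linarith [hb j k η (by linarith), hN j hj, hN k hk]
      exact ⟨G, fun _ => hG⟩
    · exact ⟨0, fun h => absurd h hη⟩
  choose F hF using hlim
  refine ⟨F, fun δ hδ => ?_⟩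
  obtain ⟨e, he, hb⟩ := hsub δ hδ
  refine ⟨e, he, fun k η hη => ?_⟩
  have h1 := he.add_const (e k)
  rw [zero_add] at h1
  exact le_of_tendsto_of_tendsto' ((hF η (hδ.lt.trans hη)).sub_const _).norm h1
    fun j => hb j k η hη

/-- The translates `F η` of `f` converge in the Hardy space as `η → 0+`, if the means are bounded.
In the estimate `mean_shift_sub_rpow_le`, the constant `ε` is made small first; then `s`, so that the
means of `f` vary little on `(0, 2 s]`; then `η` and `η'`. -/
theorem exists_boundary_value (h : ApproxInMean p f P) {B : ℝ}
    (hB : ∀ σ : ℝ, 0 < σ → Mean p σ f ≤ B) :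
    ∃ F : HardySpace p, Tendsto (fun σ : ℝ => Mean p σ f) (𝓝[>] 0) (𝓝 ‖F‖) ∧
      ∀ (n : ℕ+) (c : ℂ), Tendsto (fun k => P k n) atTop (𝓝 c) → coeff p n F = c := by
  have hp1 := hp.out
  have hp0 : 0 < p := by linarith
  obtain ⟨F, hF⟩ := h.exists_translate
  have hFlim : ∀ η > 0, Tendsto (fun k => translate p η (P k)) atTop (𝓝 (F η)) := by
    intro η hη
    obtain ⟨e, he, hb⟩ := hF (η / 2) (half_pos hη)
    rw [tendsto_iff_norm_sub_tendsto_zero]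
    refine squeeze_zero (fun _ => norm_nonneg _) (fun k => ?_) he
    rw [norm_sub_rev]
    exact hb k η (half_lt_self hη)
  have hM : ∀ {σ : ℝ}, 0 < σ → Tendsto (fun k => Mean p σ (evalPoly (P k))) atTop
    (𝓝 (Mean p σ f)) := fun hσ => (h.meanExists_and_tendsto hp1 hσ).2
  have hle : ∀ η > 0, ‖F η‖ ≤ Mean p η f := fun η hη =>
    le_of_tendsto_of_tendsto' (hFlim η hη).norm (hM hη) fun k => norm_translate_le p η (P k)
  -- the norm of `F η` dominates the means to the right of `η` only; `2 * η` is one such abscissa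
  have hge : ∀ η > 0, Mean p (2 * η) f ≤ ‖F η‖ := fun η hη =>
    le_of_tendsto_of_tendsto' (hM (by linarith)) (hFlim η hη).norm
      fun k => mean_le_norm_translate p (by linarith) (P k)
  have hcont : ∀ τ > 0, ContinuousAt F τ := by
    intro τ hτ
    obtain ⟨e, he, hb⟩ := hF (τ / 2) (half_pos hτ)
    refine continuousAt_of_locally_uniform_approx_of_continuousAt fun u hu => ?_
    obtain ⟨r, hr, hru⟩ := Metric.mem_uniformity_dist.1 hu
    obtain ⟨k, hk⟩ := (he.eventually (gt_mem_nhds hr)).exists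
    refine ⟨_, Ioi_mem_nhds (half_lt_self hτ), fun η => translate p η (P k),
      (continuous_translate p (P k)).continuousAt, fun η hη => hru ?_⟩
    rw [dist_eq_norm]
    exact (hb k η hη).trans_lt hk
  have hkey : ∀ {η η' s ε : ℝ}, 0 < η → 0 < η' → 0 < s → 0 < ε → ε ≤ convexityConst p →
      ‖F η - F η'‖ ^ p ≤ 4 ^ p *
        ((ε + convexityConst p / ε) * Mean p η f ^ p +
          (ε - convexityConst p / ε) * Mean p (η + s) f ^ p +
        ((ε + convexityConst p / ε) * Mean p η' f ^ p +
          (ε - convexityConst p / ε) * Mean p (η' + s) f ^ p) +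
        ‖F (s / 2 + η) - F (s / 2 + η')‖ ^ p) := by
    intro η η' s ε hη hη' hs hε hε1
    have hMp : ∀ {σ : ℝ}, 0 < σ → Tendsto (fun k => Mean p σ (evalPoly (P k)) ^ p) atTop
      (𝓝 (Mean p σ f ^ p)) := fun hσ => (hM hσ).rpow_const (Or.inr hp0.le)
    have hlhs := ((hFlim η hη).sub (hFlim η' hη')).norm.rpow_const (p := p) (Or.inr hp0.le)
    have hrhs := ((hFlim (s / 2 + η) (by positivity)).sub
      (hFlim (s / 2 + η') (by positivity))).norm.rpow_const (p := p) (Or.inr hp0.le)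
    refine le_of_tendsto_of_tendsto' hlhs
      ((((((hMp hη).const_mul _).add ((hMp (by positivity)).const_mul _)).add
        (((hMp hη').const_mul _).add ((hMp (by positivity)).const_mul _))).add hrhs).const_mul _)
      fun k => ?_
    have h1 := norm_translate_sub_translate_le p η η' (P k)
    have h2 := mean_shift_sub_le_norm p (half_lt_self hs) η η' (P k)
    have h3 := (meanExists_evalPoly hp0 s (shift η (P k) - shift η' (P k))).mean_nonneg hp0
    refine (Real.rpow_le_rpow (norm_nonneg _) h1 hp0.le).trans
      ((mean_shift_sub_rpow_le hp1 (P k) η η' hs hε hε1).trans ?_)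
    gcongr
  obtain ⟨L, hL⟩ : ∃ L, Tendsto (fun σ : ℝ => Mean p σ f) (𝓝[>] 0) (𝓝 L) :=
    ⟨_, (h.antitoneOn_mean hp1).tendsto_nhdsGT ⟨B, by rintro _ ⟨σ, hσ, rfl⟩; exact hB σ hσ⟩⟩
  have hmL : ∀ σ > 0, Mean p σ f ≤ L := fun σ hσ => ge_of_tendsto hL <| by
    filter_upwards [Ioo_mem_nhdsGT hσ] with x hx
    exact h.antitoneOn_mean hp1 hx.1 hσ hx.2.le
  have hC := convexityConst_pos p
  have hcauchy : Cauchy (map F (𝓝[>] 0)) := by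
    refine cauchy_map_iff.2 ⟨inferInstance, Metric.uniformity_basis_dist.tendsto_right_iff.2
      fun r hr => ?_⟩
    obtain ⟨ε, hε, hε1, hεr⟩ : ∃ ε, 0 < ε ∧ ε ≤ convexityConst p ∧
        4 ^ p * (4 * ε * L ^ p) < r ^ p / 2 := by
      have h1 : Tendsto (fun ε : ℝ => 4 ^ p * (4 * ε * L ^ p)) (𝓝[>] 0)
          (𝓝 (4 ^ p * (4 * 0 * L ^ p))) :=
        (Continuous.tendsto (by fun_prop) _).mono_left nhdsWithin_le_nhds
      rw [mul_zero, zero_mul, mul_zero] at h1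
      obtain ⟨ε, h2, h3⟩ := ((h1.eventually (gt_mem_nhds
        (by positivity : 0 < r ^ p / 2))).and (Ioc_mem_nhdsGT hC)).exists
      exact ⟨ε, h3.1, h3.2, h2⟩
    obtain ⟨s, hs, hsr⟩ : ∃ s, 0 < s ∧ 4 ^ p *
        (4 * ε * L ^ p + 2 * (convexityConst p / ε) * (L ^ p - Mean p (2 * s) f ^ p)) <
          r ^ p / 2 := by
      have h1 := ((((hL.comp tendsto_two_mul_nhdsGT_zero).rpow_const (p := p)
        (Or.inr hp0.le)).const_sub (L ^ p)).const_mul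
        (2 * (convexityConst p / ε))).const_add (4 * ε * L ^ p) |>.const_mul ((4 : ℝ) ^ p)
      rw [sub_self, mul_zero, add_zero] at h1
      obtain ⟨s, h2, h3⟩ := ((h1.eventually (gt_mem_nhds hεr)).and
        self_mem_nhdsWithin).exists
      exact ⟨s, h3, h2⟩
    have hG : Tendsto (fun η : ℝ => F (s / 2 + η)) (𝓝[>] 0) (𝓝 (F (s / 2))) := by
      refine Tendsto.mono_left ?_ nhdsWithin_le_nhds
      refine (hcont (s / 2) (by positivity)).tendsto.comp ?_
      have : Tendsto (fun η : ℝ => s / 2 + η) (𝓝 0) (𝓝 (s / 2 + 0)) :=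
        Continuous.tendsto (by fun_prop) _
      rwa [add_zero] at this
    have hGG : Tendsto (fun x : ℝ × ℝ => 4 ^ p * ‖F (s / 2 + x.1) - F (s / 2 + x.2)‖ ^ p)
        (𝓝[>] 0 ×ˢ 𝓝[>] 0) (𝓝 0) := by
      have := (((hG.comp tendsto_fst).sub (hG.comp tendsto_snd)).norm.rpow_const (p := p)
        (Or.inr hp0.le)).const_mul ((4 : ℝ) ^ p)
      rwa [sub_self, norm_zero, Real.zero_rpow hp0.ne', mul_zero] at this
    filter_upwards [hGG.eventually (gt_mem_nhds (by positivity : 0 < r ^ p / 2)),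
      prod_mem_prod (Ioc_mem_nhdsGT hs) (Ioc_mem_nhdsGT hs)] with x hx hxs
    obtain ⟨⟨h1, h1s⟩, h2, h2s⟩ := hxs
    have hm : ∀ {η : ℝ}, 0 < η → η ≤ s →
        (ε + convexityConst p / ε) * Mean p η f ^ p +
          (ε - convexityConst p / ε) * Mean p (η + s) f ^ p ≤
        2 * ε * L ^ p + convexityConst p / ε * (L ^ p - Mean p (2 * s) f ^ p) := by
      intro η hη hηs
      have a1 := Real.rpow_le_rpow (h.mean_nonneg hp1 hη) (hmL η hη) hp0.le
      have a2 := Real.rpow_le_rpow (h.mean_nonneg hp1 (by positivity))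
        (hmL (η + s) (by positivity)) hp0.le
      have a3 := Real.rpow_le_rpow (h.mean_nonneg hp1 (by positivity)) (h.antitoneOn_mean hp1
        (Set.mem_Ioi.2 (by positivity : 0 < η + s)) (Set.mem_Ioi.2 (by positivity : 0 < 2 * s))
        (by linarith)) hp0.le
      have a4 := mul_le_mul_of_nonneg_left a1 hε.le
      have a5 := mul_le_mul_of_nonneg_left a2 hε.le
      have a6 := mul_le_mul_of_nonneg_left (sub_le_sub a1 a3) (div_pos hC hε).le
      linarith
    have h3 := hkey h1 h2 hs hε hε1
    have h4 := mul_le_mul_of_nonneg_left (add_le_add (hm h1 h1s) (hm h2 h2s))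
      (by positivity : (0 : ℝ) ≤ 4 ^ p)
    rw [dist_eq_norm]
    rw [← Real.rpow_lt_rpow_iff (norm_nonneg _) hr.le hp0]
    linarith
  obtain ⟨F₀, hF₀⟩ := cauchy_map_iff_exists_tendsto.1 hcauchy
  have hnorm : ‖F₀‖ = L := by
    exact le_antisymm
      (le_of_tendsto_of_tendsto hF₀.norm hL (eventually_nhdsWithin_of_forall hle))
      (le_of_tendsto_of_tendsto (hL.comp tendsto_two_mul_nhdsGT_zero) hF₀.norm
        (eventually_nhdsWithin_of_forall hge))
  refine ⟨F₀, hnorm ▸ hL, fun n c hc => ?_⟩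
  have hcoeff : ∀ η > 0, coeff p n (F η) = (n : ℂ) ^ (-(η : ℂ)) * c := fun η hη => by
    refine tendsto_nhds_unique (((continuous_coeff p n).tendsto _).comp (hFlim η hη)) ?_
    simp only [Function.comp_def, coeff_translate]
    exact hc.const_mul _
  have hpow : Tendsto (fun η : ℝ => (n : ℂ) ^ (-(η : ℂ)) * c) (𝓝[>] 0) (𝓝 c) := by
    have h1 : Continuous fun η : ℝ => (n : ℂ) ^ (-(η : ℂ)) * c := by
      simp only [natCast_cpow_neg_eq_exp]
      fun_prop
    have h2 := (h1.tendsto 0).mono_left (nhdsWithin_le_nhds (s := Set.Ioi 0))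
    simpa using h2
  exact tendsto_nhds_unique (((continuous_coeff p n).tendsto _).comp hF₀)
    (hpow.congr' (eventually_nhdsWithin_of_forall fun η hη => (hcoeff η hη).symm))

end ApproxInMean

/-! ### Positivity of the means and the hypothesis on the means -/

/-- By the identity theorem, `f` vanishes if all its Dirichlet coefficients do. -/
theorem eq_zero_of_coeff_eq_zero {a : ℕ → ℂ} {f : ℂ → ℂ}
    (hf : AnalyticOnNhd ℂ f {s : ℂ | 0 < s.re})
    (h : ∃ κ : ℝ, ∀ s : ℂ, κ < s.re → SeriesConvergesTo a s (f s))
    (ha : ∀ n : ℕ+, a n = 0) {s : ℂ} (hs : 0 < s.re) : f s = 0 := by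
  obtain ⟨κ, hκ⟩ := exists_hasSum h
  have hz : ∀ z : ℂ, κ < z.re → f z = 0 := fun z hz =>
    (hκ z hz).unique (by simp [ha])
  have h1 : f =ᶠ[𝓝 ((max κ 0 + 1 : ℝ) : ℂ)] 0 := by
    filter_upwards [(isOpen_re_gt κ).mem_nhds (show κ < (((max κ 0 + 1 : ℝ) : ℂ)).re by
      rw [Complex.ofReal_re]; linarith [le_max_left κ 0])] with z hzκ
    exact hz z hzκ
  exact hf.eqOn_zero_of_preconnected_of_eventuallyEq_zero
    (convex_halfSpace_re_gt 0).isPreconnected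
    (show 0 < (((max κ 0 + 1 : ℝ) : ℂ)).re by
      rw [Complex.ofReal_re]; linarith [le_max_right κ 0]) h1 hs

theorem mean_eq_zero {p : ℝ} (hp : 0 < p) {f : ℂ → ℂ} (h : ∀ s : ℂ, 0 < s.re → f s = 0) {σ : ℝ}
    (hσ : 0 < σ) : Mean p σ f = 0 := by
  refine mean_rpow_eq_of_tendsto hp ?_ le_rfl
  have h1 : truncMean p σ f = fun _ => 0 := by
    funext T
    have h2 : ∀ t : ℝ, f (σ + t * Complex.I) = 0 := fun t => h _ (by simpa using hσ)
    simp [truncMean, h2, Real.zero_rpow hp.ne']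
  rw [h1, Real.zero_rpow hp.ne']
  exact tendsto_const_nhds

theorem boundedMeans_of_truncMean_le {p C : ℝ} {f : ℂ → ℂ}
    (hf : DifferentiableOn ℂ f {s : ℂ | 0 < s.re})
    (h : ∀ σ : ℝ, 0 < σ → ∀ T : ℝ, 1 ≤ T → truncMean p σ f T ≤ C) : BoundedMeans p 0 C f where
  differentiableOn := hf
  integral_le σ hσ T hT := by
    have h1 := h σ hσ T hT
    rwa [truncMean, one_div, inv_mul_le_iff₀ (by linarith)] at h1

end DirichletHardy

theorem theorem1p1 (p : ℝ) [Fact (1 ≤ p)] (a : ℕ → ℂ) (f : ℂ → ℂ)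
    (hf : AnalyticOnNhd ℂ f {s : ℂ | 0 < s.re})
    (hseries : ∃ κ : ℝ, ∀ s : ℂ, κ < s.re → DirichletHardy.SeriesConvergesTo a s (f s))
    (hbound : ∃ C : ℝ, ∀ σ : ℝ, 0 < σ → ∀ T : ℝ, 1 ≤ T → DirichletHardy.truncMean p σ f T ≤ C) :
    (∀ σ : ℝ, 0 < σ → DirichletHardy.MeanExists p σ f) ∧
    (((∃ s : ℂ, 0 < s.re ∧ f s ≠ 0) → ∀ σ : ℝ, 0 < σ → 0 < DirichletHardy.Mean p σ f) ∧
      AntitoneOn (fun σ : ℝ => Real.log (DirichletHardy.Mean p σ f)) (Set.Ioi 0) ∧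
      ConvexOn ℝ (Set.Ioi 0) (fun σ : ℝ => Real.log (DirichletHardy.Mean p σ f))) ∧
    (∃ F : DirichletHardy.HardySpace p,
      (∀ n : ℕ+, DirichletHardy.coeff p n F = a n) ∧
      Tendsto (fun σ : ℝ => DirichletHardy.Mean p σ f) (𝓝[>] 0) (𝓝 ‖F‖)) := by
  have hp : 1 ≤ p := Fact.out
  have hp0 : 0 < p := by linarith
  obtain ⟨C, hC⟩ := hbound
  have hbm := DirichletHardy.boundedMeans_of_truncMean_le hf.differentiableOn hC
  obtain ⟨P, hPa, hPf⟩ := DirichletHardy.exists_approx hp hbm hseries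
  have h : DirichletHardy.ApproxInMean p f P := ⟨fun _ hσ => hbm.continuous_line_zero hσ, hPf⟩
  have hmean := fun σ (hσ : (0 : ℝ) < σ) => (h.meanExists_and_tendsto hp hσ).1
  have hpos : (∃ s : ℂ, 0 < s.re ∧ f s ≠ 0) →
      ∀ σ : ℝ, 0 < σ → 0 < DirichletHardy.Mean p σ f := by
    rintro ⟨s, hs, hne⟩ σ hσ
    obtain ⟨n, hn⟩ : ∃ n : ℕ+, a n ≠ 0 := by
      by_contra! hzero
      exact hne (DirichletHardy.eq_zero_of_coeff_eq_zero hf hseries hzero hs)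
    have hn' : (0 : ℝ) < n := by exact_mod_cast n.pos
    exact (mul_pos (norm_pos_iff.2 hn) (Real.rpow_pos_of_pos hn' _)).trans_le
      (h.norm_coeff_mul_le_mean hp hσ (hPa n))
  refine ⟨hmean, ⟨hpos, ?_⟩, ?_⟩
  · by_cases hne : ∃ s : ℂ, 0 < s.re ∧ f s ≠ 0
    · exact ⟨fun x hx y hy hxy => Real.log_le_log (hpos hne y hy) (h.antitoneOn_mean hp hx hy hxy),
        h.convexOn_log_mean hp (hpos hne)⟩
    · -- here `f` vanishes identically, and both claims hold by the convention `Real.log 0 = 0`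
      push Not at hne
      have hlog : Set.EqOn (fun _ => (0 : ℝ))
          (fun σ : ℝ => Real.log (DirichletHardy.Mean p σ f)) (Set.Ioi 0) := fun σ hσ => by
        simp only [DirichletHardy.mean_eq_zero hp0 hne hσ, Real.log_zero]
      exact ⟨antitoneOn_const.congr hlog, (convexOn_const 0 (convex_Ioi 0)).congr hlog⟩
  · have hB : ∀ σ : ℝ, 0 < σ → DirichletHardy.Mean p σ f ≤ C ^ (1 / p) := fun σ hσ => by
      refine le_of_tendsto ((hmean σ hσ).tendsto hp0)
        ((eventually_ge_atTop 1).mono fun T hT => ?_)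
      exact Real.rpow_le_rpow (DirichletHardy.truncMean_nonneg p σ f (by linarith)) (hC σ hσ T hT)
        (by positivity)
    obtain ⟨F, hF, hcoeff⟩ := h.exists_boundary_value hB
    exact ⟨F, fun n => hcoeff n _ (hPa n), hF⟩
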